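/- Let $K$ be a commutative $\mathbb Q$-algebra. **Bimodules.** A $K$-bimodule $(B,M,A,\rho)$ consists of $K$-algebras $A,B$, a right $A$-module $M$ and a $K$-algebra morphism $\rho:B\to\mathrm{End}_{A}(M)$. It is *filtered* (resp. *graded*) if $B$, $M$, $A$ carry decreasing filtrations $F^\bullet$ (resp. gradings) indexed by $\mathbb Z$, multiplicative on $B$ and $A$ and compatible with both actions on $M$. A morphism $(B,M,A,\rho)\to(B',M',A',\rho')$ of graded bimodules is a triple $(g,\varphi,f)$ of degree-preserving $K$-linear maps, with $g:B\to B'$, $f:A\to A'$ algebra morphisms and $\varphi:M\to M'$ satisfying $\varphi(ma)=\varphi(m)f(a)$, $\varphi(\rho(b)m)=\rho'(g(b))\varphi(m)$. A filtered bimodule has an associated graded bimodule $(\mathrm{gr}B,\mathrm{gr}M,\mathrm{gr}A,\mathrm{gr}\rho)$, where $\mathrm{gr}_n=F^n/F^{n+1}$; write $[x]_n$ for the class in $\mathrm{gr}_n$ of $x\in F^n$. A *factorization structure* on a filtered bimodule is a triple $(e,r,c)$ with $e\in F^1B$ and right $A$-module morphisms $r:M\to A$, $c:A\to M$ such that $\rho(e)=c\circ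 r$, $r(F^nM)\subset F^nA$, $c(F^nA)\subset F^{n+1}M$ for all $n$; on a graded bimodule it is such a triple with $e,r,c$ of degrees $1,0,1$. Let $\mathrm{BFS}_{fil}$ and $\mathrm{BFS}_{gr}$ be the corresponding classes of filtered, resp. graded, bimodules with factorization structure; the morphisms of $\mathrm{BFS}_{gr}$ are the graded bimodule morphisms $(g,\varphi,f)$ with $g(e)=e'$, $f\circ r=r'\circ\varphi$, $\varphi\circ c=c'\circ f$. For $O\in \mathrm{BFS}_{fil}$, $\mathrm{gr}(O)\in\mathrm{BFS}_{gr}$ is the graded bimodule with factorization structure $([e]_1,\ [m]_n\mapsto[r(m)]_n,\ [a]_n\mapsto[c(a)]_{n+1})$. **Betti side.** Let $F_2$ be the free group on $X_0,X_1$ and $V^B=KF_2$. Let $K_4$ be the pure braid group on four strands, generated by $x_{ij}$ $(1\le i<j\le 4)$ subject to: $abc$ commutes with $a$, $b$, $c$ for $(a,b,c)=(x_{ij},x_{ik},x_{jk})$, $i<j<k$; and $(x_{12},x_{34})=(x_{13},x_{12}^{-1}x_{24}x_{12})=(x_{14},x_{23})=1$, where $(g,h)$ is the group commutator. Let $\omega_4=x_{12}x_{13}x_{23}x_{14}x_{24}x_{34}$,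 which generates the center of $K_4$, and $P_5^*=K_4/\langle\omega_4\rangle$. In $P_5^*$ put $x_{15}=(x_{12}x_{13}x_{14})^{-1}$, $x_{25}=(x_{12}x_{23}x_{24})^{-1}$, $x_{35}=(x_{13}x_{23}x_{34})^{-1}$. Group morphisms $\mathrm{pr}_1,\mathrm{pr}_2,\mathrm{pr}_5:P_5^*\to F_2$ are defined by $$\begin{array}{c|cccccc} & x_{12}&x_{13}&x_{14}&x_{23}&x_{24}&x_{34}\\\hline \mathrm{pr}_1&1&1&1&X_0&(X_1X_0)^{-1}&X_1\\ \mathrm{pr}_2&1&(X_0X_1)^{-1}&X_0&1&1&X_1\\ \mathrm{pr}_5&X_1&(X_0X_1)^{-1}&X_0&X_0&(X_1X_0)^{-1}&X_1\end{array}$$ and $\ell:F_2\to P_5^*$ by $X_0\mapsto x_{23}$, $X_1\mapsto x_{12}$ (a section of $\mathrm{pr}_5$). Let $K\mathrm{pr}_{12}:KP_5^*\to V^B\otimes V^B$ be the algebra morphism $g\mapsto \mathrm{pr}_1(g)\otimes\mathrm{pr}_2(g)$, for $g\in P_5^*$. Equip the group algebras $KF_2$ and $KP_5^*$ with the filtrations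 by the powers of their augmentation ideals ($F^n$ being everything for $n\le 0$) and $V^B\otimes V^B$ with the tensor product filtration $F^n=\sum_{i+j=n}F^i\otimes F^j$. Set $$M^B=\ker(K\mathrm{pr}_5)\otimes_{KP_5^*}(V^B\otimes V^B),$$ where $KP_5^*$ acts on the left of $V^B\otimes V^B$ through $K\mathrm{pr}_{12}$; $M^B$ is a right $V^B\otimes V^B$-module, and $V^B$ acts on it on the left through $K\ell$ and left multiplication on the two-sided ideal $\ker(K\mathrm{pr}_5)$. For $d\in\mathbb Z$ let $\mathcal M^B_d=(V^B,M^B,V^B\otimes V^B)$ be the resulting bimodule, filtered by letting $F^nM^B$ be the image of $F^{n+d}(KP_5^*)\cap\ker(K\mathrm{pr}_5)$ under $x\mapsto x\otimes1$. **De Rham side.** Let $\mathfrak f_2$ be the free $K$-Lie algebra on $e_0,e_1$, $e_\infty=-e_0-e_1$ and $V^{DR}=U(\mathfrak f_2)$. Let $\mathfrak t_4$ be the $K$-Lie algebra generated by $t_{ij}=t_{ji}$ $(i\neq j\in\{1,2,3,4\})$ subject to $[t_{ij},t_{ik}+t_{jk}]=0$ for $i,j,k$ distinct and $[t_{ij},t_{kl}]=0$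 for $i,j,k,l$ distinct; let $\mathfrak p_5$ be its quotient by the Lie ideal generated by $z_4=\sum_{i<j}t_{ij}$. In $\mathfrak p_5$ put $t_{15}=-t_{12}-t_{13}-t_{14}$, $t_{25}=-t_{12}-t_{23}-t_{24}$, $t_{35}=-t_{13}-t_{23}-t_{34}$. Lie algebra morphisms $\mathrm{pr}_1,\mathrm{pr}_2,\mathrm{pr}_5:\mathfrak p_5\to\mathfrak f_2$ are defined by $$\begin{array}{c|cccccc} & t_{12}&t_{13}&t_{14}&t_{23}&t_{24}&t_{34}\\\hline \mathrm{pr}_1&0&0&0&e_0&e_\infty&e_1\\ \mathrm{pr}_2&0&e_\infty&e_0&0&0&e_1\\ \mathrm{pr}_5&e_1&e_\infty&e_0&e_0&e_\infty&e_1\end{array}$$ and $\ell:\mathfrak f_2\to\mathfrak p_5$ by $e_0\mapsto t_{23}$, $e_1\mapsto t_{12}$. Let $U(\mathrm{pr}_{12}):U(\mathfrak p_5)\to V^{DR}\otimes V^{DR}$ be the algebra morphism with $a\mapsto \mathrm{pr}_1(a)\otimes1+1\otimes\mathrm{pr}_2(a)$ for $a\in\mathfrak p_5$. Grade $V^{DR}$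 and $U(\mathfrak p_5)$ by giving $e_0,e_1$ and the $t_{ij}$ degree $1$, and $V^{DR}\otimes V^{DR}$ by the tensor product grading. Set $$M^{DR}=\ker(U(\mathrm{pr}_5))\otimes_{U(\mathfrak p_5)}(V^{DR}\otimes V^{DR}),$$ with right action of $V^{DR}\otimes V^{DR}$ and left action of $V^{DR}$ defined as above, now through $U(\mathrm{pr}_{12})$ and $U(\ell)$. For $d\in\mathbb Z$ let $\mathcal M^{DR}_d=(V^{DR},M^{DR},V^{DR}\otimes V^{DR})$ be the resulting bimodule, graded by letting the degree $n$ part of $M^{DR}$ be the span of the $x\otimes w$ with $x,w$ homogeneous of total degree $n+d$. **The canonical morphism.** Call a morphism of graded bimodules $(g,\varphi,f):\mathcal M^{DR}_d\to\mathrm{gr}(\mathcal M^B_d)$ *canonical* if $g(e_i)=[X_i-1]_1$, $f(e_i\otimes1)=[(X_i-1)\otimes1]_1$ and $f(1\otimes e_i)=[1\otimes(X_i-1)]_1$ for $i=0,1$, and $\varphi(t_{i5}\otimes1)=[(x_{i5}-1)\otimes1]_{1-d}$ for $i=1,2,3$. **The factorization structures.** Let $\kappa_B:(V^B\otimes V^B)^3\to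 M^B$, $(a_i)\mapsto\sum_i(x_{i5}-1)\otimes a_i$ and $\kappa_{DR}:(V^{DR}\otimes V^{DR})^3\to M^{DR}$, $(a_i)\mapsto\sum_it_{i5}\otimes a_i$. In $V^B\otimes V^B$ write $X_1=X_1\otimes 1$, $Y_1=1\otimes X_1$; in $V^{DR}\otimes V^{DR}$ write $e_1=e_1\otimes1$, $f_1=1\otimes e_1$. **Theorem.** 1. For every $d\in\mathbb Z$ there is a unique isomorphism of graded bimodules $\mathcal M^{DR}_d\simeq\mathrm{gr}(\mathcal M^B_d)$ which is canonical. 2. The maps $\kappa_B$ and $\kappa_{DR}$ are bijective. On the filtered bimodule $\mathcal M^B_1$ there is a unique factorization structure $(e,r,c)$ such that $e=X_1-1$, that $r\circ\kappa_B$ is left multiplication by the row $(1,\,-X_1,\,0)\,Y_1$, and that $c=\kappa_B\circ(\text{left multiplication by the column }Y_1^{-1}\,{}^t(X_1-1,\ 1-Y_1,\ 0))$. On the graded bimodule $\mathcal M^{DR}_1$ there is a unique factorization structure $(e,r,c)$ such that $e=e_1$, that $r\circ\kappa_{DR}$ is left multiplication by the row $(1,-1,0)$, and that $c=\kappa_{DR}\circ(\text{left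 multiplication by the column }{}^t(e_1,-f_1,0))$. Let $O^B_{fil}\in\mathrm{BFS}_{fil}$ and $O^{DR}\in\mathrm{BFS}_{gr}$ be the objects so obtained. 3. In $\mathrm{BFS}_{gr}$ one has $\mathrm{gr}(O^B_{fil})\simeq O^{DR}$: there is a unique isomorphism $O^{DR}\to\mathrm{gr}(O^B_{fil})$ in $\mathrm{BFS}_{gr}$ whose underlying morphism of graded bimodules is canonical. -/

import Mathlib

open scoped TensorProduct DirectSum

universe u

namespace BFSTheory

noncomputable section

/-! ### Associated graded modules of filtered modules -/

section Graded

variable {K : Type u} [CommRing K]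
variable {X Y Z : Type u} [AddCommGroup X] [Module K X] [AddCommGroup Y] [Module K Y]
  [AddCommGroup Z] [Module K Z]

/-- `gr_n X = F^n X / F^{n+1} X`. -/
abbrev GrPiece (F : ℤ → Submodule K X) (n : ℤ) : Type u :=
  F n ⧸ (F (n + 1)).submoduleOf (F n)

/-- The associated graded module `gr X = ⨁ n, F^n X / F^{n+1} X`. -/
def Gr (F : ℤ → Submodule K X) : Type u := ⨁ n : ℤ, GrPiece F n

instance (F : ℤ → Submodule K X) : AddCommGroup (Gr F) :=
  inferInstanceAs (AddCommGroup (⨁ n : ℤ, GrPiece F n))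

instance (F : ℤ → Submodule K X) : Module K (Gr F) :=
  inferInstanceAs (Module K (⨁ n : ℤ, GrPiece F n))

/-- `gr X` is by definition the direct sum of its pieces. -/
def grEquiv (F : ℤ → Submodule K X) : (⨁ n : ℤ, GrPiece F n) ≃ₗ[K] Gr F :=
  LinearEquiv.refl K (⨁ n : ℤ, GrPiece F n)

/-- The class `[x]_n ∈ gr_n X ⊆ gr X` of `x ∈ F^n X`. -/
def cls (F : ℤ → Submodule K X) (n : ℤ) : F n →ₗ[K] Gr F :=
  (grEquiv F).toLinearMap.comp
    ((DirectSum.lof K ℤ (GrPiece F) n).comp ((F (n + 1)).submoduleOf (F n)).mkQ)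

/-- The summand `gr_n X` of `gr X`, as a submodule. -/
def grPart (F : ℤ → Submodule K X) (n : ℤ) : Submodule K (Gr F) :=
  LinearMap.range (cls F n)

theorem cls_eq_zero {F : ℤ → Submodule K X} {n : ℤ} (x : F n) (h : (x : X) ∈ F (n + 1)) :
    cls F n x = 0 := by
  have : ((F (n + 1)).submoduleOf (F n)).mkQ x = 0 := by
    rw [Submodule.mkQ_apply, Submodule.Quotient.mk_eq_zero]
    exact h
  rw [cls, LinearMap.comp_apply, LinearMap.comp_apply, this, map_zero, map_zero]

theorem cls_congr {F : ℤ → Submodule K X} {m n : ℤ} {x : F m} {y : F n} (h : m = n)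
    (hxy : (x : X) = y) : cls F m x = cls F n y := by
  subst h
  exact congrArg _ (Subtype.ext hxy)

theorem gr_induction {F : ℤ → Submodule K X} {p : Gr F → Prop} (h0 : p 0)
    (hc : ∀ n (x : F n), p (cls F n x)) (ha : ∀ a b, p a → p b → p (a + b)) (a : Gr F) : p a := by
  suffices h : ∀ b, p (grEquiv F b) from h ((grEquiv F).symm a)
  intro b
  refine DirectSum.induction_on b (by rwa [map_zero]) (fun n x => ?_)
    (fun a b h h' => by rw [map_add]; exact ha _ _ h h')
  obtain ⟨y, rfl⟩ := Submodule.mkQ_surjective _ x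
  exact hc n y

/-- Linear maps out of `gr X` from compatible linear maps out of the `F^n X`. -/
def grLift (F : ℤ → Submodule K X) (f : ∀ n, F n →ₗ[K] Y)
    (h : ∀ n (x : F n), (x : X) ∈ F (n + 1) → f n x = 0) : Gr F →ₗ[K] Y :=
  (DirectSum.toModule K ℤ Y fun n =>
    Submodule.liftQ _ (f n) fun x hx => h n x hx).comp (grEquiv F).symm.toLinearMap

@[simp]
theorem grLift_cls (F : ℤ → Submodule K X) (f : ∀ n, F n →ₗ[K] Y)
    (h : ∀ n (x : F n), (x : X) ∈ F (n + 1) → f n x = 0) (n : ℤ) (x : F n) :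
    grLift F f h (cls F n x) = f n x := by
  simp only [grLift, cls, LinearMap.comp_apply, LinearEquiv.coe_coe,
    LinearEquiv.symm_apply_apply, DirectSum.toModule_lof, Submodule.mkQ_apply]
  rfl

/-- The map `gr X → gr Y` of degree `d` induced by a linear map `φ` with
`φ (F^n X) ⊆ F^{n+d} Y`. -/
def grMap (F : ℤ → Submodule K X) (G : ℤ → Submodule K Y) (d : ℤ) (φ : X →ₗ[K] Y)
    (h : ∀ n, ∀ x ∈ F n, φ x ∈ G (n + d)) : Gr F →ₗ[K] Gr G :=
  grLift F (fun n => (cls G (n + d)).comp (φ.restrict (h n))) fun n x hx =>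
    cls_eq_zero _ (by
      have := h _ _ hx
      rwa [add_right_comm] at this)

@[simp]
theorem grMap_cls (F : ℤ → Submodule K X) (G : ℤ → Submodule K Y) (d : ℤ) (φ : X →ₗ[K] Y)
    (h : ∀ n, ∀ x ∈ F n, φ x ∈ G (n + d)) (n : ℤ) (x : F n) :
    grMap F G d φ h (cls F n x) = cls G (n + d) ⟨φ x, h n x x.2⟩ := by
  rw [grMap, grLift_cls]
  rfl

/-- The bilinear map `gr X × gr Y → gr Z` induced by a bilinear map `β` with
`β (F^i X, F^j Y) ⊆ F^{i+j} Z`. -/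
def grBil (F : ℤ → Submodule K X) (G : ℤ → Submodule K Y) (H : ℤ → Submodule K Z)
    (β : X →ₗ[K] Y →ₗ[K] Z)
    (h : ∀ i j, ∀ x ∈ F i, ∀ y ∈ G j, β x y ∈ H (i + j)) : Gr F →ₗ[K] Gr G →ₗ[K] Gr H :=
  grLift F
    (fun i =>
      { toFun := fun x =>
          grLift G
            (fun j => (cls H (i + j)).comp ((β x).restrict (fun y hy => h i j x x.2 y hy)))
            fun j y hy => cls_eq_zero _ (by
              have := h i _ x x.2 _ hy
              rwa [← add_assoc] at this)
        map_add' := fun x x' => by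
          ext a
          induction a using gr_induction with
          | h0 => simp
          | hc n y =>
            simp only [grLift_cls, LinearMap.add_apply, LinearMap.comp_apply]
            rw [← map_add]
            exact cls_congr rfl (by simp)
          | ha a b ha hb => simp only [map_add, ha, hb]
        map_smul' := fun r x => by
          ext a
          induction a using gr_induction with
          | h0 => simp
          | hc n y =>
            simp only [grLift_cls, LinearMap.smul_apply, LinearMap.comp_apply, RingHom.id_apply]
            rw [← map_smul]
            exact cls_congr rfl (by simp)
          | ha a b ha hb => simp only [map_add, ha, hb] })
    fun i x hx => by
      ext a
      induction a using gr_induction with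
      | h0 => simp
      | hc n y =>
        simp only [LinearMap.coe_mk, AddHom.coe_mk, grLift_cls, LinearMap.comp_apply,
          LinearMap.zero_apply]
        refine cls_eq_zero _ ?_
        have := h _ _ _ hx _ y.2
        rwa [add_right_comm] at this
      | ha a b ha hb => simp only [map_add, ha, hb]

@[simp]
theorem grBil_cls (F : ℤ → Submodule K X) (G : ℤ → Submodule K Y) (H : ℤ → Submodule K Z)
    (β : X →ₗ[K] Y →ₗ[K] Z)
    (h : ∀ i j, ∀ x ∈ F i, ∀ y ∈ G j, β x y ∈ H (i + j)) (i j : ℤ) (x : F i) (y : G j) :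
    grBil F G H β h (cls F i x) (cls G j y) = cls H (i + j) ⟨β x y, h i j x x.2 y y.2⟩ := by
  rw [grBil, grLift_cls]
  simp only [LinearMap.coe_mk, AddHom.coe_mk, grLift_cls]
  rfl

end Graded

/-! ### Filtered and graded algebras -/

section Algebras

variable {K : Type u} [CommRing K] {A : Type u} [Ring A] [Algebra K A]

/-- `F` is a (decreasing, `ℤ`-indexed) algebra filtration of `A`. -/
class IsAlgFiltration (F : ℤ → Submodule K A) : Prop where
  antitone : Antitone F
  one_mem : (1 : A) ∈ F 0
  mul_mem : ∀ i j, ∀ a ∈ F i, ∀ b ∈ F j, a * b ∈ F (i + j)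

/-- `gA` is an algebra grading of `A`. -/
class IsAlgGrading (gA : ℤ → Submodule K A) : Prop where
  isInternal : DirectSum.IsInternal gA
  one_mem : (1 : A) ∈ gA 0
  mul_mem : ∀ i j, ∀ a ∈ gA i, ∀ b ∈ gA j, a * b ∈ gA (i + j)

variable (F : ℤ → Submodule K A) [IsAlgFiltration F]

/-- The product of `gr A`. -/
def grMul : Gr F →ₗ[K] Gr F →ₗ[K] Gr F :=
  grBil F F F (LinearMap.mul K A) IsAlgFiltration.mul_mem

theorem grMul_cls (i j : ℤ) (a : F i) (b : F j) :
    grMul F (cls F i a) (cls F j b) =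
      cls F (i + j) ⟨(a : A) * b, IsAlgFiltration.mul_mem (F := F) i j a a.2 b b.2⟩ :=
  grBil_cls _ _ _ _ _ _ _ _ _

/-- `[a]_i * [b]_j = [a * b]_{i+j}` and `1 = [1]_0`. -/
instance : Ring (Gr F) where
  __ := instAddCommGroupGr F
  mul a b := grMul F a b
  one := cls F 0 ⟨1, IsAlgFiltration.one_mem⟩
  left_distrib a b c := map_add (grMul F a) b c
  right_distrib a b c := by
    change grMul F (a + b) c = grMul F a c + grMul F b c
    rw [map_add, LinearMap.add_apply]
  zero_mul a := by
    change grMul F 0 a = 0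
    rw [map_zero, LinearMap.zero_apply]
  mul_zero a := map_zero (grMul F a)
  mul_assoc a b c := by
    change grMul F (grMul F a b) c = grMul F a (grMul F b c)
    induction a using gr_induction with
    | h0 => simp
    | ha a a' h h' => simp only [map_add, LinearMap.add_apply, h, h']
    | hc i a =>
      induction b using gr_induction with
      | h0 => simp
      | ha a a' h h' => simp only [map_add, LinearMap.add_apply, h, h']
      | hc j b =>
        induction c using gr_induction with
        | h0 => simp
        | ha a a' h h' => simp only [map_add, h, h']
        | hc k c =>
          rw [grMul_cls, grMul_cls, grMul_cls, grMul_cls]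
          exact cls_congr (add_assoc i j k) (mul_assoc (a : A) (b : A) (c : A))
  one_mul a := by
    change grMul F _ a = a
    induction a using gr_induction with
    | h0 => simp
    | ha a a' h h' => rw [map_add, h, h']
    | hc i a =>
      erw [grMul_cls]
      exact cls_congr (zero_add _) (one_mul _)
  mul_one a := by
    change grMul F a _ = a
    induction a using gr_induction with
    | h0 => simp
    | ha a a' h h' => rw [map_add, LinearMap.add_apply, h, h']
    | hc i a =>
      erw [grMul_cls]
      exact cls_congr (add_zero _) (mul_one _)

instance : Algebra K (Gr F) :=
  Algebra.ofModule
    (fun r a b => by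
      change grMul F (r • a) b = r • grMul F a b
      rw [map_smul, LinearMap.smul_apply])
    (fun r a b => by
      change grMul F a (r • b) = r • grMul F a b
      rw [map_smul])

theorem gr_mul_cls (i j : ℤ) (a : F i) (b : F j) :
    cls F i a * cls F j b =
      cls F (i + j) ⟨(a : A) * b, IsAlgFiltration.mul_mem (F := F) i j a a.2 b b.2⟩ :=
  grMul_cls F i j a b

theorem gr_one : (1 : Gr F) = cls F 0 ⟨1, IsAlgFiltration.one_mem⟩ := rfl

end Algebras

/-! ### Internal gradings -/

section Internal

variable {K : Type u} [CommRing K] {X Y : Type u} [AddCommGroup X] [Module K X]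
  [AddCommGroup Y] [Module K Y]

/-- `δ` sends every `x ∈ P n` to the one-term family `x` placed in degree `n`. -/
def IsDecomp (P : ℤ → Submodule K X) (δ : X →ₗ[K] (ℤ →₀ X)) : Prop :=
  ∀ n, ∀ x ∈ P n, δ x = Finsupp.single n x

theorem iSupIndep_of_single {P : ℤ → Submodule K X} {ι : X →ₗ[K] Y}
    (hι : Function.Injective ι) {δ : X →ₗ[K] (ℤ →₀ Y)}
    (hδ : ∀ n, ∀ x ∈ P n, δ x = Finsupp.single n (ι x)) : iSupIndep P := by
  refine iSupIndep_of_dfinsupp_lsum_injective _ ?_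
  rw [injective_iff_map_eq_zero]
  intro m hm
  have key : ∀ m : Π₀ n, P n, ∀ k,
      δ (DFinsupp.lsum ℕ (fun n => (P n).subtype) m) k = ι (m k : X) := by
    intro m k
    induction m using DFinsupp.induction with
    | h0 => simp
    | ha i b f hf hb ih =>
      rw [map_add, map_add, Finsupp.add_apply, ih, DFinsupp.add_apply, Submodule.coe_add, map_add]
      congr 1
      rw [DFinsupp.lsum_single, Submodule.subtype_apply, hδ i _ b.2, DFinsupp.single_apply,
        Finsupp.single_apply]
      split_ifs with h
      · subst h; rfl
      · exact (map_zero ι).symm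
  ext k
  apply hι
  rw [← key m k]
  erw [hm]
  simp

theorem isInternal_of_isDecomp {P : ℤ → Submodule K X} (hP : ⨆ n, P n = ⊤)
    {δ : X →ₗ[K] (ℤ →₀ X)} (hδ : IsDecomp P δ) : DirectSum.IsInternal P :=
  DirectSum.isInternal_submodule_of_iSupIndep_of_iSup_eq_top
    (iSupIndep_of_single (ι := LinearMap.id) Function.injective_id hδ) hP

theorem exists_isDecomp {P : ℤ → Submodule K X} (hP : DirectSum.IsInternal P) :
    ∃ δ : X →ₗ[K] (ℤ →₀ X), IsDecomp P δ := by
  let e := LinearEquiv.ofBijective (DirectSum.coeLinearMap P) hP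
  refine ⟨(DirectSum.toModule K ℤ (ℤ →₀ X)
    (fun n => (Finsupp.lsingle n).comp (P n).subtype)).comp e.symm.toLinearMap, fun n x hx => ?_⟩
  have : e.symm x = DirectSum.lof K ℤ (fun n => P n) n ⟨x, hx⟩ := by
    rw [LinearEquiv.symm_apply_eq]
    exact (DirectSum.coeLinearMap_lof P n ⟨x, hx⟩).symm
  rw [LinearMap.comp_apply, LinearEquiv.coe_coe, this, DirectSum.toModule_lof]
  rfl

theorem grPart_isInternal (F : ℤ → Submodule K X) : DirectSum.IsInternal (grPart F) := by
  refine isInternal_of_isDecomp (δ := grLift F (fun n => (Finsupp.lsingle n).comp (cls F n))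
    fun n x hx => by rw [LinearMap.comp_apply, cls_eq_zero x hx, map_zero]) ?_ ?_
  · rw [eq_top_iff]
    intro a _
    induction a using gr_induction with
    | h0 => exact zero_mem _
    | ha a b ha hb => exact add_mem (ha trivial) (hb trivial)
    | hc n x => exact Submodule.mem_iSup_of_mem n ⟨x, rfl⟩
  · rintro n _ ⟨x, rfl⟩
    rw [grLift_cls]
    rfl

instance {A : Type u} [Ring A] [Algebra K A] (F : ℤ → Submodule K A) [IsAlgFiltration F] :
    IsAlgGrading (grPart F) where
  isInternal := grPart_isInternal F
  one_mem := ⟨_, rfl⟩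
  mul_mem := by
    rintro i j _ ⟨a, rfl⟩ _ ⟨b, rfl⟩
    exact ⟨_, (gr_mul_cls F i j a b).symm⟩

end Internal

/-! ### Bimodules and factorization structures -/

open MulOpposite CategoryTheory

/-- A `K`-bimodule `(B, M, A, ρ)`: `K`-algebras `B` and `A`, a right `A`-module `M` (that is, an
`Aᵐᵒᵖ`-module) with the `K`-linear structure coming from `A`, and a `K`-algebra morphism `ρ`
from `B` to the algebra of endomorphisms of the right `A`-module `M`. -/
structure KBimodule (K : Type u) [CommRing K] where
  B : Type u
  M : Type u
  A : Type u
  [ringB : Ring B]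
  [algebraB : Algebra K B]
  [ringA : Ring A]
  [algebraA : Algebra K A]
  [addCommGroupM : AddCommGroup M]
  [moduleM : Module K M]
  [rightModuleM : Module Aᵐᵒᵖ M]
  [isScalarTower : IsScalarTower K Aᵐᵒᵖ M]
  ρ : B →ₐ[K] Module.End Aᵐᵒᵖ M

attribute [instance] KBimodule.ringB KBimodule.algebraB KBimodule.ringA KBimodule.algebraA
  KBimodule.addCommGroupM KBimodule.moduleM KBimodule.rightModuleM KBimodule.isScalarTower

section Bimodules

variable {K : Type u} [CommRing K]

/-- The right action `(m, a) ↦ m · a`, as a bilinear map. -/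
def KBimodule.act (X : KBimodule K) : X.M →ₗ[K] X.A →ₗ[K] X.M :=
  LinearMap.mk₂ K (fun m a => op a • m) (fun _ _ _ => smul_add _ _ _)
    (fun _ _ _ => smul_comm _ _ _) (fun m a a' => add_smul (op a) (op a') m)
    (fun k m a => smul_assoc k (op a) m)

/-- The left action `(b, m) ↦ ρ b m`, as a bilinear map. -/
def KBimodule.lact (X : KBimodule K) : X.B →ₗ[K] X.M →ₗ[K] X.M :=
  LinearMap.mk₂ K (fun b m => X.ρ b m) (fun b b' m => by rw [map_add, LinearMap.add_apply])
    (fun k b m => by rw [map_smul, LinearMap.smul_apply]) (fun b m m' => map_add _ _ _)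
    (fun k b m => by
      rw [← algebraMap_smul X.Aᵐᵒᵖ k m, map_smul, algebraMap_smul])

/-- A filtered `K`-bimodule. -/
structure FilBimodule (K : Type u) [CommRing K] extends KBimodule K where
  FB : ℤ → Submodule K B
  FM : ℤ → Submodule K M
  FA : ℤ → Submodule K A
  [filB : IsAlgFiltration FB]
  [filA : IsAlgFiltration FA]
  antitoneM : Antitone FM
  act_mem : ∀ i j, ∀ m ∈ FM i, ∀ a ∈ FA j, op a • m ∈ FM (i + j)
  ρ_mem : ∀ i j, ∀ b ∈ FB i, ∀ m ∈ FM j, ρ b m ∈ FM (i + j)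

attribute [instance] FilBimodule.filB FilBimodule.filA

/-- A graded `K`-bimodule. -/
structure GrBimodule (K : Type u) [CommRing K] extends KBimodule K where
  gB : ℤ → Submodule K B
  gM : ℤ → Submodule K M
  gA : ℤ → Submodule K A
  [grB : IsAlgGrading gB]
  [grA : IsAlgGrading gA]
  isInternalM : DirectSum.IsInternal gM
  act_mem : ∀ i j, ∀ m ∈ gM i, ∀ a ∈ gA j, op a • m ∈ gM (i + j)
  ρ_mem : ∀ i j, ∀ b ∈ gB i, ∀ m ∈ gM j, ρ b m ∈ gM (i + j)

/-- A morphism `(g, φ, f)` of graded bimodules. -/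
@[ext]
structure GrBimodule.Hom (X Y : GrBimodule K) where
  g : X.B →ₐ[K] Y.B
  φ : X.M →ₗ[K] Y.M
  f : X.A →ₐ[K] Y.A
  map_act : ∀ (m : X.M) (a : X.A), φ (op a • m) = op (f a) • φ m
  map_ρ : ∀ (b : X.B) (m : X.M), φ (X.ρ b m) = Y.ρ (g b) (φ m)
  g_mem : ∀ n, ∀ b ∈ X.gB n, g b ∈ Y.gB n
  φ_mem : ∀ n, ∀ m ∈ X.gM n, φ m ∈ Y.gM n
  f_mem : ∀ n, ∀ a ∈ X.gA n, f a ∈ Y.gA n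

/-- The category of graded bimodules. -/
instance : Category (GrBimodule K) where
  Hom X Y := GrBimodule.Hom X Y
  id X :=
    { g := AlgHom.id K X.B
      φ := LinearMap.id
      f := AlgHom.id K X.A
      map_act := fun _ _ => rfl
      map_ρ := fun _ _ => rfl
      g_mem := fun _ _ h => h
      φ_mem := fun _ _ h => h
      f_mem := fun _ _ h => h }
  comp u v :=
    { g := v.g.comp u.g
      φ := v.φ.comp u.φ
      f := v.f.comp u.f
      map_act := fun m a => (congrArg v.φ (u.map_act m a)).trans (v.map_act _ _)
      map_ρ := fun b m => (congrArg v.φ (u.map_ρ b m)).trans (v.map_ρ _ _)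
      g_mem := fun n b h => v.g_mem n _ (u.g_mem n b h)
      φ_mem := fun n b h => v.φ_mem n _ (u.φ_mem n b h)
      f_mem := fun n b h => v.f_mem n _ (u.f_mem n b h) }

/-- A factorization structure `(e, r, c)` on a filtered bimodule, compatible with the
filtrations. -/
@[ext]
structure FilFactorization (X : FilBimodule K) where
  e : X.B
  r : X.M →ₗ[X.Aᵐᵒᵖ] X.A
  c : X.A →ₗ[X.Aᵐᵒᵖ] X.M
  ρ_e : X.ρ e = c ∘ₗ r
  e_mem : e ∈ X.FB 1
  r_mem : ∀ n, ∀ m ∈ X.FM n, r m ∈ X.FA n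
  c_mem : ∀ n, ∀ a ∈ X.FA n, c a ∈ X.FM (n + 1)

/-- A factorization structure `(e, r, c)` on a graded bimodule, with `e`, `r`, `c` of degrees
`1`, `0`, `1`. -/
@[ext]
structure GrFactorization (X : GrBimodule K) where
  e : X.B
  r : X.M →ₗ[X.Aᵐᵒᵖ] X.A
  c : X.A →ₗ[X.Aᵐᵒᵖ] X.M
  ρ_e : X.ρ e = c ∘ₗ r
  e_mem : e ∈ X.gB 1
  r_mem : ∀ n, ∀ m ∈ X.gM n, r m ∈ X.gA n
  c_mem : ∀ n, ∀ a ∈ X.gA n, c a ∈ X.gM (n + 1)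

variable (K) in
/-- The objects of `BFS_fil`: filtered bimodules with a factorization structure. -/
structure BFSFil where
  X : FilBimodule K
  S : FilFactorization X

variable (K) in
/-- The objects of `BFS_gr`: graded bimodules with a factorization structure. -/
structure BFSGr where
  X : GrBimodule K
  S : GrFactorization X

/-- A morphism of `BFS_gr`: a morphism of graded bimodules compatible with the factorization
structures. -/
@[ext]
structure BFSGr.Hom (P Q : BFSGr K) where
  hom : P.X ⟶ Q.X
  map_e : hom.g P.S.e = Q.S.e
  map_r : ∀ m, hom.f (P.S.r m) = Q.S.r (hom.φ m)
  map_c : ∀ a, hom.φ (P.S.c a) = Q.S.c (hom.f a)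

/-- The category `BFS_gr`. -/
instance : Category (BFSGr K) where
  Hom P Q := BFSGr.Hom P Q
  id P := ⟨𝟙 P.X, rfl, fun _ => rfl, fun _ => rfl⟩
  comp u v :=
    { hom := u.hom ≫ v.hom
      map_e := (congrArg v.hom.g u.map_e).trans v.map_e
      map_r := fun m => (congrArg v.hom.f (u.map_r m)).trans (v.map_r _)
      map_c := fun m => (congrArg v.hom.φ (u.map_c m)).trans (v.map_c _) }

/-! ### The graded bimodule of a filtered bimodule -/

namespace FilBimodule

variable (X : FilBimodule K)

/-- `[m]_i · [a]_j = [m · a]_{i+j}`. -/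
def grAct : Gr X.FM →ₗ[K] Gr X.FA →ₗ[K] Gr X.FM :=
  grBil X.FM X.FA X.FM X.act X.act_mem

/-- `[b]_i · [m]_j = [ρ b m]_{i+j}`. -/
def grLact : Gr X.FB →ₗ[K] Gr X.FM →ₗ[K] Gr X.FM :=
  grBil X.FB X.FM X.FM X.lact X.ρ_mem

theorem grAct_cls (i j : ℤ) (m : X.FM i) (a : X.FA j) :
    X.grAct (cls _ i m) (cls _ j a) =
      cls X.FM (i + j) ⟨op (a : X.A) • (m : X.M), X.act_mem i j m m.2 a a.2⟩ :=
  grBil_cls _ _ _ _ _ _ _ _ _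

theorem grLact_cls (i j : ℤ) (b : X.FB i) (m : X.FM j) :
    X.grLact (cls _ i b) (cls _ j m) =
      cls X.FM (i + j) ⟨X.ρ (b : X.B) (m : X.M), X.ρ_mem i j b b.2 m m.2⟩ :=
  grBil_cls _ _ _ _ _ _ _ _ _

theorem grAct_one (m : Gr X.FM) : X.grAct m 1 = m := by
  induction m using gr_induction with
  | h0 => simp
  | ha a a' h h' => rw [map_add, LinearMap.add_apply, h, h']
  | hc i a =>
    rw [gr_one, grAct_cls]
    exact cls_congr (add_zero _) (one_smul X.Aᵐᵒᵖ (a : X.M))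

theorem grAct_mul (m : Gr X.FM) (a b : Gr X.FA) :
    X.grAct m (a * b) = X.grAct (X.grAct m a) b := by
  induction m using gr_induction with
  | h0 => simp
  | ha a a' h h' => simp only [map_add, LinearMap.add_apply, h, h']
  | hc i m =>
    induction a using gr_induction with
    | h0 => simp
    | ha a a' h h' => simp only [add_mul, map_add, LinearMap.add_apply, h, h']
    | hc j a =>
      induction b using gr_induction with
      | h0 => simp
      | ha a a' h h' => simp only [mul_add, map_add, h, h']
      | hc k b =>
        rw [gr_mul_cls, grAct_cls, grAct_cls, grAct_cls]
        exact cls_congr (add_assoc _ _ _).symm 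
          (mul_smul (op (b : X.A)) (op (a : X.A)) (m : X.M))

theorem grLact_one (m : Gr X.FM) : X.grLact 1 m = m := by
  induction m using gr_induction with
  | h0 => simp
  | ha a a' h h' => rw [map_add, h, h']
  | hc i a =>
    rw [gr_one, grLact_cls]
    exact cls_congr (zero_add _) (LinearMap.congr_fun (map_one X.ρ) (a : X.M))

theorem grLact_mul (a b : Gr X.FB) (m : Gr X.FM) :
    X.grLact (a * b) m = X.grLact a (X.grLact b m) := by
  induction m using gr_induction with
  | h0 => simp
  | ha a a' h h' => simp only [map_add, h, h']
  | hc i m =>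
    induction a using gr_induction with
    | h0 => simp
    | ha a a' h h' => simp only [add_mul, map_add, LinearMap.add_apply, h, h']
    | hc j a =>
      induction b using gr_induction with
      | h0 => simp
      | ha a a' h h' => simp only [mul_add, map_add, LinearMap.add_apply, h, h']
      | hc k b =>
        rw [gr_mul_cls, grLact_cls, grLact_cls, grLact_cls]
        exact cls_congr (add_assoc _ _ _)
          (LinearMap.congr_fun (map_mul X.ρ (a : X.B) (b : X.B)) (m : X.M))

theorem grLact_grAct (b : Gr X.FB) (m : Gr X.FM) (a : Gr X.FA) :
    X.grLact b (X.grAct m a) = X.grAct (X.grLact b m) a := by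
  induction m using gr_induction with
  | h0 => simp
  | ha a a' h h' => simp only [map_add, LinearMap.add_apply, h, h']
  | hc i m =>
    induction a using gr_induction with
    | h0 => simp
    | ha a a' h h' => simp only [map_add, h, h']
    | hc j a =>
      induction b using gr_induction with
      | h0 => simp
      | ha a a' h h' => simp only [map_add, LinearMap.add_apply, h, h']
      | hc k b =>
        rw [grAct_cls, grLact_cls, grLact_cls, grAct_cls]
        exact cls_congr (add_assoc _ _ _).symm (map_smul (X.ρ (b : X.B)) _ _)

/-- The underlying bimodule `(gr B, gr M, gr A, gr ρ)` of `gr X`. -/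
def grK : KBimodule K :=
  letI : Module (Gr X.FA)ᵐᵒᵖ (Gr X.FM) :=
    { smul := fun a m => X.grAct m a.unop
      one_smul := fun m => X.grAct_one m
      mul_smul := fun a b m => X.grAct_mul m b.unop a.unop
      smul_zero := fun a => by
        change X.grAct 0 a.unop = 0
        rw [map_zero, LinearMap.zero_apply]
      smul_add := fun a m m' => by
        change X.grAct (m + m') a.unop = X.grAct m a.unop + X.grAct m' a.unop
        rw [map_add, LinearMap.add_apply]
      add_smul := fun a b m => map_add (X.grAct m) a.unop b.unop
      zero_smul := fun m => map_zero (X.grAct m) }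
  haveI : IsScalarTower K (Gr X.FA)ᵐᵒᵖ (Gr X.FM) :=
    ⟨fun k a m => map_smul (X.grAct m) k a.unop⟩
  { B := Gr X.FB
    M := Gr X.FM
    A := Gr X.FA
    ρ := AlgHom.ofLinearMap
      { toFun := fun b =>
          { toFun := X.grLact b
            map_add' := map_add _
            map_smul' := fun a m => X.grLact_grAct b m a.unop }
        map_add' := fun b b' => LinearMap.ext fun m => by
          change X.grLact (b + b') m = X.grLact b m + X.grLact b' m
          rw [map_add, LinearMap.add_apply]
        map_smul' := fun k b => LinearMap.ext fun m => by
          change X.grLact (k • b) m = k • X.grLact b m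
          rw [map_smul, LinearMap.smul_apply] }
      (LinearMap.ext fun m => X.grLact_one m)
      (fun b b' => LinearMap.ext fun m => X.grLact_mul b b' m) }

/-- The graded bimodule `gr X` of a filtered bimodule `X`. -/
def gr : GrBimodule K where
  toKBimodule := X.grK
  gB := grPart X.FB
  gM := grPart X.FM
  gA := grPart X.FA
  grB := inferInstanceAs (IsAlgGrading (grPart X.FB))
  grA := inferInstanceAs (IsAlgGrading (grPart X.FA))
  isInternalM := grPart_isInternal X.FM
  act_mem := by
    rintro i j _ ⟨m, rfl⟩ _ ⟨a, rfl⟩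
    exact ⟨_, (X.grAct_cls i j m a).symm⟩
  ρ_mem := by
    rintro i j _ ⟨b, rfl⟩ _ ⟨m, rfl⟩
    exact ⟨_, (X.grLact_cls i j b m).symm⟩

/-- The class `[b]_n` in `gr B`. -/
def clsB (n : ℤ) (b : X.B) (hb : b ∈ X.FB n) : X.gr.B := cls X.FB n ⟨b, hb⟩

/-- The class `[m]_n` in `gr M`. -/
def clsM (n : ℤ) (m : X.M) (hm : m ∈ X.FM n) : X.gr.M := cls X.FM n ⟨m, hm⟩

/-- The class `[a]_n` in `gr A`. -/
def clsA (n : ℤ) (a : X.A) (ha : a ∈ X.FA n) : X.gr.A := cls X.FA n ⟨a, ha⟩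

end FilBimodule

namespace FilFactorization

variable {X : FilBimodule K} (S : FilFactorization X)

/-- `gr_0 r`, that is `[m]_n ↦ [r m]_n`. -/
def grR : Gr X.FM →ₗ[K] Gr X.FA :=
  grMap X.FM X.FA 0 (S.r.restrictScalars K) fun n m hm => by
    rw [add_zero]
    exact S.r_mem n m hm

/-- `gr_1 c`, that is `[a]_n ↦ [c a]_{n+1}`. -/
def grC : Gr X.FA →ₗ[K] Gr X.FM :=
  grMap X.FA X.FM 1 (S.c.restrictScalars K) S.c_mem

theorem grR_cls (n : ℤ) (m : X.FM n) :
    S.grR (cls _ n m) = cls X.FA n ⟨S.r m, S.r_mem n m m.2⟩ :=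
  (grMap_cls _ _ _ _ _ _ _).trans (cls_congr (add_zero n) rfl)

theorem grC_cls (n : ℤ) (a : X.FA n) :
    S.grC (cls _ n a) = cls X.FM (n + 1) ⟨S.c a, S.c_mem n a a.2⟩ :=
  grMap_cls _ _ _ _ _ _ _

theorem grR_grAct (m : Gr X.FM) (a : Gr X.FA) : S.grR (X.grAct m a) = S.grR m * a := by
  induction m using gr_induction with
  | h0 => simp
  | ha a a' h h' => simp only [map_add, LinearMap.add_apply, add_mul, h, h']
  | hc i m =>
    induction a using gr_induction with
    | h0 => simp
    | ha a a' h h' => simp only [map_add, mul_add, h, h']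
    | hc j a =>
      rw [X.grAct_cls, grR_cls, grR_cls, gr_mul_cls]
      exact cls_congr rfl (map_smul S.r (op (a : X.A)) (m : X.M))

theorem grC_mul (a b : Gr X.FA) : S.grC (a * b) = X.grAct (S.grC a) b := by
  induction a using gr_induction with
  | h0 => simp
  | ha a a' h h' => simp only [map_add, LinearMap.add_apply, add_mul, h, h']
  | hc i a =>
    induction b using gr_induction with
    | h0 => simp
    | ha a a' h h' => simp only [map_add, mul_add, h, h']
    | hc j b =>
      rw [gr_mul_cls, grC_cls, grC_cls, X.grAct_cls]
      exact cls_congr (add_right_comm _ _ _) (map_smul S.c (op (b : X.A)) (a : X.A))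

theorem grLact_e (m : Gr X.FM) :
    X.grLact (cls X.FB 1 ⟨S.e, S.e_mem⟩) m = S.grC (S.grR m) := by
  induction m using gr_induction with
  | h0 => simp
  | ha a a' h h' => simp only [map_add, h, h']
  | hc i m =>
    rw [X.grLact_cls, grR_cls, grC_cls]
    exact cls_congr (add_comm _ _) (LinearMap.congr_fun S.ρ_e (m : X.M))

/-- The factorization structure `([e]_1, gr_0 r, gr_1 c)` on `gr X`. -/
def gr : GrFactorization X.gr where
  e := X.clsB 1 S.e S.e_mem
  r :=
    { toFun := S.grR
      map_add' := map_add _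
      map_smul' := fun a m => S.grR_grAct m a.unop }
  c :=
    { toFun := S.grC
      map_add' := map_add _
      map_smul' := fun a b => S.grC_mul b a.unop }
  ρ_e := LinearMap.ext fun m => S.grLact_e m
  e_mem := ⟨_, rfl⟩
  r_mem := by
    rintro n _ ⟨m, rfl⟩
    exact ⟨_, (S.grR_cls n m).symm⟩
  c_mem := by
    rintro n _ ⟨a, rfl⟩
    exact ⟨_, (S.grC_cls n a).symm⟩

end FilFactorization

/-- The functor `gr : BFS_fil → BFS_gr` on objects. -/
def BFSFil.gr (P : BFSFil K) : BFSGr K := ⟨P.X.gr, P.S.gr⟩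

end Bimodules

/-! ### The bimodule `ker p ⊗_P W` -/

section KerTensor

variable {K : Type u} [CommRing K] {V P V' W : Type u} [Ring V] [Algebra K V] [Ring P]
  [Algebra K P] [Ring V'] [Algebra K V'] [Ring W] [Algebra K W]

/-- The kernel of `p : P → V'`, as a `K`-module. -/
def KerMod (p : P →ₐ[K] V') : Type u := LinearMap.ker p.toLinearMap

namespace KerMod

variable (p : P →ₐ[K] V')

instance : AddCommGroup (KerMod p) :=
  inferInstanceAs (AddCommGroup (LinearMap.ker p.toLinearMap))

instance : Module K (KerMod p) :=
  inferInstanceAs (Module K (LinearMap.ker p.toLinearMap))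

/-- The inclusion `ker p → P`. -/
def incl : KerMod p →ₗ[K] P := (LinearMap.ker p.toLinearMap).subtype

variable {p}

/-- An element of `P` killed by `p`, as an element of `ker p`. -/
def mk (x : P) (hx : p x = 0) : KerMod p :=
  Subtype.mk (p := fun y => y ∈ LinearMap.ker p.toLinearMap) x hx

@[simp]
theorem incl_mk (x : P) (hx : p x = 0) : incl p (mk x hx) = x := rfl

theorem map_incl (x : KerMod p) : p (incl p x) = 0 := Subtype.property x

theorem ext {x y : KerMod p} (h : incl p x = incl p y) : x = y := Subtype.ext h

theorem range_incl : LinearMap.range (incl p) = LinearMap.ker p.toLinearMap :=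
  Submodule.range_subtype _

variable (p)

/-- Right multiplication by `a` on the two-sided ideal `ker p`. -/
def mulRight (a : P) : KerMod p →ₗ[K] KerMod p where
  toFun x := mk (incl p x * a) (by rw [map_mul, map_incl, zero_mul])
  map_add' x y := ext (by
    change incl p (x + y) * a = incl p x * a + incl p y * a
    rw [map_add, add_mul])
  map_smul' k x := ext (by
    change incl p (k • x) * a = k • (incl p x * a)
    rw [map_smul, smul_mul_assoc])

/-- Left multiplication by `a` on the two-sided ideal `ker p`. -/
def mulLeft (a : P) : KerMod p →ₗ[K] KerMod p where
  toFun x := mk (a * incl p x) (by rw [map_mul, map_incl, mul_zero])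
  map_add' x y := ext (by
    change a * incl p (x + y) = a * incl p x + a * incl p y
    rw [map_add, mul_add])
  map_smul' k x := ext (by
    change a * incl p (k • x) = k • (a * incl p x)
    rw [map_smul, mul_smul_comm])

end KerMod

/-- The relations `x a ⊗ w = x ⊗ q(a) w` for `x ∈ ker p`, `a ∈ P`, `w ∈ W`. -/
def kerTensorRel (p : P →ₐ[K] V') (q : P →ₐ[K] W) : Submodule K (KerMod p ⊗[K] W) :=
  Submodule.span K
    {t | ∃ (x : KerMod p) (a : P) (w : W), t = KerMod.mulRight p a x ⊗ₜ w - x ⊗ₜ (q a * w)}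

/-- The tensor product `ker p ⊗_P W` of the right `P`-module `ker p` with `W`, a left `P`-module
through `q`. -/
def KerTensor (p : P →ₐ[K] V') (q : P →ₐ[K] W) : Type u :=
  (KerMod p ⊗[K] W) ⧸ kerTensorRel p q

namespace KerTensor

variable (p : P →ₐ[K] V') (q : P →ₐ[K] W)

instance : AddCommGroup (KerTensor p q) :=
  inferInstanceAs (AddCommGroup ((KerMod p ⊗[K] W) ⧸ kerTensorRel p q))

instance : Module K (KerTensor p q) :=
  inferInstanceAs (Module K ((KerMod p ⊗[K] W) ⧸ kerTensorRel p q))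

/-- The quotient map `ker p ⊗_K W → ker p ⊗_P W`. -/
def proj : KerMod p ⊗[K] W →ₗ[K] KerTensor p q := (kerTensorRel p q).mkQ

/-- The class of `x ⊗ w`. -/
def tmul : KerMod p →ₗ[K] W →ₗ[K] KerTensor p q :=
  (TensorProduct.mk K (KerMod p) W).compr₂ (proj p q)

variable {p q}

theorem tmul_mul (x : KerMod p) (a : P) (w : W) :
    tmul p q (KerMod.mulRight p a x) w = tmul p q x (q a * w) :=
  (Submodule.Quotient.eq _).2 (Submodule.subset_span ⟨x, a, w, rfl⟩)

theorem induction {C : KerTensor p q → Prop} (h0 : C 0) (ht : ∀ x w, C (tmul p q x w))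
    (ha : ∀ a b, C a → C b → C (a + b)) (m : KerTensor p q) : C m := by
  obtain ⟨t, rfl⟩ := Submodule.mkQ_surjective _ m
  induction t with
  | zero => exact h0
  | tmul x w => exact ht x w
  | add a b h h' => exact ha _ _ h h'

variable (p q)

/-- A linear endomorphism of `ker p ⊗_K W` preserving the relations induces one of
`ker p ⊗_P W`. -/
def desc (φ : KerMod p ⊗[K] W →ₗ[K] KerMod p ⊗[K] W)
    (h : ∀ (x : KerMod p) (a : P) (w : W),
      proj p q (φ (KerMod.mulRight p a x ⊗ₜ w)) = proj p q (φ (x ⊗ₜ (q a * w)))) :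
    KerTensor p q →ₗ[K] KerTensor p q :=
  (kerTensorRel p q).liftQ ((proj p q).comp φ) (Submodule.span_le.2 (by
    rintro _ ⟨x, a, w, rfl⟩
    rw [SetLike.mem_coe, LinearMap.mem_ker, LinearMap.comp_apply, map_sub, map_sub, h, sub_self]))

/-- The right action of `w₀ ∈ W`: `x ⊗ w ↦ x ⊗ w w₀`. -/
def actR (w₀ : W) : KerTensor p q →ₗ[K] KerTensor p q :=
  desc p q (LinearMap.lTensor _ (LinearMap.mulRight K w₀)) fun x a w => by
    rw [LinearMap.lTensor_tmul, LinearMap.lTensor_tmul, LinearMap.mulRight_apply,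
      LinearMap.mulRight_apply, mul_assoc]
    exact tmul_mul x a (w * w₀)

/-- The left action of `b ∈ P`: `x ⊗ w ↦ b x ⊗ w`. -/
def actL (b : P) : KerTensor p q →ₗ[K] KerTensor p q :=
  desc p q (LinearMap.rTensor _ (KerMod.mulLeft p b)) fun x a w => by
    rw [LinearMap.rTensor_tmul, LinearMap.rTensor_tmul]
    refine Eq.trans ?_ (tmul_mul (KerMod.mulLeft p b x) a w)
    exact congrArg (fun y => tmul p q y w) (KerMod.ext (mul_assoc b (KerMod.incl p x) a).symm)

theorem actR_tmul (w₀ : W) (x : KerMod p) (w : W) :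
    actR p q w₀ (tmul p q x w) = tmul p q x (w * w₀) := rfl

theorem actL_tmul (b : P) (x : KerMod p) (w : W) :
    actL p q b (tmul p q x w) = tmul p q (KerMod.mulLeft p b x) w := rfl

theorem ext_tmul {f g : KerTensor p q →ₗ[K] KerTensor p q}
    (h : ∀ x w, f (tmul p q x w) = g (tmul p q x w)) : f = g := by
  ext m
  induction m using KerTensor.induction with
  | h0 => rw [map_zero, map_zero]
  | ht x w => exact h x w
  | ha a b h h' => rw [map_add, map_add, h, h']

/-- The right action of `W` on `ker p ⊗_P W`. -/
def actRHom : Wᵐᵒᵖ →+* Module.End K (KerTensor p q) where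
  toFun w := actR p q w.unop
  map_zero' := ext_tmul p q fun x w => by
    rw [actR_tmul, MulOpposite.unop_zero, mul_zero, map_zero]; rfl
  map_one' := ext_tmul p q fun x w => by
    rw [actR_tmul, MulOpposite.unop_one, mul_one]; rfl
  map_add' a b := ext_tmul p q fun x w => by
    rw [actR_tmul, MulOpposite.unop_add, mul_add, map_add]; rfl
  map_mul' a b := ext_tmul p q fun x w => by
    rw [actR_tmul, MulOpposite.unop_mul, ← mul_assoc]; rfl

instance : Module Wᵐᵒᵖ (KerTensor p q) := Module.compHom _ (actRHom p q)

theorem op_smul (w₀ : W) (m : KerTensor p q) : op w₀ • m = actR p q w₀ m := rfl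

theorem op_smul_tmul (w₀ : W) (x : KerMod p) (w : W) :
    op w₀ • tmul p q x w = tmul p q x (w * w₀) := rfl

instance : IsScalarTower K Wᵐᵒᵖ (KerTensor p q) where
  smul_assoc k w m := by
    have : actR p q (k • w).unop = k • actR p q w.unop := ext_tmul p q fun x w' => by
      rw [actR_tmul, MulOpposite.unop_smul, mul_smul_comm, map_smul]; rfl
    exact LinearMap.congr_fun this m

theorem actL_op_smul (b : P) (w₀ : W) (m : KerTensor p q) :
    actL p q b (op w₀ • m) = op w₀ • actL p q b m := by
  have : (actL p q b).comp (actR p q w₀) = (actR p q w₀).comp (actL p q b) :=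
    ext_tmul p q fun x w => rfl
  exact LinearMap.congr_fun this m

/-- The left action of `P` on `ker p ⊗_P W`. -/
def actLHom : P →ₐ[K] Module.End Wᵐᵒᵖ (KerTensor p q) :=
  AlgHom.ofLinearMap
    { toFun := fun b =>
        { toFun := actL p q b
          map_add' := map_add _
          map_smul' := fun w m => actL_op_smul p q b w.unop m }
      map_add' := fun a b => LinearMap.ext fun m =>
        LinearMap.congr_fun (f := actL p q (a + b)) (g := actL p q a + actL p q b)
          (ext_tmul p q fun x w => by
            rw [actL_tmul, LinearMap.add_apply, actL_tmul, actL_tmul, ← LinearMap.add_apply,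
              ← map_add]
            exact congrArg (fun y => tmul p q y w) (KerMod.ext (add_mul a b (KerMod.incl p x)))) m
      map_smul' := fun k b => LinearMap.ext fun m =>
        LinearMap.congr_fun (f := actL p q (k • b)) (g := k • actL p q b)
          (ext_tmul p q fun x w => by
            rw [actL_tmul, LinearMap.smul_apply, actL_tmul, ← LinearMap.smul_apply, ← map_smul]
            exact congrArg (fun y => tmul p q y w) (KerMod.ext (smul_mul_assoc k b (KerMod.incl p x)))) m }
    (LinearMap.ext fun m =>
      LinearMap.congr_fun (f := actL p q 1) (g := LinearMap.id)
        (ext_tmul p q fun x w => by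
          rw [actL_tmul]
          exact congrArg (fun y => tmul p q y w) (KerMod.ext (one_mul (KerMod.incl p x)))) m)
    (fun a b => LinearMap.ext fun m =>
      LinearMap.congr_fun (f := actL p q (a * b)) (g := (actL p q a).comp (actL p q b))
        (ext_tmul p q fun x w => by
          rw [actL_tmul]
          exact congrArg (fun y => tmul p q y w) (KerMod.ext (mul_assoc a b (KerMod.incl p x)))) m)

theorem actLHom_tmul (b : P) (x : KerMod p) (w : W) :
    actLHom p q b (tmul p q x w) = tmul p q (KerMod.mulLeft p b x) w := rfl

/-- The bimodule `(V, ker p ⊗_P W, W)`, where `V` acts on the left through `ℓ : V → P`. -/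
def bimodule (ℓ : V →ₐ[K] P) : KBimodule K where
  B := V
  M := KerTensor p q
  A := W
  ρ := (actLHom p q).comp ℓ

/-! #### Filtrations -/

/-- `F^n (ker p ⊗_P W)` is the image of `F^n P ∩ ker p` under `x ↦ x ⊗ 1`. -/
def fil (FP : ℤ → Submodule K P) (n : ℤ) : Submodule K (KerTensor p q) :=
  ((FP n).comap (KerMod.incl p)).map ((tmul p q).flip 1)

theorem fil_antitone {FP : ℤ → Submodule K P} (h : Antitone FP) : Antitone (fil p q FP) :=
  fun _ _ hij => Submodule.map_mono (Submodule.comap_mono (h hij))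

theorem fil_actR {FP : ℤ → Submodule K P} [IsAlgFiltration FP] {FW : ℤ → Submodule K W}
    (hq : ∀ n, (FP n).map q.toLinearMap = FW n) (i j : ℤ) (m : KerTensor p q)
    (hm : m ∈ fil p q FP i) (w : W) (hw : w ∈ FW j) : op w • m ∈ fil p q FP (i + j) := by
  obtain ⟨x, hx, rfl⟩ := hm
  rw [← hq] at hw
  obtain ⟨a, ha, rfl⟩ := hw
  refine ⟨KerMod.mulRight p a x, IsAlgFiltration.mul_mem i j _ hx a ha, ?_⟩
  rw [LinearMap.flip_apply, LinearMap.flip_apply, tmul_mul, op_smul_tmul, one_mul, mul_one]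
  rfl

theorem fil_actL {FP : ℤ → Submodule K P} [IsAlgFiltration FP] {FV : ℤ → Submodule K V}
    (ℓ : V →ₐ[K] P) (hℓ : ∀ n, ∀ v ∈ FV n, ℓ v ∈ FP n) (i j : ℤ) (v : V) (hv : v ∈ FV i)
    (m : KerTensor p q) (hm : m ∈ fil p q FP j) :
    actLHom p q (ℓ v) m ∈ fil p q FP (i + j) := by
  obtain ⟨x, hx, rfl⟩ := hm
  exact ⟨KerMod.mulLeft p (ℓ v) x, IsAlgFiltration.mul_mem i j _ (hℓ i v hv) _ hx, rfl⟩

/-- The filtered bimodule `(V, ker p ⊗_P W, W)`, with `F^n M` the image of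
`F^{n+d} P ∩ ker p`. -/
def filBimodule {FV : ℤ → Submodule K V} {FP : ℤ → Submodule K P} {FW : ℤ → Submodule K W}
    [IsAlgFiltration FV] [IsAlgFiltration FP] [IsAlgFiltration FW] (ℓ : V →ₐ[K] P)
    (hq : ∀ n, (FP n).map q.toLinearMap = FW n) (hℓ : ∀ n, ∀ v ∈ FV n, ℓ v ∈ FP n) (d : ℤ) :
    FilBimodule K where
  toKBimodule := bimodule p q ℓ
  FB := FV
  FM n := fil p q FP (n + d)
  FA := FW
  filB := inferInstanceAs (IsAlgFiltration FV)
  filA := inferInstanceAs (IsAlgFiltration FW)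
  antitoneM _ _ h := fil_antitone p q (IsAlgFiltration.antitone (F := FP)) (by omega)
  act_mem i j m hm w hw := by
    have := fil_actR p q hq (i + d) j m hm w hw
    rwa [add_right_comm] at this
  ρ_mem i j v hv m hm := by
    have := fil_actL p q ℓ hℓ i (j + d) v hv m hm
    rwa [← add_assoc] at this

end KerTensor

end KerTensor

/-! ### Sums `∑_{i+j=n} X_i · Y_j` -/

section Convolve

variable {K : Type u} [CommRing K] {X Y Z : Type u} [AddCommGroup X] [Module K X]
  [AddCommGroup Y] [Module K Y] [AddCommGroup Z] [Module K Z]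

/-- The span of all `β x y` with `x ∈ P i`, `y ∈ Q j`, `i + j = n`. -/
def convolve (β : X →ₗ[K] Y →ₗ[K] Z) (P : ℤ → Submodule K X) (Q : ℤ → Submodule K Y) (n : ℤ) :
    Submodule K Z :=
  ⨆ i, Submodule.map₂ β (P i) (Q (n - i))

variable {β : X →ₗ[K] Y →ₗ[K] Z} {P : ℤ → Submodule K X} {Q : ℤ → Submodule K Y}

theorem mem_convolve {i j : ℤ} {x : X} {y : Y} (hx : x ∈ P i) (hy : y ∈ Q j) :
    β x y ∈ convolve β P Q (i + j) :=
  Submodule.mem_iSup_of_mem i (Submodule.apply_mem_map₂ _ hx (by rwa [add_sub_cancel_left]))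

theorem mem_convolve' {i j n : ℤ} (h : i + j = n) {x : X} {y : Y} (hx : x ∈ P i) (hy : y ∈ Q j) :
    β x y ∈ convolve β P Q n := h ▸ mem_convolve hx hy

theorem convolve_le {n : ℤ} {S : Submodule K Z}
    (h : ∀ i j, i + j = n → ∀ x ∈ P i, ∀ y ∈ Q j, β x y ∈ S) : convolve β P Q n ≤ S :=
  iSup_le fun i => Submodule.map₂_le.2 fun x hx y hy => h i (n - i) (by ring) x hx y hy

/-- The bilinear map sending homogeneous `x`, `y` of degrees `i`, `j` to `β x y` placed in
degree `i + j`. -/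
def gradeBil (β : X →ₗ[K] Y →ₗ[K] Z) (δ : X →ₗ[K] (ℤ →₀ X)) (ε : Y →ₗ[K] (ℤ →₀ Y)) :
    X →ₗ[K] Y →ₗ[K] (ℤ →₀ Z) :=
  ((Finsupp.lsum K (fun i : ℤ => LinearMap.flip (Finsupp.lsum K (fun j : ℤ =>
    LinearMap.flip (β.compr₂ (Finsupp.lsingle (i + j))))))).comp δ).compl₂ ε

theorem gradeBil_apply {δ : X →ₗ[K] (ℤ →₀ X)} {ε : Y →ₗ[K] (ℤ →₀ Y)} (hδ : IsDecomp P δ)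
    (hε : IsDecomp Q ε) {i j : ℤ} {x : X} {y : Y} (hx : x ∈ P i) (hy : y ∈ Q j) :
    gradeBil β δ ε x y = Finsupp.single (i + j) (β x y) := by
  simp [gradeBil, hδ i x hx, hε j y hy]

theorem isDecomp_convolve {δ : Z →ₗ[K] (ℤ →₀ Z)}
    (h : ∀ i j, ∀ x ∈ P i, ∀ y ∈ Q j, δ (β x y) = Finsupp.single (i + j) (β x y)) :
    IsDecomp (convolve β P Q) δ := by
  intro n z hz
  have : convolve β P Q n ≤ LinearMap.eqLocus δ (Finsupp.lsingle n) :=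
    convolve_le fun i j hij x hx y hy => by
      rw [LinearMap.mem_eqLocus, h i j x hx y hy, hij]
      rfl
  exact this hz

theorem iSup_convolve (hP : ⨆ i, P i = ⊤) (hQ : ⨆ i, Q i = ⊤)
    (hβ : ∀ S : Submodule K Z, (∀ x y, β x y ∈ S) → S = ⊤) : ⨆ n, convolve β P Q n = ⊤ := by
  refine hβ _ fun x y => ?_
  have hx : x ∈ ⨆ i, P i := hP ▸ Submodule.mem_top
  have hy : y ∈ ⨆ i, Q i := hQ ▸ Submodule.mem_top
  induction hx using Submodule.iSup_induction' with
  | zero => rw [map_zero, LinearMap.zero_apply]; exact zero_mem _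
  | add x x' _ _ h h' => rw [map_add, LinearMap.add_apply]; exact add_mem h h'
  | mem i x hx =>
    induction hy using Submodule.iSup_induction' with
    | zero => rw [map_zero]; exact zero_mem _
    | add y y' _ _ h h' => rw [map_add]; exact add_mem h h'
    | mem j y hy => exact Submodule.mem_iSup_of_mem (i + j) (mem_convolve hx hy)

/-- A shift of an internal grading is an internal grading. -/
theorem isInternal_shift (hP : DirectSum.IsInternal P) (d : ℤ) :
    DirectSum.IsInternal fun n => P (n + d) := by
  obtain ⟨δ, hδ⟩ := exists_isDecomp hP
  refine isInternal_of_isDecomp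
    (δ := (Finsupp.lmapDomain X K fun n => n - d).comp δ) ?_ fun n x hx => ?_
  · rw [eq_top_iff, ← hP.submodule_iSup_eq_top]
    exact iSup_le fun n => le_iSup_of_le (n - d) (by rw [sub_add_cancel])
  · rw [LinearMap.comp_apply, hδ _ x hx, Finsupp.lmapDomain_apply, Finsupp.mapDomain_single,
      add_sub_cancel_right]

end Convolve

/-! ### Filtrations by powers and gradings by generators; tensor products -/

section PowTensor

variable {K : Type u} [CommRing K] {A : Type u} [Ring A] [Algebra K A]

/-- The filtration of an algebra by the powers of a two-sided ideal `I`: `F^n = I^n` for `n ≥ 1`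
and `F^n` is everything for `n ≤ 0`. -/
def powFil (I : Submodule K A) (n : ℤ) : Submodule K A :=
  if n ≤ 0 then ⊤ else I ^ n.toNat

theorem powFil_of_nonpos (I : Submodule K A) {n : ℤ} (h : n ≤ 0) : powFil I n = ⊤ := if_pos h

theorem powFil_succ (I : Submodule K A) (n : ℕ) : powFil I (n + 1 : ℕ) = I ^ (n + 1) := by
  rw [powFil, if_neg (by omega), Int.toNat_natCast]

theorem powFil_one (I : Submodule K A) : powFil I 1 = I := by
  have := powFil_succ I 0
  rwa [zero_add, pow_one] at this

theorem powFil_isAlgFiltration {I : Submodule K A} (hl : ∀ a, ∀ x ∈ I, a * x ∈ I)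
    (hr : ∀ a, ∀ x ∈ I, x * a ∈ I) : IsAlgFiltration (powFil I) := by
  have hl' : ∀ n : ℕ, ⊤ * I ^ (n + 1) ≤ I ^ (n + 1) := fun n => by
    rw [pow_succ', ← mul_assoc]
    exact mul_le_mul' (Submodule.mul_le.2 fun a _ x hx => hl a x hx) le_rfl
  have hr' : ∀ n : ℕ, I ^ (n + 1) * ⊤ ≤ I ^ (n + 1) := fun n => by
    rw [pow_succ, mul_assoc]
    exact mul_le_mul' le_rfl (Submodule.mul_le.2 fun x hx a _ => hr a x hx)
  have anti : Antitone (powFil I) := by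
    refine antitone_int_of_succ_le fun n => ?_
    rcases le_or_gt n 0 with h | h
    · rw [powFil_of_nonpos I h]; exact le_top
    · obtain ⟨m, rfl⟩ : ∃ m : ℕ, n = (m + 1 : ℕ) := ⟨(n - 1).toNat, by omega⟩
      rw [← Nat.cast_succ, powFil_succ, powFil_succ, pow_succ _ (m + 1)]
      exact (mul_le_mul' le_rfl le_top).trans (hr' m)
  refine ⟨anti, by rw [powFil_of_nonpos I le_rfl]; trivial, fun i j a ha b hb => ?_⟩
  rcases le_or_gt i 0 with hi | hi
  · refine anti (show i + j ≤ j by omega) ?_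
    rcases le_or_gt j 0 with hj | hj
    · rw [powFil_of_nonpos I hj]; trivial
    · obtain ⟨m, rfl⟩ : ∃ m : ℕ, j = (m + 1 : ℕ) := ⟨(j - 1).toNat, by omega⟩
      rw [powFil_succ] at hb ⊢
      exact hl' m (Submodule.mul_mem_mul Submodule.mem_top hb)
  · rcases le_or_gt j 0 with hj | hj
    · refine anti (show i + j ≤ i by omega) ?_
      obtain ⟨m, rfl⟩ : ∃ m : ℕ, i = (m + 1 : ℕ) := ⟨(i - 1).toNat, by omega⟩
      rw [powFil_succ] at ha ⊢
      exact hr' m (Submodule.mul_mem_mul ha Submodule.mem_top)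
    · obtain ⟨m, rfl⟩ : ∃ m : ℕ, i = (m + 1 : ℕ) := ⟨(i - 1).toNat, by omega⟩
      obtain ⟨k, rfl⟩ : ∃ m : ℕ, j = (m + 1 : ℕ) := ⟨(j - 1).toNat, by omega⟩
      rw [powFil_succ] at ha hb
      rw [← Nat.cast_add, show m + 1 + (k + 1) = (m + 1 + k) + 1 by ring, powFil_succ,
        show m + 1 + k + 1 = (m + 1) + (k + 1) by ring, pow_add]
      exact Submodule.mul_mem_mul ha hb

/-- An algebra morphism sending `I` to `F^1` sends the powers of `I` to the filtration `F`. -/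
theorem map_powFil_le {B : Type u} [Ring B] [Algebra K B] {I : Submodule K A}
    {F : ℤ → Submodule K B} [IsAlgFiltration F] (hF : ∀ n ≤ 0, F n = ⊤) (f : A →ₐ[K] B)
    (h : ∀ x ∈ I, f x ∈ F 1) (n : ℤ) (x : A) (hx : x ∈ powFil I n) : f x ∈ F n := by
  rcases le_or_gt n 0 with hn | hn
  · rw [hF n hn]; trivial
  · obtain ⟨m, rfl⟩ : ∃ m : ℕ, n = (m + 1 : ℕ) := ⟨(n - 1).toNat, by omega⟩
    rw [powFil_succ] at hx
    have : I ^ (m + 1) ≤ (F (m + 1 : ℕ)).comap f.toLinearMap := by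
      clear hx hn
      induction m with
      | zero => rw [zero_add, pow_one]; exact h
      | succ m ih =>
        rw [pow_succ]
        refine Submodule.mul_le.2 fun a ha b hb => ?_
        rw [Submodule.mem_comap, AlgHom.toLinearMap_apply, map_mul]
        have := IsAlgFiltration.mul_mem (F := F) _ 1 _ (ih ha) _ (h b hb)
        exact_mod_cast this
    exact this hx

/-- The grading of an algebra generated by the submodule `W` of elements of degree `1`. -/
def genGrading (W : Submodule K A) (n : ℤ) : Submodule K A :=
  if 0 ≤ n then W ^ n.toNat else ⊥

theorem genGrading_natCast (W : Submodule K A) (n : ℕ) : genGrading W n = W ^ n := by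
  rw [genGrading, if_pos (by omega), Int.toNat_natCast]

theorem genGrading_one (W : Submodule K A) : genGrading W 1 = W := by
  have := genGrading_natCast W 1
  rwa [pow_one] at this

theorem genGrading_of_neg (W : Submodule K A) {n : ℤ} (h : n < 0) : genGrading W n = ⊥ :=
  if_neg (by omega)

theorem genGrading_mul_mem (W : Submodule K A) (i j : ℤ) (a : A) (ha : a ∈ genGrading W i)
    (b : A) (hb : b ∈ genGrading W j) : a * b ∈ genGrading W (i + j) := by
  rcases lt_or_ge i 0 with hi | hi
  · rw [genGrading_of_neg W hi, Submodule.mem_bot] at ha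
    rw [ha, zero_mul]; exact zero_mem _
  rcases lt_or_ge j 0 with hj | hj
  · rw [genGrading_of_neg W hj, Submodule.mem_bot] at hb
    rw [hb, mul_zero]; exact zero_mem _
  lift i to ℕ using hi
  lift j to ℕ using hj
  rw [genGrading_natCast] at ha hb
  rw [← Nat.cast_add, genGrading_natCast, pow_add]
  exact Submodule.mul_mem_mul ha hb

theorem genGrading_one_mem (W : Submodule K A) : (1 : A) ∈ genGrading W 0 := by
  have := genGrading_natCast W 0
  rw [Nat.cast_zero] at this
  rw [this, pow_zero]
  exact Submodule.one_le.1 le_rfl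

/-- An algebra morphism sending `W` to degree `1` is graded. -/
theorem map_genGrading_le {B : Type u} [Ring B] [Algebra K B] {W : Submodule K A}
    {gB : ℤ → Submodule K B} (h1 : (1 : B) ∈ gB 0)
    (hm : ∀ i j, ∀ a ∈ gB i, ∀ b ∈ gB j, a * b ∈ gB (i + j)) (f : A →ₐ[K] B)
    (h : ∀ x ∈ W, f x ∈ gB 1) (n : ℤ) (x : A) (hx : x ∈ genGrading W n) : f x ∈ gB n := by
  rcases lt_or_ge n 0 with hn | hn
  · rw [genGrading_of_neg W hn, Submodule.mem_bot] at hx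
    rw [hx, map_zero]; exact zero_mem _
  lift n to ℕ using hn
  rw [genGrading_natCast] at hx
  have : W ^ n ≤ (gB n).comap f.toLinearMap := by
    clear hx
    induction n with
    | zero =>
      rw [pow_zero, Submodule.one_le, Submodule.mem_comap, AlgHom.toLinearMap_apply, map_one]
      exact h1
    | succ m ih =>
      rw [pow_succ]
      refine Submodule.mul_le.2 fun a ha b hb => ?_
      rw [Submodule.mem_comap, AlgHom.toLinearMap_apply, map_mul]
      have := hm _ 1 _ (ih ha) _ (h b hb)
      exact_mod_cast this
  exact this hx

theorem genGrading_isAlgGrading {W : Submodule K A} (hW : Algebra.adjoin K (W : Set A) = ⊤)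
    (δ : A →ₐ[K] AddMonoidAlgebra A ℤ)
    (hδ : ∀ w ∈ W, δ w = AddMonoidAlgebra.single 1 w) : IsAlgGrading (genGrading W) := by
  refine ⟨?_, genGrading_one_mem W, genGrading_mul_mem W⟩
  let e : AddMonoidAlgebra A ℤ →ₗ[K] (ℤ →₀ A) :=
    { toFun := fun x => x.coeff
      map_add' := fun _ _ => rfl
      map_smul' := fun _ _ => rfl }
  refine isInternal_of_isDecomp (δ := e.comp δ.toLinearMap) ?_ fun n x hx => ?_
  · let S : Subalgebra K A :=
      { carrier := (⨆ n, genGrading W n : Submodule K A)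
        mul_mem' := fun {a b} ha hb => by
          rw [SetLike.mem_coe] at ha hb ⊢
          induction ha using Submodule.iSup_induction' with
          | zero => rw [zero_mul]; exact zero_mem _
          | add x x' _ _ h h' => rw [add_mul]; exact add_mem h h'
          | mem i x hx =>
            induction hb using Submodule.iSup_induction' with
            | zero => rw [mul_zero]; exact zero_mem _
            | add y y' _ _ h h' => rw [mul_add]; exact add_mem h h'
            | mem j y hy =>
              exact Submodule.mem_iSup_of_mem (i + j) (genGrading_mul_mem W i j x hx y hy)
        add_mem' := fun {a b} ha hb => add_mem (S := Submodule K A) ha hb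
        algebraMap_mem' := fun k => by
          rw [Algebra.algebraMap_eq_smul_one]
          exact Submodule.smul_mem _ _
            (Submodule.mem_iSup_of_mem 0 (genGrading_one_mem W)) }
    have hS : S = ⊤ := by
      rw [eq_top_iff, ← hW]
      refine Algebra.adjoin_le fun w hw => ?_
      exact Submodule.mem_iSup_of_mem 1 (by rwa [genGrading_one])
    rw [eq_top_iff]
    intro x _
    have : x ∈ S := hS ▸ Algebra.mem_top
    exact this
  · suffices h : δ x = AddMonoidAlgebra.single n x from congrArg (fun y => y.coeff) h
    rcases lt_or_ge n 0 with hn | hn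
    · rw [genGrading_of_neg W hn, Submodule.mem_bot] at hx
      rw [hx, map_zero, AddMonoidAlgebra.single_zero]
    lift n to ℕ using hn
    rw [genGrading_natCast] at hx
    induction n generalizing x with
    | zero =>
      rw [pow_zero] at hx
      obtain ⟨k, rfl⟩ := Submodule.mem_one.1 hx
      rw [AlgHom.commutes]
      rfl
    | succ m ih =>
      rw [pow_succ] at hx
      induction hx using Submodule.mul_induction_on' with
      | mem_mul_mem a ha b hb =>
        rw [map_mul, ih a ha, hδ b hb, AddMonoidAlgebra.single_mul_single]
        rfl
      | add a _ b _ h h' => rw [map_add, h, h', AddMonoidAlgebra.single_add]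

end PowTensor

/-! ### Filtration and grading of `A ⊗ A` -/

section TensorFil

variable {K : Type u} [CommRing K] {A : Type u} [Ring A] [Algebra K A]

/-- `(A ⊗ A)_n = ∑_{i+j=n} A_i ⊗ A_j`, for a filtration or a grading of `A`. -/
def tensorFil (F : ℤ → Submodule K A) : ℤ → Submodule K (A ⊗[K] A) :=
  convolve (TensorProduct.mk K A A) F F

theorem tensorFil_mul_mem {F : ℤ → Submodule K A}
    (hF : ∀ i j, ∀ a ∈ F i, ∀ b ∈ F j, a * b ∈ F (i + j)) (i j : ℤ) (a : A ⊗[K] A)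
    (ha : a ∈ tensorFil F i) (b : A ⊗[K] A) (hb : b ∈ tensorFil F j) :
    a * b ∈ tensorFil F (i + j) := by
  have key : tensorFil F i ≤ (tensorFil F (i + j)).comap (LinearMap.mulRight K b) := by
    refine convolve_le fun i₁ i₂ hi x hx y hy => ?_
    rw [Submodule.mem_comap, LinearMap.mulRight_apply]
    have key' : tensorFil F j ≤
        (tensorFil F (i + j)).comap (LinearMap.mulLeft K (TensorProduct.mk K A A x y)) := by
      refine convolve_le fun j₁ j₂ hj x' hx' y' hy' => ?_
      rw [Submodule.mem_comap, LinearMap.mulLeft_apply, TensorProduct.mk_apply,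
        TensorProduct.mk_apply, Algebra.TensorProduct.tmul_mul_tmul]
      exact mem_convolve' (β := TensorProduct.mk K A A) (by rw [← hi, ← hj]; ring)
        (hF _ _ _ hx _ hx') (hF _ _ _ hy _ hy')
    exact key' hb
  exact key ha

theorem tensorFil_one_mem {F : ℤ → Submodule K A} (hF : (1 : A) ∈ F 0) :
    (1 : A ⊗[K] A) ∈ tensorFil F 0 :=
  mem_convolve' (β := TensorProduct.mk K A A) (add_zero 0) hF hF

theorem tensorFil_isAlgFiltration (F : ℤ → Submodule K A) [IsAlgFiltration F] :
    IsAlgFiltration (tensorFil F) where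
  antitone := fun m n h => convolve_le fun i j hij x hx y hy =>
    mem_convolve' (β := TensorProduct.mk K A A) (show (i - (n - m)) + j = m by omega)
      (IsAlgFiltration.antitone (F := F) (by omega) hx) hy
  one_mem := tensorFil_one_mem IsAlgFiltration.one_mem
  mul_mem := tensorFil_mul_mem IsAlgFiltration.mul_mem

theorem tensorFil_isAlgGrading (gA : ℤ → Submodule K A) [h : IsAlgGrading gA] :
    IsAlgGrading (tensorFil gA) where
  isInternal := by
    obtain ⟨δ, hδ⟩ := exists_isDecomp h.isInternal
    refine isInternal_of_isDecomp
      (δ := TensorProduct.lift (gradeBil (TensorProduct.mk K A A) δ δ)) ?_ ?_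
    · refine iSup_convolve h.isInternal.submodule_iSup_eq_top
        h.isInternal.submodule_iSup_eq_top fun S hS => ?_
      rw [eq_top_iff, ← TensorProduct.span_tmul_eq_top, Submodule.span_le]
      rintro _ ⟨x, y, rfl⟩
      exact hS x y
    · refine isDecomp_convolve fun i j x hx y hy => ?_
      rw [TensorProduct.mk_apply, TensorProduct.lift.tmul, gradeBil_apply hδ hδ hx hy]
      rfl
  one_mem := tensorFil_one_mem IsAlgGrading.one_mem
  mul_mem := tensorFil_mul_mem IsAlgGrading.mul_mem

end TensorFil

/-! ### The grading of `ker p ⊗_P W` -/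

section KerGrading

variable {K : Type u} [CommRing K] {V P V' W : Type u} [Ring V] [Algebra K V] [Ring P]
  [Algebra K P] [Ring V'] [Algebra K V'] [Ring W] [Algebra K W]

/-- The homogeneous elements of degree `n` of `ker p`. -/
def KerMod.grading (p : P →ₐ[K] V') (gP : ℤ → Submodule K P) (n : ℤ) : Submodule K (KerMod p) :=
  (gP n).comap (KerMod.incl p)

theorem KerMod.incl_injective (p : P →ₐ[K] V') : Function.Injective (KerMod.incl p) :=
  fun _ _ h => KerMod.ext h

theorem KerMod.grading_isInternal {p : P →ₐ[K] V'} {gP : ℤ → Submodule K P}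
    {gV' : ℤ → Submodule K V'} (hP : DirectSum.IsInternal gP) (hV' : DirectSum.IsInternal gV')
    (hp : ∀ n, ∀ x ∈ gP n, p x ∈ gV' n) : DirectSum.IsInternal (KerMod.grading p gP) := by
  obtain ⟨δ, hδ⟩ := exists_isDecomp hP
  obtain ⟨ε, hε⟩ := exists_isDecomp hV'
  have h1 : ∀ x : P, ε (p x) = (δ x).mapRange p (map_zero p) := by
    intro x
    have hx : x ∈ ⨆ i, gP i := hP.submodule_iSup_eq_top ▸ Submodule.mem_top
    induction hx using Submodule.iSup_induction' with
    | zero => simp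
    | add x y _ _ h h' =>
      rw [map_add, map_add, h, h', map_add, Finsupp.mapRange_add fun a b => map_add p a b]
    | mem i x hx => rw [hδ i x hx, hε i _ (hp i x hx), Finsupp.mapRange_single]
  have h2 : ∀ x : P, ∀ n, δ x n ∈ gP n := by
    intro x n
    have hx : x ∈ ⨆ i, gP i := hP.submodule_iSup_eq_top ▸ Submodule.mem_top
    induction hx using Submodule.iSup_induction' with
    | zero => simp
    | add x y _ _ h h' => rw [map_add]; exact add_mem h h'
    | mem i x hx =>
      rw [hδ i x hx, Finsupp.single_apply]
      split_ifs with h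
      · exact h ▸ hx
      · exact zero_mem _
  have h3 : ∀ x : P, ∑ n ∈ (δ x).support, δ x n = x := by
    intro x
    have : (Finsupp.lsum K fun _ : ℤ => (LinearMap.id : P →ₗ[K] P)) (δ x) = x := by
      have hx : x ∈ ⨆ i, gP i := hP.submodule_iSup_eq_top ▸ Submodule.mem_top
      induction hx using Submodule.iSup_induction' with
      | zero => simp
      | add x y _ _ h h' => rw [map_add, map_add, h, h']
      | mem i x hx => simp [hδ i x hx]
    exact this
  refine DirectSum.isInternal_submodule_of_iSupIndep_of_iSup_eq_top ?_ ?_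
  · exact iSupIndep_of_single (KerMod.incl_injective p) (δ := δ.comp (KerMod.incl p))
      fun n x hx => hδ n _ hx
  · rw [eq_top_iff]
    intro x _
    have hk : ∀ n, p (δ (KerMod.incl p x) n) = 0 := fun n => by
      have := DFunLike.congr_fun (h1 (KerMod.incl p x)) n
      rw [KerMod.map_incl, map_zero, Finsupp.mapRange_apply] at this
      exact this.symm
    have : x = ∑ n ∈ (δ (KerMod.incl p x)).support, KerMod.mk _ (hk n) := by
      apply KerMod.ext
      rw [map_sum]
      exact (h3 _).symm
    rw [this]
    exact sum_mem fun n _ => Submodule.mem_iSup_of_mem n (h2 _ n)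

namespace KerTensor

variable (p : P →ₐ[K] V') (q : P →ₐ[K] W)

/-- The homogeneous elements of degree `n` of `ker p ⊗_P W`: the span of the `x ⊗ w` with `x` and
`w` homogeneous of degrees `i` and `j` with `i + j = n`. -/
def grading (gP : ℤ → Submodule K P) (gW : ℤ → Submodule K W) : ℤ → Submodule K (KerTensor p q) :=
  convolve (tmul p q) (KerMod.grading p gP) gW

theorem grading_isInternal {gP : ℤ → Submodule K P} {gV' : ℤ → Submodule K V'}
    {gW : ℤ → Submodule K W} (hP : IsAlgGrading gP) (hV' : IsAlgGrading gV')
    (hW : IsAlgGrading gW) (hp : ∀ n, ∀ x ∈ gP n, p x ∈ gV' n)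
    (hq : ∀ n, ∀ x ∈ gP n, q x ∈ gW n) : DirectSum.IsInternal (grading p q gP gW) := by
  have hJ := KerMod.grading_isInternal hP.isInternal hV'.isInternal hp
  obtain ⟨δ, hδ⟩ := exists_isDecomp hJ
  obtain ⟨ε, hε⟩ := exists_isDecomp hW.isInternal
  have rel : ∀ (x : KerMod p) (a : P) (w : W),
      gradeBil (tmul p q) δ ε (KerMod.mulRight p a x) w =
        gradeBil (tmul p q) δ ε x (q a * w) := by
    intro x a w
    have hx : x ∈ ⨆ i, KerMod.grading p gP i := hJ.submodule_iSup_eq_top ▸ Submodule.mem_top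
    have ha : a ∈ ⨆ i, gP i := hP.isInternal.submodule_iSup_eq_top ▸ Submodule.mem_top
    have hw : w ∈ ⨆ i, gW i := hW.isInternal.submodule_iSup_eq_top ▸ Submodule.mem_top
    induction hx using Submodule.iSup_induction' with
    | zero => simp
    | add x y _ _ h h' => simp only [map_add, LinearMap.add_apply, h, h']
    | mem i x hx =>
      induction ha using Submodule.iSup_induction' with
      | zero =>
        have : KerMod.mulRight p 0 x = 0 := KerMod.ext ((mul_zero _).trans (map_zero _).symm)
        rw [this, map_zero, map_zero, LinearMap.zero_apply, zero_mul, map_zero]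
      | add a b _ _ h h' =>
        have : KerMod.mulRight p (a + b) x = KerMod.mulRight p a x + KerMod.mulRight p b x :=
          KerMod.ext (by
            rw [map_add]
            exact mul_add _ _ _)
        rw [this, map_add, LinearMap.add_apply, h, h', map_add, add_mul, map_add]
      | mem k a ha =>
        induction hw using Submodule.iSup_induction' with
        | zero => rw [mul_zero, map_zero, map_zero]
        | add w w' _ _ h h' => rw [mul_add, map_add, map_add, h, h']
        | mem j w hw =>
          rw [gradeBil_apply hδ hε (i := i + k) (j := j)
              (hP.mul_mem i k _ hx a ha) hw,
            gradeBil_apply hδ hε (i := i) (j := k + j) hx (hW.mul_mem k j _ (hq k a ha) w hw),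
            tmul_mul, add_assoc]
  refine isInternal_of_isDecomp (δ := (kerTensorRel p q).liftQ
    (TensorProduct.lift (gradeBil (tmul p q) δ ε)) (Submodule.span_le.2 ?_)) ?_ ?_
  · refine iSup_convolve hJ.submodule_iSup_eq_top hW.isInternal.submodule_iSup_eq_top
      fun S hS => ?_
    rw [eq_top_iff]
    intro m _
    induction m using KerTensor.induction with
    | h0 => exact zero_mem _
    | ht x w => exact hS x w
    | ha a b h h' => exact add_mem (h trivial) (h' trivial)
  · rintro _ ⟨x, a, w, rfl⟩
    rw [SetLike.mem_coe, LinearMap.mem_ker, map_sub, TensorProduct.lift.tmul,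
      TensorProduct.lift.tmul, rel, sub_self]
  · refine isDecomp_convolve fun i j x hx w hw => ?_
    rw [← gradeBil_apply hδ hε hx hw]
    rfl

/-- The graded bimodule `(V, ker p ⊗_P W, W)`, with `M_n` the homogeneous elements of degree
`n + d` of `ker p ⊗_P W`. -/
def grBimodule {gV : ℤ → Submodule K V} {gP : ℤ → Submodule K P} {gV' : ℤ → Submodule K V'}
    {gW : ℤ → Submodule K W} (hV : IsAlgGrading gV) (hP : IsAlgGrading gP)
    (hV' : IsAlgGrading gV') (hW : IsAlgGrading gW) (hp : ∀ n, ∀ x ∈ gP n, p x ∈ gV' n)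
    (hq : ∀ n, ∀ x ∈ gP n, q x ∈ gW n) (ℓ : V →ₐ[K] P) (hℓ : ∀ n, ∀ v ∈ gV n, ℓ v ∈ gP n)
    (d : ℤ) : GrBimodule K where
  toKBimodule := bimodule p q ℓ
  gB := gV
  gM n := grading p q gP gW (n + d)
  gA := gW
  grB := hV
  grA := hW
  isInternalM := isInternal_shift (grading_isInternal p q hP hV' hW hp hq) d
  act_mem i j m hm (w : W) hw := by
    have : grading p q gP gW (i + d) ≤ (grading p q gP gW (i + j + d)).comap (actR p q w) :=
      convolve_le fun i₁ i₂ hi x hx w' hw' => by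
        rw [Submodule.mem_comap, actR_tmul]
        exact mem_convolve' (by omega) hx (hW.mul_mem _ _ _ hw' _ hw)
    exact this hm
  ρ_mem i j (v : V) hv m hm := by
    have : grading p q gP gW (j + d) ≤ (grading p q gP gW (i + j + d)).comap (actL p q (ℓ v)) :=
      convolve_le fun i₁ i₂ hi x hx w' hw' => by
        rw [Submodule.mem_comap, actL_tmul]
        exact mem_convolve' (show (i + i₁) + i₂ = _ by omega)
          (hP.mul_mem _ _ _ (hℓ _ _ hv) _ hx) hw'
    exact this hm

end KerTensor

end KerGrading

/-! ### Rows and columns -/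

section RowCol

variable {K : Type u} [CommRing K] {P V' W : Type u} [Ring P] [Algebra K P] [Ring V']
  [Algebra K V'] [Ring W] [Algebra K W]

/-- The morphism `W^3 → ker p ⊗_P W`, `(a_1, a_2, a_3) ↦ ∑ i, u_i ⊗ a_i` of right
`W`-modules. -/
def KerTensor.kappa (p : P →ₐ[K] V') (q : P →ₐ[K] W) (u : Fin 3 → KerMod p) :
    (Fin 3 → W) →ₗ[Wᵐᵒᵖ] KerTensor p q where
  toFun a := ∑ i, KerTensor.tmul p q (u i) (a i)
  map_add' a b := by simp only [Pi.add_apply, map_add, Finset.sum_add_distrib]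
  map_smul' w a := by
    rw [RingHom.id_apply, Finset.smul_sum]
    rfl

/-- The morphism `W^3 → W` of right `W`-modules given by a row. -/
def rowMap (w : Fin 3 → W) : (Fin 3 → W) →ₗ[Wᵐᵒᵖ] W where
  toFun a := ∑ i, w i * a i
  map_add' a b := by simp only [Pi.add_apply, mul_add, Finset.sum_add_distrib]
  map_smul' b a := by
    rw [RingHom.id_apply, Finset.smul_sum]
    exact Finset.sum_congr rfl fun i _ => mul_smul_comm b (w i) (a i)

/-- The morphism `W → W^3` of right `W`-modules given by a column. -/
def colMap (w : Fin 3 → W) : W →ₗ[Wᵐᵒᵖ] (Fin 3 → W) where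
  toFun a i := w i * a
  map_add' _ _ := funext fun _ => mul_add _ _ _
  map_smul' b a := funext fun i => mul_smul_comm b (w i) a

end RowCol

/-! ### Pure braid groups -/

/-- The pairs `ij` with `1 ≤ i < j ≤ 4`. -/
inductive Pair : Type
  | p12 | p13 | p14 | p23 | p24 | p34

namespace Betti

open Pair

open scoped commutatorElement

/-- The free group `F_2` on `X_0`, `X_1`. -/
abbrev F2 : Type := FreeGroup (Fin 2)

/-- The relations `(abc, a) = (abc, b) = (abc, c) = 1`. -/
def tripleRels {G : Type} [Group G] (a b c : G) : Set G :=
  {⁅a * b * c, a⁆, ⁅a * b * c, b⁆, ⁅a * b * c, c⁆}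

/-- The generators `x_ij`, in the free group on them. -/
def y (a : Pair) : FreeGroup Pair := FreeGroup.of a

/-- The relations of the pure braid group on four strands. -/
def relsK4 : Set (FreeGroup Pair) :=
  tripleRels (y p12) (y p13) (y p23) ∪ tripleRels (y p12) (y p14) (y p24) ∪
  tripleRels (y p13) (y p14) (y p34) ∪ tripleRels (y p23) (y p24) (y p34) ∪
  {⁅y p12, y p34⁆, ⁅y p13, (y p12)⁻¹ * y p24 * y p12⁆, ⁅y p14, y p23⁆}

/-- The pure braid group `K_4` on four strands. -/
abbrev K4 : Type := PresentedGroup relsK4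

/-- The generator `ω_4 = x_12 x_13 x_23 x_14 x_24 x_34` of the center of `K_4`. -/
def ω4 : K4 :=
  PresentedGroup.of p12 * PresentedGroup.of p13 * PresentedGroup.of p23 *
    PresentedGroup.of p14 * PresentedGroup.of p24 * PresentedGroup.of p34

/-- `P_5^* = K_4 / ⟨ω_4⟩`. -/
abbrev P5 : Type := K4 ⧸ Subgroup.normalClosure {ω4}

/-- The class of `x_ij` in `P_5^*`. -/
def x (a : Pair) : P5 := QuotientGroup.mk (PresentedGroup.of a)

/-- The group morphism `P_5^* → G` sending the generators `x_ij` to given elements. -/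
def P5lift {G : Type} [Group G] (f : Pair → G) (h : ∀ r ∈ relsK4, FreeGroup.lift f r = 1)
    (hω : f p12 * f p13 * f p23 * f p14 * f p24 * f p34 = 1) : P5 →* G :=
  QuotientGroup.lift _ (PresentedGroup.toGroup h) (Subgroup.normalClosure_le_normal (by
    rintro _ rfl
    rw [SetLike.mem_coe, MonoidHom.mem_ker, ω4]
    simp only [map_mul, PresentedGroup.toGroup.of]
    exact hω))

theorem P5lift_x {G : Type} [Group G] (f : Pair → G) (h : ∀ r ∈ relsK4, FreeGroup.lift f r = 1)
    (hω : f p12 * f p13 * f p23 * f p14 * f p24 * f p34 = 1) (a : Pair) :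
    P5lift f h hω (x a) = f a :=
  PresentedGroup.toGroup.of h

/-- The generators `X_0`, `X_1` of `F_2`. -/
def X (i : Fin 2) : F2 := FreeGroup.of i

/-- The images of the `x_ij` under `pr_1`. -/
def pr1Fun : Pair → F2
  | p12 => 1
  | p13 => 1
  | p14 => 1
  | p23 => X 0
  | p24 => (X 1 * X 0)⁻¹
  | p34 => X 1

/-- The images of the `x_ij` under `pr_2`. -/
def pr2Fun : Pair → F2
  | p12 => 1
  | p13 => (X 0 * X 1)⁻¹
  | p14 => X 0
  | p23 => 1
  | p24 => 1
  | p34 => X 1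

/-- The images of the `x_ij` under `pr_5`. -/
def pr5Fun : Pair → F2
  | p12 => X 1
  | p13 => (X 0 * X 1)⁻¹
  | p14 => X 0
  | p23 => X 0
  | p24 => (X 1 * X 0)⁻¹
  | p34 => X 1

/-- `pr_1 : P_5^* → F_2`. -/
def pr1 : P5 →* F2 :=
  P5lift pr1Fun
    (by
      rintro r ((((hr | hr) | hr) | hr) | hr) <;>
        rcases hr with rfl | rfl | rfl <;>
        simp [y, pr1Fun, commutatorElement_def])
    (by simp only [pr1Fun]; group)

/-- `pr_2 : P_5^* → F_2`. -/
def pr2 : P5 →* F2 :=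
  P5lift pr2Fun
    (by
      rintro r ((((hr | hr) | hr) | hr) | hr) <;>
        rcases hr with rfl | rfl | rfl <;>
        (simp [y, pr2Fun, commutatorElement_def]; try group))
    (by simp only [pr2Fun]; group)

/-- `pr_5 : P_5^* → F_2`. -/
def pr5 : P5 →* F2 :=
  P5lift pr5Fun
    (by
      rintro r ((((hr | hr) | hr) | hr) | hr) <;>
        rcases hr with rfl | rfl | rfl <;>
        (simp [y, pr5Fun, commutatorElement_def]; try group))
    (by simp only [pr5Fun]; group)

/-- The section `ℓ : F_2 → P_5^*` of `pr_5`: `X_0 ↦ x_23`, `X_1 ↦ x_12`. -/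
def ell : F2 →* P5 := FreeGroup.lift ![x p23, x p12]

/-- `x_15`, `x_25`, `x_35`. -/
def x5 : Fin 3 → P5 :=
  ![(x p12 * x p13 * x p14)⁻¹, (x p12 * x p23 * x p24)⁻¹, (x p13 * x p23 * x p34)⁻¹]

theorem pr1_x (a : Pair) : pr1 (x a) = pr1Fun a := P5lift_x _ _ _ a
theorem pr2_x (a : Pair) : pr2 (x a) = pr2Fun a := P5lift_x _ _ _ a
theorem pr5_x (a : Pair) : pr5 (x a) = pr5Fun a := P5lift_x _ _ _ a

theorem pr5_x5 (i : Fin 3) : pr5 (x5 i) = 1 := by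
  fin_cases i <;> simp [x5, pr5_x, pr5Fun]

theorem pr1_surj (g : F2) : ∃ h, pr1 h = g ∧ pr2 h = 1 := by
  induction g using FreeGroup.induction_on with
  | C1 => exact ⟨1, map_one _, map_one _⟩
  | of i =>
    fin_cases i
    · exact ⟨x p23, pr1_x _, pr2_x _⟩
    · refine ⟨x p34 * x p13 * x p14, ?_, ?_⟩ <;>
        simp [pr1_x, pr2_x, pr1Fun, pr2Fun, X]
  | inv_of i ih => obtain ⟨h, h1, h2⟩ := ih; exact ⟨h⁻¹, by simp [h1], by simp [h2]⟩
  | mul a b ha hb =>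
    obtain ⟨h, h1, h2⟩ := ha
    obtain ⟨k, h3, h4⟩ := hb
    exact ⟨h * k, by simp [h1, h3], by simp [h2, h4]⟩

theorem pr2_surj (g : F2) : ∃ h, pr1 h = 1 ∧ pr2 h = g := by
  induction g using FreeGroup.induction_on with
  | C1 => exact ⟨1, map_one _, map_one _⟩
  | of i =>
    fin_cases i
    · exact ⟨x p14, pr1_x _, pr2_x _⟩
    · refine ⟨x p23 * x p24 * x p34, ?_, ?_⟩ <;>
        simp [pr1_x, pr2_x, pr1Fun, pr2Fun, X]
  | inv_of i ih => obtain ⟨h, h1, h2⟩ := ih; exact ⟨h⁻¹, by simp [h1], by simp [h2]⟩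
  | mul a b ha hb =>
    obtain ⟨h, h1, h2⟩ := ha
    obtain ⟨k, h3, h4⟩ := hb
    exact ⟨h * k, by simp [h1, h3], by simp [h2, h4]⟩

/-! ### Group algebras and their augmentation filtrations -/

section Aug

variable (K : Type u) [CommRing K]

/-- The augmentation ideal of `K G`: the submodule spanned by the `g - 1`. -/
def augIdeal (G : Type) [Group G] : Submodule K (MonoidAlgebra K G) :=
  Submodule.span K (Set.range fun g : G => MonoidAlgebra.of K G g - 1)

variable {G : Type} [Group G]

theorem of_sub_one_mem (g : G) : MonoidAlgebra.of K G g - 1 ∈ augIdeal K G :=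
  Submodule.subset_span ⟨g, rfl⟩

theorem augIdeal_mul_mem_left (a b : MonoidAlgebra K G) (hb : b ∈ augIdeal K G) :
    a * b ∈ augIdeal K G := by
  induction a using MonoidAlgebra.induction_linear with
  | zero => rw [zero_mul]; exact zero_mem _
  | add a a' h h' => rw [add_mul]; exact add_mem h h'
  | single h k =>
    rw [← MonoidAlgebra.smul_of, smul_mul_assoc]
    refine Submodule.smul_mem _ _ ?_
    induction hb using Submodule.span_induction with
    | zero => rw [mul_zero]; exact zero_mem _
    | add a a' _ _ h h' => rw [mul_add]; exact add_mem h h'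
    | smul k a _ h => rw [mul_smul_comm]; exact Submodule.smul_mem _ _ h
    | mem b hb =>
      obtain ⟨g, rfl⟩ := hb
      have : MonoidAlgebra.of K G h * (MonoidAlgebra.of K G g - 1) =
          (MonoidAlgebra.of K G (h * g) - 1) - (MonoidAlgebra.of K G h - 1) := by
        rw [map_mul]; noncomm_ring
      rw [this]
      exact sub_mem (of_sub_one_mem K _) (of_sub_one_mem K _)

theorem augIdeal_mul_mem_right (a b : MonoidAlgebra K G) (hb : b ∈ augIdeal K G) :
    b * a ∈ augIdeal K G := by
  induction a using MonoidAlgebra.induction_linear with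
  | zero => rw [mul_zero]; exact zero_mem _
  | add a a' h h' => rw [mul_add]; exact add_mem h h'
  | single h k =>
    rw [← MonoidAlgebra.smul_of, mul_smul_comm]
    refine Submodule.smul_mem _ _ ?_
    induction hb using Submodule.span_induction with
    | zero => rw [zero_mul]; exact zero_mem _
    | add a a' _ _ h h' => rw [add_mul]; exact add_mem h h'
    | smul k a _ h => rw [smul_mul_assoc]; exact Submodule.smul_mem _ _ h
    | mem b hb =>
      obtain ⟨g, rfl⟩ := hb
      have : (MonoidAlgebra.of K G g - 1) * MonoidAlgebra.of K G h =
          (MonoidAlgebra.of K G (g * h) - 1) - (MonoidAlgebra.of K G h - 1) := by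
        rw [map_mul]; noncomm_ring
      rw [this]
      exact sub_mem (of_sub_one_mem K _) (of_sub_one_mem K _)

variable (G) in
/-- The augmentation filtration of `K G`. -/
def augFil : ℤ → Submodule K (MonoidAlgebra K G) := powFil (augIdeal K G)

instance : IsAlgFiltration (augFil K G) :=
  powFil_isAlgFiltration (augIdeal_mul_mem_left K) (augIdeal_mul_mem_right K)

theorem of_sub_one_mem_augFil (g : G) : MonoidAlgebra.of K G g - 1 ∈ augFil K G 1 := by
  rw [augFil, powFil_one]
  exact of_sub_one_mem K g

theorem map_augFil_le {B : Type u} [Ring B] [Algebra K B] {F : ℤ → Submodule K B}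
    [IsAlgFiltration F] (hF : ∀ n ≤ 0, F n = ⊤) (f : MonoidAlgebra K G →ₐ[K] B)
    (h : ∀ g : G, f (MonoidAlgebra.of K G g) - 1 ∈ F 1) (n : ℤ) (a : MonoidAlgebra K G)
    (ha : a ∈ augFil K G n) : f a ∈ F n := by
  refine map_powFil_le hF f (fun b hb => ?_) n a ha
  have : augIdeal K G ≤ (F 1).comap f.toLinearMap := Submodule.span_le.2 (by
    rintro _ ⟨g, rfl⟩
    rw [SetLike.mem_coe, Submodule.mem_comap, AlgHom.toLinearMap_apply, map_sub, map_one]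
    exact h g)
  exact this hb

end Aug

/-! ### The Betti bimodule -/

section Bimodule

variable (K : Type u) [CommRing K]

/-- `V^B = K F_2`. -/
abbrev V : Type u := MonoidAlgebra K F2

/-- `V^B ⊗ V^B`. -/
abbrev VV : Type u := V K ⊗[K] V K

/-- `K P_5^*`. -/
abbrev KP5 : Type u := MonoidAlgebra K P5

/-- `K pr_5 : K P_5^* → V^B`. -/
def Kpr5 : KP5 K →ₐ[K] V K := MonoidAlgebra.mapDomainAlgHom K K pr5

/-- `K pr_12 : K P_5^* → V^B ⊗ V^B`, sending `g ∈ P_5^*` to `pr_1 g ⊗ pr_2 g`. -/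
def Kpr12 : KP5 K →ₐ[K] VV K :=
  MonoidAlgebra.lift K (VV K) P5
    { toFun := fun g => MonoidAlgebra.of K F2 (pr1 g) ⊗ₜ MonoidAlgebra.of K F2 (pr2 g)
      map_one' := by simp only [map_one]; rfl
      map_mul' := fun g h => by
        simp only [map_mul, Algebra.TensorProduct.tmul_mul_tmul] }

/-- `K ℓ : V^B → K P_5^*`. -/
def Kell : V K →ₐ[K] KP5 K := MonoidAlgebra.mapDomainAlgHom K K ell

theorem Kpr5_of (g : P5) : Kpr5 K (MonoidAlgebra.of K P5 g) = MonoidAlgebra.of K F2 (pr5 g) := by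
  simp [Kpr5]

theorem Kell_of (g : F2) : Kell K (MonoidAlgebra.of K F2 g) = MonoidAlgebra.of K P5 (ell g) := by
  simp [Kell]

theorem Kpr12_of (g : P5) : Kpr12 K (MonoidAlgebra.of K P5 g) =
    MonoidAlgebra.of K F2 (pr1 g) ⊗ₜ MonoidAlgebra.of K F2 (pr2 g) := by
  rw [Kpr12, MonoidAlgebra.lift_of]
  rfl

/-- The filtration of `V^B ⊗ V^B`. -/
abbrev filVV : ℤ → Submodule K (VV K) := tensorFil (augFil K F2)

instance : IsAlgFiltration (filVV K) := tensorFil_isAlgFiltration _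

theorem tensor_le {S : Submodule K (VV K)} (h : ∀ a b : V K, a ⊗ₜ b ∈ S) : S = ⊤ := by
  rw [eq_top_iff, ← TensorProduct.span_tmul_eq_top, Submodule.span_le]
  rintro _ ⟨a, b, rfl⟩
  exact h a b

theorem filVV_of_nonpos (n : ℤ) (hn : n ≤ 0) : filVV K n = ⊤ :=
  tensor_le K fun a b =>
    mem_convolve' (β := TensorProduct.mk K (V K) (V K)) (add_zero n)
      (by rw [augFil, powFil_of_nonpos _ hn]; trivial)
      (by rw [augFil, powFil_of_nonpos _ le_rfl]; trivial)

theorem Kpr12_surjective : Function.Surjective (Kpr12 K) := by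
  rw [← AlgHom.coe_toLinearMap, ← LinearMap.range_eq_top]
  refine tensor_le K fun a b => ?_
  induction a using MonoidAlgebra.induction_on with
  | add a a' h h' => rw [TensorProduct.add_tmul]; exact add_mem h h'
  | smul k a h => rw [← TensorProduct.smul_tmul']; exact Submodule.smul_mem _ _ h
  | of g =>
    induction b using MonoidAlgebra.induction_on with
    | add a a' h h' => rw [TensorProduct.tmul_add]; exact add_mem h h'
    | smul k a h => rw [TensorProduct.tmul_smul]; exact Submodule.smul_mem _ _ h
    | of g' =>
      obtain ⟨h, h1, h2⟩ := pr1_surj g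
      obtain ⟨h', h1', h2'⟩ := pr2_surj g'
      refine ⟨MonoidAlgebra.of K P5 (h * h'), ?_⟩
      rw [AlgHom.toLinearMap_apply, Kpr12_of, map_mul pr1, map_mul pr2, h1, h2, h1', h2', mul_one, one_mul]

/-- `K pr_12` maps `F^n (K P_5^*)` onto `F^n (V^B ⊗ V^B)`. -/
theorem map_Kpr12 (n : ℤ) : (augFil K P5 n).map (Kpr12 K).toLinearMap = filVV K n := by
  have : IsAlgFiltration fun n => (augFil K P5 n).map (Kpr12 K).toLinearMap :=
    { antitone := fun m n h => Submodule.map_mono (IsAlgFiltration.antitone h)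
      one_mem := ⟨1, IsAlgFiltration.one_mem, map_one (Kpr12 K)⟩
      mul_mem := by
        rintro i j _ ⟨a, ha, rfl⟩ _ ⟨b, hb, rfl⟩
        exact ⟨a * b, IsAlgFiltration.mul_mem i j a ha b hb, map_mul (Kpr12 K) a b⟩ }
  have top : ∀ n ≤ (0 : ℤ), (augFil K P5 n).map (Kpr12 K).toLinearMap = ⊤ := fun n hn => by
    rw [augFil, powFil_of_nonpos _ hn, Submodule.map_top, LinearMap.range_eq_top]
    exact Kpr12_surjective K
  have i1 : ∀ i, ∀ a ∈ augFil K F2 i,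
      a ⊗ₜ 1 ∈ (augFil K P5 i).map (Kpr12 K).toLinearMap := fun i a ha => by
    refine map_augFil_le K top (Algebra.TensorProduct.includeLeft : V K →ₐ[K] VV K)
      (fun g => ?_) i a ha
    obtain ⟨h, h1, h2⟩ := pr1_surj g
    refine ⟨_, of_sub_one_mem_augFil K h, ?_⟩
    rw [AlgHom.toLinearMap_apply, map_sub, map_one, Kpr12_of, h1, h2, map_one]
    rfl
  have i2 : ∀ i, ∀ a ∈ augFil K F2 i,
      1 ⊗ₜ a ∈ (augFil K P5 i).map (Kpr12 K).toLinearMap := fun i a ha => by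
    refine map_augFil_le K top (Algebra.TensorProduct.includeRight : V K →ₐ[K] VV K)
      (fun g => ?_) i a ha
    obtain ⟨h, h1, h2⟩ := pr2_surj g
    refine ⟨_, of_sub_one_mem_augFil K h, ?_⟩
    rw [AlgHom.toLinearMap_apply, map_sub, map_one, Kpr12_of, h1, h2, map_one]
    rfl
  refine le_antisymm ?_ ?_
  · rintro _ ⟨a, ha, rfl⟩
    refine map_augFil_le K (filVV_of_nonpos K) (Kpr12 K) (fun g => ?_) n a ha
    have : Kpr12 K (MonoidAlgebra.of K P5 g) - 1 =
        (MonoidAlgebra.of K F2 (pr1 g) - 1) ⊗ₜ MonoidAlgebra.of K F2 (pr2 g) +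
          1 ⊗ₜ (MonoidAlgebra.of K F2 (pr2 g) - 1) := by
      rw [Kpr12_of, TensorProduct.sub_tmul, TensorProduct.tmul_sub,
        Algebra.TensorProduct.one_def]
      abel
    rw [this]
    refine add_mem ?_ ?_
    · refine mem_convolve' (β := TensorProduct.mk K (V K) (V K)) (add_zero 1)
        (of_sub_one_mem_augFil K _) ?_
      rw [augFil, powFil_of_nonpos _ le_rfl]
      trivial
    · exact mem_convolve' (β := TensorProduct.mk K (V K) (V K)) (zero_add 1)
        IsAlgFiltration.one_mem (of_sub_one_mem_augFil K _)
  · refine convolve_le fun i j hij a ha b hb => ?_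
    obtain ⟨a', ha', h1⟩ := i1 i a ha
    obtain ⟨b', hb', h2⟩ := i2 j b hb
    refine ⟨a' * b', hij ▸ IsAlgFiltration.mul_mem i j a' ha' b' hb', ?_⟩
    rw [AlgHom.toLinearMap_apply] at h1 h2 ⊢
    rw [map_mul, h1, h2, Algebra.TensorProduct.tmul_mul_tmul, one_mul, mul_one]
    rfl

theorem Kell_mem (n : ℤ) (v : V K) (hv : v ∈ augFil K F2 n) : Kell K v ∈ augFil K P5 n :=
  map_augFil_le K (F := augFil K P5) (fun _ hn => powFil_of_nonpos _ hn) (Kell K)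
    (fun g => by rw [Kell_of]; exact of_sub_one_mem_augFil K _) n v hv

/-- The filtered bimodule `(V^B, M^B, V^B ⊗ V^B)` with
`M^B = ker (K pr_5) ⊗_{K P_5^*} (V^B ⊗ V^B)`, where `F^n M^B` is the image of
`F^{n+d} (ker (K pr_5))` under `x ↦ x ⊗ 1`. -/
def bimodule (d : ℤ) : FilBimodule K :=
  KerTensor.filBimodule (Kpr5 K) (Kpr12 K) (FV := augFil K F2) (FP := augFil K P5)
    (FW := filVV K) (Kell K) (map_Kpr12 K) (Kell_mem K) d

/-- The element `x_i5 - 1` of `ker (K pr_5)`. -/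
def u (i : Fin 3) : KerMod (Kpr5 K) :=
  KerMod.mk (MonoidAlgebra.of K P5 (x5 i) - 1) (by
    rw [map_sub, map_one, Kpr5_of, pr5_x5, map_one, sub_self])

/-- The element `(x_i5 - 1) ⊗ 1` of `M^B`. -/
def m (i : Fin 3) : KerTensor (Kpr5 K) (Kpr12 K) := KerTensor.tmul _ _ (u K i) 1

theorem m_mem (d : ℤ) (i : Fin 3) : m K i ∈ (bimodule K d).FM (1 - d) := by
  refine ⟨u K i, ?_, rfl⟩
  have := of_sub_one_mem_augFil K (x5 i)
  rw [SetLike.mem_coe, Submodule.mem_comap, sub_add_cancel]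
  exact this

/-- The element `X_i - 1` of `V^B`. -/
def e (i : Fin 2) : V K := MonoidAlgebra.of K F2 (X i) - 1

theorem e_mem (i : Fin 2) : e K i ∈ augFil K F2 1 := of_sub_one_mem_augFil K _

theorem e_tmul_mem (i : Fin 2) : e K i ⊗ₜ[K] (1 : V K) ∈ filVV K 1 :=
  mem_convolve' (β := TensorProduct.mk K (V K) (V K)) (add_zero 1) (e_mem K i)
    IsAlgFiltration.one_mem

theorem tmul_e_mem (i : Fin 2) : (1 : V K) ⊗ₜ[K] e K i ∈ filVV K 1 :=
  mem_convolve' (β := TensorProduct.mk K (V K) (V K)) (zero_add 1) IsAlgFiltration.one_mem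
    (e_mem K i)

/-- `κ (a_1, a_2, a_3) = ∑ i, (x_i5 - 1) ⊗ a_i`. -/
def kappa : (Fin 3 → VV K) →ₗ[(VV K)ᵐᵒᵖ] KerTensor (Kpr5 K) (Kpr12 K) :=
  KerTensor.kappa _ _ (u K)

/-- `X_1 ⊗ 1`, denoted `X_1`. -/
def X1 : VV K := MonoidAlgebra.of K F2 (X 1) ⊗ₜ 1

/-- `1 ⊗ X_1`, denoted `Y_1`. -/
def Y1 : VV K := 1 ⊗ₜ MonoidAlgebra.of K F2 (X 1)

/-- The inverse of `Y_1`. -/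
def Y1inv : VV K := 1 ⊗ₜ MonoidAlgebra.of K F2 (X 1)⁻¹

/-- The row `(1, -X_1, 0) Y_1`. -/
def row : Fin 3 → VV K := ![Y1 K, -X1 K * Y1 K, 0]

/-- The column `Y_1⁻¹ (X_1 - 1, 1 - Y_1, 0)`. -/
def col : Fin 3 → VV K := ![Y1inv K * (X1 K - 1), Y1inv K * (1 - Y1 K), 0]

/-- `(e, r, c)` is the factorization structure of `O^B_fil`: `e = X_1 - 1`, and `r` and `c`
correspond under `κ` to left multiplication by the row and by the column above. -/
def IsFactorization (S : FilFactorization (bimodule K 1)) : Prop :=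
  S.e = e K 1 ∧ S.r ∘ₗ kappa K = rowMap (row K) ∧ S.c = kappa K ∘ₗ colMap (col K)

end Bimodule

end Betti

/-! ### Infinitesimal braids -/

namespace DeRham

open Pair

attribute [local instance] LieRing.ofAssociativeRing

section Lie

variable (K : Type u) [CommRing K]

section General

variable {K} {L : Type u} [LieRing L] [LieAlgebra K L] {L' : Type u} [LieRing L'] [LieAlgebra K L']

/-- The projection onto the quotient by a Lie ideal. -/
def quotMk (I : LieIdeal K L) : L →ₗ⁅K⁆ L ⧸ I where
  toLinearMap := I.toSubmodule.mkQ
  map_lie' := rfl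

theorem quotMk_surjective (I : LieIdeal K L) : Function.Surjective (quotMk I) :=
  Submodule.mkQ_surjective _

theorem quotMk_eq_zero (I : LieIdeal K L) {a : L} (h : a ∈ I) : quotMk I a = 0 :=
  (Submodule.Quotient.mk_eq_zero _).2 h

/-- The morphism `L / I → L'` induced by a morphism `L → L'` vanishing on the Lie ideal `I`. -/
def quotLift (I : LieIdeal K L) (f : L →ₗ⁅K⁆ L') (h : I ≤ f.ker) : L ⧸ I →ₗ⁅K⁆ L' where
  toLinearMap := I.toSubmodule.liftQ f.toLinearMap fun a ha => f.mem_ker.1 (h ha)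
  map_lie' := by
    intro a b
    obtain ⟨a, rfl⟩ := quotMk_surjective I a
    obtain ⟨b, rfl⟩ := quotMk_surjective I b
    exact f.map_lie a b

theorem quotLift_mk (I : LieIdeal K L) (f : L →ₗ⁅K⁆ L') (h : I ≤ f.ker) (a : L) :
    quotLift I f h (quotMk I a) = f a := rfl

/-- The morphism `U(f)` of enveloping algebras induced by a morphism `f` of Lie algebras. -/
def Umap (f : L →ₗ⁅K⁆ L') : UniversalEnvelopingAlgebra K L →ₐ[K] UniversalEnvelopingAlgebra K L' :=
  UniversalEnvelopingAlgebra.lift K ((UniversalEnvelopingAlgebra.ι K).comp f)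

theorem Umap_ι (f : L →ₗ⁅K⁆ L') (a : L) :
    Umap f (UniversalEnvelopingAlgebra.ι K a) = UniversalEnvelopingAlgebra.ι K (f a) :=
  UniversalEnvelopingAlgebra.lift_ι_apply _ _ _

/-- The grading of `U(L)` for which the given generators of `L` have degree `1`. -/
def Ugrading {I : Type} (t : I → L) : ℤ → Submodule K (UniversalEnvelopingAlgebra K L) :=
  genGrading (Submodule.span K (Set.range fun i => UniversalEnvelopingAlgebra.ι K (t i)))

theorem ι_mem_Ugrading {I : Type} (t : I → L) (i : I) :
    UniversalEnvelopingAlgebra.ι K (t i) ∈ Ugrading (K := K) (L := L) t 1 := by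
  rw [Ugrading, genGrading_one]
  exact Submodule.subset_span ⟨i, rfl⟩

theorem Ugrading_isAlgGrading {I : Type} (t : I → L)
    (hgen : ∀ H : LieSubalgebra K L, (∀ i, t i ∈ H) → ∀ a, a ∈ H)
    (δ : L →ₗ⁅K⁆ AddMonoidAlgebra (UniversalEnvelopingAlgebra K L) ℤ)
    (hδ : ∀ i, δ (t i) = AddMonoidAlgebra.single 1 (UniversalEnvelopingAlgebra.ι K (t i))) :
    IsAlgGrading (Ugrading (K := K) (L := L) t) := by
  refine genGrading_isAlgGrading ?_ (UniversalEnvelopingAlgebra.lift K δ) fun w hw => ?_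
  · set S := Algebra.adjoin K
      (Submodule.span K (Set.range fun i => UniversalEnvelopingAlgebra.ι K (t i)) :
        Set (UniversalEnvelopingAlgebra K L)) with hS
    have h1 : ∀ a : L, UniversalEnvelopingAlgebra.ι K a ∈ S :=
      hgen ((lieSubalgebraOfSubalgebra K _ S).comap (UniversalEnvelopingAlgebra.ι K)) fun i =>
        Algebra.subset_adjoin (Submodule.subset_span ⟨i, rfl⟩)
    let g : UniversalEnvelopingAlgebra K L →ₐ[K] S := UniversalEnvelopingAlgebra.lift K
      { toFun := fun a => ⟨UniversalEnvelopingAlgebra.ι K a, h1 a⟩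
        map_add' := fun a b => Subtype.ext (map_add (UniversalEnvelopingAlgebra.ι K) a b)
        map_smul' := fun k a => Subtype.ext (map_smul (UniversalEnvelopingAlgebra.ι K) k a)
        map_lie' := fun {a b} =>
          Subtype.ext (LieHom.map_lie (UniversalEnvelopingAlgebra.ι K) a b) }
    have h2 : S.val.comp g = AlgHom.id K _ := by
      apply UniversalEnvelopingAlgebra.hom_ext
      ext a
      change ((g (UniversalEnvelopingAlgebra.ι K a) : S) : UniversalEnvelopingAlgebra K L) = _
      rw [UniversalEnvelopingAlgebra.lift_ι_apply]
      rfl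
    rw [eq_top_iff]
    intro a _
    have := AlgHom.congr_fun h2 a
    rw [AlgHom.id_apply] at this
    rw [← this]
    exact (g a).2
  · induction hw using Submodule.span_induction with
    | zero => rw [map_zero, AddMonoidAlgebra.single_zero]
    | add a b _ _ h h' => rw [map_add, h, h', AddMonoidAlgebra.single_add]
    | smul k a _ h => rw [map_smul, h, AddMonoidAlgebra.smul_single]
    | mem w hw =>
      obtain ⟨i, rfl⟩ := hw
      rw [UniversalEnvelopingAlgebra.lift_ι_apply, hδ]

theorem Umap_mem {I I' : Type} (t : I → L) (t' : I' → L') (f : L →ₗ⁅K⁆ L')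
    (h : ∀ i, f (t i) ∈ Submodule.span K (Set.range t')) (n : ℤ)
    (a : UniversalEnvelopingAlgebra K L) (ha : a ∈ Ugrading t n) : Umap f a ∈ Ugrading t' n := by
  refine map_genGrading_le (genGrading_one_mem _) (genGrading_mul_mem _) (Umap f)
    (fun w hw => ?_) n a ha
  rw [genGrading_one]
  have key : Submodule.span K (Set.range fun i => UniversalEnvelopingAlgebra.ι K (t i)) ≤
      (Submodule.span K (Set.range fun i => UniversalEnvelopingAlgebra.ι K (t' i))).comap
        (Umap f).toLinearMap := by
    refine Submodule.span_le.2 ?_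
    rintro _ ⟨i, rfl⟩
    rw [SetLike.mem_coe, Submodule.mem_comap, AlgHom.toLinearMap_apply, Umap_ι]
    have : Submodule.span K (Set.range t') ≤
        (Submodule.span K (Set.range fun i => UniversalEnvelopingAlgebra.ι K (t' i))).comap
          (UniversalEnvelopingAlgebra.ι K : L' →ₗ⁅K⁆ _).toLinearMap := by
      refine Submodule.span_le.2 ?_
      rintro _ ⟨j, rfl⟩
      exact Submodule.subset_span ⟨j, rfl⟩
    exact this (h i)
  exact key hw

end General

/-- The free Lie algebra `f_2` on `e_0`, `e_1`. -/
abbrev f2 : Type u := FreeLieAlgebra K (Fin 2)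

/-- The generators `e_0`, `e_1` of `f_2`. -/
def e (i : Fin 2) : f2 K := FreeLieAlgebra.of K i

/-- `e_∞ = - e_0 - e_1`. -/
def einf : f2 K := -e K 0 - e K 1

/-- The relations `[a, b + c] = [b, a + c] = [c, a + b] = 0`. -/
def tripleRels {L : Type u} [LieRing L] (a b c : L) : Set L :=
  {⁅a, b + c⁆, ⁅b, a + c⁆, ⁅c, a + b⁆}

/-- The generators `t_ij`, in the free Lie algebra on them. -/
def s (a : Pair) : FreeLieAlgebra K Pair := FreeLieAlgebra.of K a

/-- The infinitesimal braid relations on four strands. -/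
def relst4 : Set (FreeLieAlgebra K Pair) :=
  tripleRels (s K p12) (s K p13) (s K p23) ∪ tripleRels (s K p12) (s K p14) (s K p24) ∪
  tripleRels (s K p13) (s K p14) (s K p34) ∪ tripleRels (s K p23) (s K p24) (s K p34) ∪
  {⁅s K p12, s K p34⁆, ⁅s K p13, s K p24⁆, ⁅s K p14, s K p23⁆}

/-- The infinitesimal braid Lie algebra `t_4` on four strands. -/
abbrev t4 : Type u :=
  FreeLieAlgebra K Pair ⧸ LieSubmodule.lieSpan K (FreeLieAlgebra K Pair) (relst4 K)

/-- The projection from the free Lie algebra on the `t_ij` to `t_4`. -/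
def t4mk : FreeLieAlgebra K Pair →ₗ⁅K⁆ t4 K := quotMk _

/-- The central element `z_4`, the sum of all `t_ij`. -/
def z4 : t4 K :=
  t4mk K (s K p12 + s K p13 + s K p23 + s K p14 + s K p24 + s K p34)

/-- `p_5 = t_4 / (z_4)`. -/
abbrev p5 : Type u := t4 K ⧸ LieSubmodule.lieSpan K (t4 K) {z4 K}

/-- The projection from the free Lie algebra on the `t_ij` to `p_5`. -/
def p5mk : FreeLieAlgebra K Pair →ₗ⁅K⁆ p5 K := (quotMk _).comp (t4mk K)

/-- The class of `t_ij` in `p_5`. -/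
def t (a : Pair) : p5 K := p5mk K (s K a)

variable {K}

/-- The Lie algebra morphism `p_5 → L` sending the generators `t_ij` to given elements. -/
def p5lift {L : Type u} [LieRing L] [LieAlgebra K L] (f : Pair → L)
    (h : ∀ r ∈ relst4 K, FreeLieAlgebra.lift K f r = 0)
    (hz : f p12 + f p13 + f p23 + f p14 + f p24 + f p34 = 0) : p5 K →ₗ⁅K⁆ L :=
  quotLift _
    (quotLift _ (FreeLieAlgebra.lift K f) (LieSubmodule.lieSpan_le.2 fun r hr => by
      rw [SetLike.mem_coe, LieHom.mem_ker]
      exact h r hr))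
    (LieSubmodule.lieSpan_le.2 (by
      rintro _ rfl
      rw [SetLike.mem_coe, LieHom.mem_ker, z4, t4mk, quotLift_mk]
      simp only [map_add, s, FreeLieAlgebra.lift_of_apply]
      exact hz))

theorem p5lift_t {L : Type u} [LieRing L] [LieAlgebra K L] (f : Pair → L)
    (h : ∀ r ∈ relst4 K, FreeLieAlgebra.lift K f r = 0)
    (hz : f p12 + f p13 + f p23 + f p14 + f p24 + f p34 = 0) (a : Pair) :
    p5lift f h hz (t K a) = f a :=
  FreeLieAlgebra.lift_of_apply f a

theorem p5mk_surjective : Function.Surjective (p5mk K) :=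
  (quotMk_surjective _).comp (quotMk_surjective _)

theorem p5mk_eq_zero {r : FreeLieAlgebra K Pair} (hr : r ∈ relst4 K) : p5mk K r = 0 := by
  have : t4mk K r = 0 := quotMk_eq_zero _ (LieSubmodule.subset_lieSpan hr)
  rw [p5mk, LieHom.comp_apply, this, map_zero]

theorem sum_t : t K p12 + t K p13 + t K p23 + t K p14 + t K p24 + t K p34 = 0 := by
  have : p5mk K (s K p12 + s K p13 + s K p23 + s K p14 + s K p24 + s K p34) = 0 :=
    quotMk_eq_zero _ (LieSubmodule.subset_lieSpan rfl)
  simp only [map_add] at this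
  exact this

theorem mem_of_gen {L : Type u} [LieRing L] [LieAlgebra K L] {J : Type}
    (f : FreeLieAlgebra K J →ₗ⁅K⁆ L) (hf : Function.Surjective f) (H : LieSubalgebra K L)
    (h : ∀ j, f (FreeLieAlgebra.of K j) ∈ H) (a : L) : a ∈ H := by
  have : H.incl.comp (FreeLieAlgebra.lift K fun j => (⟨_, h j⟩ : H)) = f := by
    apply FreeLieAlgebra.hom_ext
    intro j
    rw [LieHom.comp_apply, FreeLieAlgebra.lift_of_apply]
    rfl
  obtain ⟨b, rfl⟩ := hf a
  rw [← this]
  exact Subtype.property _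

theorem p5_gen (H : LieSubalgebra K (p5 K)) (h : ∀ i, t K i ∈ H) (a : p5 K) : a ∈ H :=
  mem_of_gen (p5mk K) p5mk_surjective H h a

theorem f2_gen (H : LieSubalgebra K (f2 K)) (h : ∀ i, e K i ∈ H) (a : f2 K) : a ∈ H :=
  mem_of_gen (LieHom.id : f2 K →ₗ⁅K⁆ f2 K) Function.surjective_id H h a

variable (K)

/-- The images of the `t_ij` under `pr_1`. -/
def pr1Fun : Pair → f2 K
  | p12 => 0
  | p13 => 0
  | p14 => 0
  | p23 => e K 0
  | p24 => einf K
  | p34 => e K 1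

/-- The images of the `t_ij` under `pr_2`. -/
def pr2Fun : Pair → f2 K
  | p12 => 0
  | p13 => einf K
  | p14 => e K 0
  | p23 => 0
  | p24 => 0
  | p34 => e K 1

/-- The images of the `t_ij` under `pr_5`. -/
def pr5Fun : Pair → f2 K
  | p12 => e K 1
  | p13 => einf K
  | p14 => e K 0
  | p23 => e K 0
  | p24 => einf K
  | p34 => e K 1

theorem e_one_zero : ⁅e K 1, e K 0⁆ = -⁅e K 0, e K 1⁆ := (lie_skew _ _).symm

/-- `pr_1 : p_5 → f_2`. -/
def pr1 : p5 K →ₗ⁅K⁆ f2 K :=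
  p5lift (pr1Fun K)
    (by
      rintro r ((((hr | hr) | hr) | hr) | hr) <;>
        rcases hr with rfl | rfl | rfl <;>
        simp only [s, pr1Fun, einf, LieHom.map_lie, map_add, FreeLieAlgebra.lift_of_apply] <;>
        (simp; try (rw [e_one_zero]; abel)))
    (by simp only [pr1Fun, einf]; abel)

/-- `pr_2 : p_5 → f_2`. -/
def pr2 : p5 K →ₗ⁅K⁆ f2 K :=
  p5lift (pr2Fun K)
    (by
      rintro r ((((hr | hr) | hr) | hr) | hr) <;>
        rcases hr with rfl | rfl | rfl <;>
        simp only [s, pr2Fun, einf, LieHom.map_lie, map_add, FreeLieAlgebra.lift_of_apply] <;>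
        (simp; try (rw [e_one_zero]; abel)))
    (by simp only [pr2Fun, einf]; abel)

/-- `pr_5 : p_5 → f_2`. -/
def pr5 : p5 K →ₗ⁅K⁆ f2 K :=
  p5lift (pr5Fun K)
    (by
      rintro r ((((hr | hr) | hr) | hr) | hr) <;>
        rcases hr with rfl | rfl | rfl <;>
        simp only [s, pr5Fun, einf, LieHom.map_lie, map_add, FreeLieAlgebra.lift_of_apply] <;>
        (simp; try (rw [e_one_zero]; abel)))
    (by simp only [pr5Fun, einf]; abel)

/-- The section `ℓ : f_2 → p_5` of `pr_5`: `e_0 ↦ t_23`, `e_1 ↦ t_12`. -/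
def ell : f2 K →ₗ⁅K⁆ p5 K := FreeLieAlgebra.lift K ![t K p23, t K p12]

/-- `t_15`, `t_25`, `t_35`. -/
def t5 : Fin 3 → p5 K :=
  ![-t K p12 - t K p13 - t K p14, -t K p12 - t K p23 - t K p24, -t K p13 - t K p23 - t K p34]

theorem pr1_t (a : Pair) : pr1 K (t K a) = pr1Fun K a := p5lift_t _ _ _ a
theorem pr2_t (a : Pair) : pr2 K (t K a) = pr2Fun K a := p5lift_t _ _ _ a
theorem pr5_t (a : Pair) : pr5 K (t K a) = pr5Fun K a := p5lift_t _ _ _ a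

theorem pr5_t5 (i : Fin 3) : pr5 K (t5 K i) = 0 := by
  fin_cases i <;> (simp [t5, pr5_t, pr5Fun, einf]; try abel)

theorem ell_e (i : Fin 2) : ell K (e K i) = ![t K p23, t K p12] i :=
  FreeLieAlgebra.lift_of_apply _ _

/-! ### The de Rham bimodule -/

/-- `V^DR = U(f_2)`. -/
abbrev V : Type u := UniversalEnvelopingAlgebra K (f2 K)

/-- `V^DR ⊗ V^DR`. -/
abbrev VV : Type u := V K ⊗[K] V K

/-- `U(p_5)`. -/
abbrev Up5 : Type u := UniversalEnvelopingAlgebra K (p5 K)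

/-- The generator `e_i` of `V^DR`. -/
def ee (i : Fin 2) : V K := UniversalEnvelopingAlgebra.ι K (e K i)

/-- `U(pr_5) : U(p_5) → V^DR`. -/
def Upr5 : Up5 K →ₐ[K] V K := Umap (pr5 K)

/-- `U(ℓ) : V^DR → U(p_5)`. -/
def Uell : V K →ₐ[K] Up5 K := Umap (ell K)

/-- `U(pr_12) : U(p_5) → V^DR ⊗ V^DR`, sending `a ∈ p_5` to `pr_1 a ⊗ 1 + 1 ⊗ pr_2 a`. -/
def Upr12 : Up5 K →ₐ[K] VV K :=
  UniversalEnvelopingAlgebra.lift K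
    { toFun := fun a => UniversalEnvelopingAlgebra.ι K (pr1 K a) ⊗ₜ 1 +
        1 ⊗ₜ UniversalEnvelopingAlgebra.ι K (pr2 K a)
      map_add' := fun a b => by
        simp only [map_add, TensorProduct.add_tmul, TensorProduct.tmul_add]
        abel
      map_smul' := fun k a => by
        simp only [map_smul, TensorProduct.smul_tmul', TensorProduct.tmul_smul, smul_add,
          RingHom.id_apply]
      map_lie' := fun {a b} => by
        simp only [LieHom.map_lie, LieRing.of_associative_ring_bracket, mul_add, add_mul,
          Algebra.TensorProduct.tmul_mul_tmul, TensorProduct.sub_tmul, TensorProduct.tmul_sub,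
          mul_one, one_mul]
        abel }

theorem Upr12_ι (a : p5 K) : Upr12 K (UniversalEnvelopingAlgebra.ι K a) =
    UniversalEnvelopingAlgebra.ι K (pr1 K a) ⊗ₜ 1 +
      1 ⊗ₜ UniversalEnvelopingAlgebra.ι K (pr2 K a) :=
  UniversalEnvelopingAlgebra.lift_ι_apply _ _ _

/-- The grading of `V^DR`, with `e_0`, `e_1` of degree `1`. -/
def gradV : ℤ → Submodule K (V K) := Ugrading (e K)

/-- The grading of `U(p_5)`, with the `t_ij` of degree `1`. -/
def gradP : ℤ → Submodule K (Up5 K) := Ugrading (t K)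

/-- The grading of `V^DR ⊗ V^DR`. -/
def gradVV : ℤ → Submodule K (VV K) := tensorFil (gradV K)

theorem gradV_isAlgGrading : IsAlgGrading (gradV K) :=
  Ugrading_isAlgGrading _ f2_gen (FreeLieAlgebra.lift K fun i => AddMonoidAlgebra.single 1 (ee K i))
    fun i => FreeLieAlgebra.lift_of_apply _ i

theorem gradVV_isAlgGrading : IsAlgGrading (gradVV K) :=
  haveI := gradV_isAlgGrading K
  tensorFil_isAlgGrading _

/-- The elements of `p_5`, placed in degree `1`. -/
def single1 : p5 K →ₗ[K] AddMonoidAlgebra (Up5 K) ℤ where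
  toFun a := AddMonoidAlgebra.single 1 (UniversalEnvelopingAlgebra.ι K a)
  map_add' a b := by rw [map_add, AddMonoidAlgebra.single_add]
  map_smul' k a := by rw [map_smul, AddMonoidAlgebra.smul_single, RingHom.id_apply]

variable {K} in
theorem single1_lie {a b : p5 K} (h : ⁅a, b⁆ = 0) : ⁅single1 K a, single1 K b⁆ = 0 := by
  have h' : ⁅UniversalEnvelopingAlgebra.ι K a, UniversalEnvelopingAlgebra.ι K b⁆ = 0 := by
    rw [← LieHom.map_lie, h, map_zero]
  rw [LieRing.of_associative_ring_bracket] at h' ⊢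
  rw [single1, LinearMap.coe_mk, AddHom.coe_mk, AddMonoidAlgebra.single_mul_single,
    AddMonoidAlgebra.single_mul_single, ← AddMonoidAlgebra.single_sub, h',
    AddMonoidAlgebra.single_zero]

/-- The images of the `t_ij` placed in degree `1`. -/
def degFun (a : Pair) : AddMonoidAlgebra (Up5 K) ℤ := single1 K (t K a)

theorem degFun_s (a : Pair) : FreeLieAlgebra.lift K (degFun K) (s K a) = single1 K (p5mk K (s K a)) :=
  FreeLieAlgebra.lift_of_apply _ _

theorem degFun_add (a b : Pair) : FreeLieAlgebra.lift K (degFun K) (s K a + s K b) =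
    single1 K (p5mk K (s K a + s K b)) := by
  rw [map_add (FreeLieAlgebra.lift K (degFun K)), map_add (p5mk K), LinearMap.map_add, degFun_s,
    degFun_s]

variable {K} in
theorem degFun_lie {a b : FreeLieAlgebra K Pair}
    (ha : FreeLieAlgebra.lift K (degFun K) a = single1 K (p5mk K a))
    (hb : FreeLieAlgebra.lift K (degFun K) b = single1 K (p5mk K b)) (h : ⁅a, b⁆ ∈ relst4 K) :
    FreeLieAlgebra.lift K (degFun K) ⁅a, b⁆ = 0 := by
  rw [LieHom.map_lie, ha, hb]
  refine single1_lie ?_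
  rw [← LieHom.map_lie]
  exact p5mk_eq_zero h

theorem degFun_triple (a b c : Pair) (hs : tripleRels (s K a) (s K b) (s K c) ⊆ relst4 K)
    (r : FreeLieAlgebra K Pair) (hr : r ∈ tripleRels (s K a) (s K b) (s K c)) :
    FreeLieAlgebra.lift K (degFun K) r = 0 := by
  have hr' := hs hr
  rcases hr with rfl | rfl | rfl
  · exact degFun_lie (degFun_s K a) (degFun_add K b c) hr'
  · exact degFun_lie (degFun_s K b) (degFun_add K a c) hr'
  · exact degFun_lie (degFun_s K c) (degFun_add K a b) hr'

theorem degFun_rel (r : FreeLieAlgebra K Pair) (hr : r ∈ relst4 K) :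
    FreeLieAlgebra.lift K (degFun K) r = 0 := by
  have hr' := hr
  rcases hr' with (((h | h) | h) | h) | h
  · exact degFun_triple K _ _ _ (fun _ h => Or.inl (Or.inl (Or.inl (Or.inl h)))) r h
  · exact degFun_triple K _ _ _ (fun _ h => Or.inl (Or.inl (Or.inl (Or.inr h)))) r h
  · exact degFun_triple K _ _ _ (fun _ h => Or.inl (Or.inl (Or.inr h))) r h
  · exact degFun_triple K _ _ _ (fun _ h => Or.inl (Or.inr h)) r h
  · rcases h with rfl | rfl | rfl
    · exact degFun_lie (degFun_s K p12) (degFun_s K p34) hr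
    · exact degFun_lie (degFun_s K p13) (degFun_s K p24) hr
    · exact degFun_lie (degFun_s K p14) (degFun_s K p23) hr

/-- The morphism placing the generators `t_ij` in degree `1`. -/
def degP : p5 K →ₗ⁅K⁆ AddMonoidAlgebra (Up5 K) ℤ :=
  p5lift (degFun K) (degFun_rel K)
    (by simp only [degFun, ← LinearMap.map_add, sum_t, LinearMap.map_zero])

theorem gradP_isAlgGrading : IsAlgGrading (gradP K) :=
  Ugrading_isAlgGrading _ p5_gen (degP K) fun i => p5lift_t _ _ _ i

theorem einf_mem : einf K ∈ Submodule.span K (Set.range (e K)) :=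
  sub_mem (neg_mem (Submodule.subset_span ⟨0, rfl⟩)) (Submodule.subset_span ⟨1, rfl⟩)

theorem pr5_mem (a : Pair) : pr5 K (t K a) ∈ Submodule.span K (Set.range (e K)) := by
  rw [pr5_t]
  cases a
  exacts [Submodule.subset_span ⟨1, rfl⟩, einf_mem K, Submodule.subset_span ⟨0, rfl⟩,
    Submodule.subset_span ⟨0, rfl⟩, einf_mem K, Submodule.subset_span ⟨1, rfl⟩]

theorem pr1_mem (a : Pair) : pr1 K (t K a) ∈ Submodule.span K (Set.range (e K)) := by
  rw [pr1_t]
  cases a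
  exacts [zero_mem _, zero_mem _, zero_mem _,
    Submodule.subset_span ⟨0, rfl⟩, einf_mem K, Submodule.subset_span ⟨1, rfl⟩]

theorem pr2_mem (a : Pair) : pr2 K (t K a) ∈ Submodule.span K (Set.range (e K)) := by
  rw [pr2_t]
  cases a
  exacts [zero_mem _, einf_mem K, Submodule.subset_span ⟨0, rfl⟩, zero_mem _, zero_mem _,
    Submodule.subset_span ⟨1, rfl⟩]

theorem Upr5_mem (n : ℤ) (a : Up5 K) (ha : a ∈ gradP K n) : Upr5 K a ∈ gradV K n :=
  Umap_mem _ _ _ (pr5_mem K) n a ha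

theorem Uell_mem (n : ℤ) (a : V K) (ha : a ∈ gradV K n) : Uell K a ∈ gradP K n :=
  Umap_mem _ _ _ (fun i => by
    rw [ell_e]
    fin_cases i
    exacts [Submodule.subset_span ⟨p23, rfl⟩, Submodule.subset_span ⟨p12, rfl⟩]) n a ha

theorem ι_mem_gradV (a : f2 K) (ha : a ∈ Submodule.span K (Set.range (e K))) :
    UniversalEnvelopingAlgebra.ι K a ∈ gradV K 1 := by
  have : Submodule.span K (Set.range (e K)) ≤ (gradV K 1).comap
      (UniversalEnvelopingAlgebra.ι K : f2 K →ₗ⁅K⁆ V K).toLinearMap := by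
    refine Submodule.span_le.2 ?_
    rintro _ ⟨j, rfl⟩
    exact ι_mem_Ugrading _ j
  exact this ha

theorem Upr12_mem (n : ℤ) (a : Up5 K) (ha : a ∈ gradP K n) : Upr12 K a ∈ gradVV K n := by
  have hV := gradV_isAlgGrading K
  have hVV := gradVV_isAlgGrading K
  refine map_genGrading_le hVV.one_mem hVV.mul_mem (Upr12 K) (fun w hw => ?_) n a ha
  have key : Submodule.span K (Set.range fun a => UniversalEnvelopingAlgebra.ι K (t K a)) ≤
      (gradVV K 1).comap (Upr12 K).toLinearMap := by
    refine Submodule.span_le.2 ?_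
    rintro _ ⟨a, rfl⟩
    rw [SetLike.mem_coe, Submodule.mem_comap, AlgHom.toLinearMap_apply, Upr12_ι]
    exact add_mem
      (mem_convolve' (β := TensorProduct.mk K (V K) (V K)) (add_zero 1)
        (ι_mem_gradV K _ (pr1_mem K a)) hV.one_mem)
      (mem_convolve' (β := TensorProduct.mk K (V K) (V K)) (zero_add 1)
        hV.one_mem (ι_mem_gradV K _ (pr2_mem K a)))
  exact key hw

/-- The graded bimodule `(V^DR, M^DR, V^DR ⊗ V^DR)` with
`M^DR = ker (U(pr_5)) ⊗_{U(p_5)} (V^DR ⊗ V^DR)`, where `M^DR_n` is the space of elements which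
are homogeneous of degree `n + d` for the tensor product grading. -/
def bimodule (d : ℤ) : GrBimodule K :=
  KerTensor.grBimodule (Upr5 K) (Upr12 K) (gradV_isAlgGrading K) (gradP_isAlgGrading K)
    (gradV_isAlgGrading K) (gradVV_isAlgGrading K) (Upr5_mem K) (Upr12_mem K) (Uell K)
    (Uell_mem K) d

/-- The element `t_i5` of `ker (U(pr_5))`. -/
def u (i : Fin 3) : KerMod (Upr5 K) :=
  KerMod.mk (UniversalEnvelopingAlgebra.ι K (t5 K i)) (by
    rw [Upr5, Umap_ι, pr5_t5, map_zero])

/-- The element `t_i5 ⊗ 1` of `M^DR`. -/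
def m (i : Fin 3) : KerTensor (Upr5 K) (Upr12 K) := KerTensor.tmul _ _ (u K i) 1

/-- `κ (a_1, a_2, a_3) = ∑ i, t_i5 ⊗ a_i`. -/
def kappa : (Fin 3 → VV K) →ₗ[(VV K)ᵐᵒᵖ] KerTensor (Upr5 K) (Upr12 K) :=
  KerTensor.kappa _ _ (u K)

/-- The row `(1, -1, 0)`. -/
def row : Fin 3 → VV K := ![1, -1, 0]

/-- The column `(e_1 ⊗ 1, -1 ⊗ e_1, 0)`. -/
def col : Fin 3 → VV K := ![ee K 1 ⊗ₜ 1, -(1 ⊗ₜ ee K 1), 0]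

/-- `(e, r, c)` is the factorization structure of `O^DR`: `e = e_1`, and `r` and `c` correspond
under `κ` to left multiplication by the row and by the column above. -/
def IsFactorization (S : GrFactorization (bimodule K 1)) : Prop :=
  S.e = ee K 1 ∧ S.r ∘ₗ kappa K = rowMap (row K) ∧ S.c = kappa K ∘ₗ colMap (col K)

end Lie

end DeRham

/-! ### The canonical morphism and the objects `O^B_fil` and `O^DR` -/

section Main

variable (K : Type u) [CommRing K]

/-- The triple `(g, φ, f)` of a morphism from the de Rham bimodule to the graded bimodule of the
Betti bimodule is the canonical one: `g` sends `e_i` to `[X_i - 1]_1`, `f` sends `e_i ⊗ 1` to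
`[(X_i - 1) ⊗ 1]_1` and `1 ⊗ e_i` to `[1 ⊗ (X_i - 1)]_1`, and `φ` sends `t_i5 ⊗ 1` to the class
of `(x_i5 - 1) ⊗ 1`. -/
structure IsCanonical {d : ℤ} (Φ : DeRham.bimodule K d ⟶ (Betti.bimodule K d).gr) : Prop where
  g_e : ∀ i : Fin 2, Φ.g (DeRham.ee K i) =
    (Betti.bimodule K d).clsB 1 (Betti.e K i) (Betti.e_mem K i)
  f_e_tmul : ∀ i : Fin 2, Φ.f (DeRham.ee K i ⊗ₜ[K] (1 : DeRham.V K)) =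
    (Betti.bimodule K d).clsA 1 (Betti.e K i ⊗ₜ[K] (1 : Betti.V K)) (Betti.e_tmul_mem K i)
  f_tmul_e : ∀ i : Fin 2, Φ.f ((1 : DeRham.V K) ⊗ₜ[K] DeRham.ee K i) =
    (Betti.bimodule K d).clsA 1 ((1 : Betti.V K) ⊗ₜ[K] Betti.e K i) (Betti.tmul_e_mem K i)
  φ_t : ∀ i : Fin 3, Φ.φ (DeRham.m K i) =
    (Betti.bimodule K d).clsM (1 - d) (Betti.m K i) (Betti.m_mem K d i)

end Main

end

end BFSTheory

/-!
The group `P_5^*` is the semidirect product of the free group `F_3` on `x_15`, `x_25`, `x_35`, which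
is the kernel of `pr_5`, by `F_2`, embedded through `ℓ` (`Betti.TwistRel.lift`,
`Betti.fromF3_mul_ell`). The right ideal `ker (K pr_5)` of `K P_5^*` is therefore free on the
`x_i5 - 1`, the coordinates being the Fox derivatives, and after base change along `K pr_12` this
says that `κ_B` is bijective (`Betti.kappa_bijective`). Conjugation by `ℓ(F_2)` replaces each `x_i5`
by a conjugate inside `F_3`, so that `F_2` acts trivially on the abelianization of `F_3`, and the
powers of the augmentation ideal of `K P_5^*` form the product filtration
(`Betti.sub_Kell_mem_rightFil`): through `κ_B`, the filtration of `M^B` is the one of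
`(V^B ⊗ V^B)^3`, shifted by one (`Betti.coord_mem`, `Betti.kappa_mem`).

The factorization comes from the relations `x_12 x_15 x_25 = x_34`, where `x_34` commutes with
`x_15` and `x_25`, and `(x_12, x_35) = 1`. They show that left multiplication by `x_12 - 1` maps the
right module spanned by the `x_i5 - 1` to itself, with a matrix which `K pr_12` sends to the product
of the column and the row of the theorem (`Betti.sub_one_mul_uP`, `Betti.Kpr12_leftCoeff`). The same
computation with `t_12 + t_15 + t_25 = t_34` gives the de Rham factorization (`DeRham.tU_12_mul_uU`,
`DeRham.Upr12_leftCoeff`). Uniqueness is clear since `r ∘ κ` is prescribed and `κ` is bijective.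

For the comparison, commutation relations in a group `G` become commutation relations between the
classes `[g - 1]_1` in `gr (K G)`, and these classes generate `gr (K G)`. This gives surjective
morphisms `U(p_5) → gr (K P_5^*)` (`DeRham.Theta`), `V^DR → gr V^B` (`DeRham.gV`) and
`V^DR ⊗ V^DR → gr (V^B ⊗ V^B)` (`DeRham.fW`), compatible with `pr_5`, `pr_12` and `ℓ`. The last two
are injective, the leading term of the Magnus expansion `X_i ↦ 1 + e_i X` being a left inverse
(`DeRham.lead_gV`, `DeRham.lead₂_fW`).

The injectivity of `DeRham.Theta` is not needed. The derivation `a ↦ (a - ℓ (pr_5 a)) ⊗ 1` from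
`K P_5^*` to `M^B` is filtered, and composing its associated graded map with `DeRham.Theta` and
restricting to `ker (U(pr_5))` gives a morphism `φ : M^DR → gr M^B` (`DeRham.phi`). The coordinates
of `φ ∘ κ_DR` in the basis `[(x_i5 - 1) ⊗ 1]` of `gr M^B` are given by the isomorphism `fW`
(`DeRham.grCoord_phi_kappa`). Hence `κ_DR` is injective; it is surjective because the `t_i5`
generate `ker (U(pr_5))` as a right ideal, so `κ_DR` and `φ` are both bijective. As `fW` maps the
row and the column on the de Rham side to the classes of those on the Betti side (`fW_row`,
`fW_col`), the isomorphism `(gV, φ, fW)` is compatible with the factorization structures. A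
canonical morphism is prescribed on generators, hence unique (`IsCanonical.hom_eq`).
-/

namespace BFSTheory

noncomputable section

namespace Betti

open Pair

open scoped commutatorElement

/-! ### The pure braid group modulo its center -/

section Group

/-- The projection of the free group on the `x_ij` onto `P_5^*`. -/
def projP5 : FreeGroup Pair →* P5 :=
  (QuotientGroup.mk' _).comp (PresentedGroup.mk relsK4)

theorem commute_of_rel {u v : FreeGroup Pair} (h : ⁅u, v⁆ ∈ relsK4) :
    Commute (projP5 u) (projP5 v) := by
  rw [← commutatorElement_eq_one_iff_commute, ← map_commutatorElement]
  have : PresentedGroup.mk relsK4 ⁅u, v⁆ = 1 :=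
    (PresentedGroup.mk_eq_one_iff).2 (Subgroup.subset_normalClosure h)
  rw [projP5, MonoidHom.comp_apply, this, map_one]

theorem commute_of_tripleRels {u v w : FreeGroup Pair} (h : tripleRels u v w ⊆ relsK4) :
    Commute (projP5 u * projP5 v * projP5 w) (projP5 u) ∧
    Commute (projP5 u * projP5 v * projP5 w) (projP5 v) ∧
    Commute (projP5 u * projP5 v * projP5 w) (projP5 w) := by
  rw [← map_mul, ← map_mul]
  exact ⟨commute_of_rel (h (Or.inl rfl)), commute_of_rel (h (Or.inr (Or.inl rfl))),
    commute_of_rel (h (Or.inr (Or.inr rfl)))⟩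

theorem triple_123 : tripleRels (y p12) (y p13) (y p23) ⊆ relsK4 :=
  fun _ h => Or.inl (Or.inl (Or.inl (Or.inl h)))

theorem triple_124 : tripleRels (y p12) (y p14) (y p24) ⊆ relsK4 :=
  fun _ h => Or.inl (Or.inl (Or.inl (Or.inr h)))

theorem triple_134 : tripleRels (y p13) (y p14) (y p34) ⊆ relsK4 :=
  fun _ h => Or.inl (Or.inl (Or.inr h))

theorem triple_234 : tripleRels (y p23) (y p24) (y p34) ⊆ relsK4 :=
  fun _ h => Or.inl (Or.inr h)

theorem commute_12_34 : Commute (x p12) (x p34) := commute_of_rel (Or.inr (Or.inl rfl))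

theorem commute_13_24 : Commute (x p13) ((x p12)⁻¹ * x p24 * x p12) :=
  commute_of_rel (u := y p13) (v := (y p12)⁻¹ * y p24 * y p12) (Or.inr (Or.inr (Or.inl rfl)))

theorem commute_14_23 : Commute (x p14) (x p23) := commute_of_rel (Or.inr (Or.inr (Or.inr rfl)))

theorem prod_x : x p12 * x p13 * x p23 * x p14 * x p24 * x p34 = 1 :=
  (QuotientGroup.eq_one_iff ω4).2 (Subgroup.subset_normalClosure rfl)

theorem commute_mul_of_triple {G : Type} [Group G] {a b c : G} (h : Commute (a * b * c) a) :
    Commute (b * c) a := by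
  have h' := ((Commute.refl a).inv_left).mul_left h
  rwa [mul_assoc, inv_mul_cancel_left] at h'

theorem commute_mul_of_triple' {G : Type} [Group G] {a b c : G} (h : Commute (a * b * c) c) :
    Commute (a * b) c := by
  have h' := h.mul_left ((Commute.refl c).inv_left)
  rwa [mul_inv_cancel_right] at h'

theorem commute_x12_x35 : Commute (x p12) (x5 2) := by
  have h1 := commute_mul_of_triple (commute_of_tripleRels triple_123).1
  exact (h1.symm.mul_right commute_12_34).inv_right

theorem commute_x23_x15 : Commute (x p23) (x5 0) := by
  have h1 := commute_mul_of_triple' (commute_of_tripleRels triple_123).2.2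
  exact (h1.symm.mul_right commute_14_23.symm).inv_right

theorem commute_x34_x15 : Commute (x p34) (x5 0) := by
  have h1 := commute_mul_of_triple' (commute_of_tripleRels triple_134).2.2
  have h2 := commute_12_34.symm.mul_right h1.symm
  rw [← mul_assoc] at h2
  exact h2.inv_right

theorem commute_x34_x25 : Commute (x p34) (x5 1) := by
  have h1 := commute_mul_of_triple' (commute_of_tripleRels triple_234).2.2
  have h2 := commute_12_34.symm.mul_right h1.symm
  rw [← mul_assoc] at h2
  exact h2.inv_right

/-- On the sphere, `x_12 x_15 x_25 = x_34`: the points `1, 2, 5` and the points `3, 4` are the two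
sides of a loop. -/
theorem x12_mul_x15_mul_x25 : x p12 * (x5 0 * x5 1) = x p34 := by
  have hω := prod_x
  have h1 := commute_mul_of_triple' (commute_of_tripleRels triple_123).2.2
  have h2 := commute_mul_of_triple (commute_of_tripleRels triple_124).1
  have h3 := commute_13_24
  have h4 := (commute_of_tripleRels triple_124).2.2
  have h6 := commute_12_34
  change Commute (x p12 * x p13) (x p23) at h1
  change Commute (x p14 * x p24) (x p12) at h2
  change Commute (x p12 * x p14 * x p24) (x p24) at h4
  change x p12 * ((x p12 * x p13 * x p14)⁻¹ * (x p12 * x p23 * x p24)⁻¹) = _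
  generalize x p12 = a at *
  generalize x p13 = b at *
  generalize x p23 = c at *
  generalize x p14 = d at *
  generalize x p24 = e at *
  generalize x p34 = f at *
  have h5 := commute_mul_of_triple' h4
  have key : c * e * a * b * d * f = 1 := by
    have e1 : e * a * b = a * b * (a⁻¹ * e * a) := by
      calc e * a * b = a * ((a⁻¹ * e * a) * b) := by group
        _ = a * (b * (a⁻¹ * e * a)) := by rw [h3.eq]
        _ = _ := by group
    have e2 : e * (a * d) = a * d * e := h5.eq.symm
    calc c * e * a * b * d * f = c * (e * a * b) * d * f := by group
      _ = (c * (a * b)) * a⁻¹ * (e * (a * d)) * f := by rw [e1]; group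
      _ = (a * b * c) * a⁻¹ * (a * d * e) * f := by rw [← h1.eq, e2]
      _ = a * b * c * d * e * f := by group
      _ = 1 := hω
  have h7 : f = (c * e * a * b * d)⁻¹ := (inv_eq_of_mul_eq_one_right key).symm
  have h8 : a * f * a⁻¹ = f := by rw [h6.eq, mul_inv_cancel_right]
  rw [← h8, h7]; group

theorem commute_x12_x15_mul_x25 : Commute (x p12) (x5 0 * x5 1) := by
  have h : x5 0 * x5 1 = (x p12)⁻¹ * x p34 := by rw [← x12_mul_x15_mul_x25]; group
  rw [h]
  exact (Commute.refl _).inv_right.mul_right commute_12_34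

theorem x25_mul_x35 : x5 1 * x5 2 =
    x p12 * x p13 * x p14 * (x p12 * x p13)⁻¹ * (x p23)⁻¹ := by
  have h0 : x5 1 = (x p12 * x p13 * x p14) * ((x p12)⁻¹ * x p34) := by
    rw [← x12_mul_x15_mul_x25]
    change x5 1 = (x p12 * x p13 * x p14) *
      ((x p12)⁻¹ * (x p12 * ((x p12 * x p13 * x p14)⁻¹ * x5 1)))
    group
  have h1 : Commute (x p12) (x p13 * x p23) :=
    (commute_mul_of_triple (commute_of_tripleRels triple_123).1).symm
  have h2 : Commute (x p12 * x p13) (x p23) :=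
    commute_mul_of_triple' (commute_of_tripleRels triple_123).2.2
  have h3 : (x p12)⁻¹ * (x p13 * x p23)⁻¹ = (x p12 * x p13)⁻¹ * (x p23)⁻¹ := by
    rw [← mul_inv_rev, ← mul_inv_rev, ← h1.eq, ← mul_assoc, h2.eq]
  rw [h0]
  change (x p12 * x p13 * x p14) * ((x p12)⁻¹ * x p34) * (x p13 * x p23 * x p34)⁻¹ = _
  rw [mul_assoc (x p12 * x p13 * x p14) (x p12 * x p13)⁻¹, ← h3]
  group

theorem commute_x23_x25_mul_x35 : Commute (x p23) (x5 1 * x5 2) := by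
  have h2 : Commute (x p23) (x p12 * x p13) :=
    (commute_mul_of_triple' (commute_of_tripleRels triple_123).2.2).symm
  rw [x25_mul_x35]
  exact (((h2.mul_right commute_14_23.symm).mul_right h2.inv_right).mul_right
    (Commute.refl _).inv_right)

/-- The conjugate of `x_14` which, on the sphere, equals `x_23 x_25 x_35`. -/
def x14' : P5 := x p12 * x p13 * x p14 * (x p12 * x p13)⁻¹

theorem x25_mul_x35_mul_x23 : x5 1 * x5 2 * x p23 = x14' := by
  rw [x25_mul_x35, inv_mul_cancel_right, x14']

theorem commute_conj_iff {G : Type} [Group G] {g a b : G} :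
    Commute (g * a * g⁻¹) b ↔ Commute a (g⁻¹ * b * g) := by
  have h := Commute.conj_iff (a := a) (b := g⁻¹ * b * g) g
  rw [← h]
  have : g * (g⁻¹ * b * g) * g⁻¹ = b := by group
  rw [this]

theorem commute_x14'_x35 : Commute x14' (x5 2) := by
  have h1 := commute_mul_of_triple (commute_of_tripleRels triple_123).1
  change Commute (x p13 * x p23) (x p12) at h1
  have h3 : Commute (x p14) (x p34 * x p13) := by
    have h := (commute_of_tripleRels triple_134).2.1
    have h' := commute_mul_of_triple' (commute_of_tripleRels triple_134).2.2
    change Commute (x p13 * x p14 * x p34) (x p14) at h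
    change Commute (x p13 * x p14) (x p34) at h'
    rw [h'.eq, ← mul_assoc] at h
    have h'' := h.mul_left ((Commute.refl (x p14)).inv_left)
    rw [mul_inv_cancel_right] at h''
    exact h''.symm
  rw [x14', commute_conj_iff]
  have : (x p12 * x p13)⁻¹ * x5 2 * (x p12 * x p13) = (x p23 * (x p34 * x p13))⁻¹ := by
    rw [← inv_inv (x5 2)]
    change (x p12 * x p13)⁻¹ * (((x p13 * x p23 * x p34)⁻¹)⁻¹)⁻¹ * (x p12 * x p13) = _
    rw [inv_inv]
    have e1 : (x p13 * x p23 * x p34)⁻¹ = x p12 * (x p13 * x p23 * x p34)⁻¹ * (x p12)⁻¹ := by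
      rw [((h1.mul_left commute_12_34.symm).symm.inv_right).eq, mul_inv_cancel_right]
    rw [e1]
    group
  rw [this]
  exact (commute_14_23.mul_right h3).inv_right

theorem commute_x14'_x25 : Commute x14' (x5 1) := by
  have h : Commute x14' (x5 1 * x5 2) := by
    rw [x25_mul_x35, ← x14']
    refine (Commute.refl _).mul_right (Commute.inv_right ?_)
    rw [← x25_mul_x35_mul_x23]
    exact (commute_x23_x25_mul_x35.symm.mul_left (Commute.refl _))
  have := h.mul_right commute_x14'_x35.inv_right
  rwa [mul_inv_cancel_right] at this

/-- If `z g` commutes with `n`, then conjugation by `g` acts on `n` as conjugation by `z⁻¹`. This is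
how the braid relations turn conjugation by `x_12` and `x_23` into conjugation by products of the
`x_i5`. -/
theorem conj_of_commute {G : Type} [Group G] {g z n : G} (h : Commute (z * g) n) :
    g * n * g⁻¹ = z⁻¹ * n * z := by
  calc g * n * g⁻¹ = z⁻¹ * (z * g * n) * g⁻¹ := by group
    _ = z⁻¹ * n * z := by rw [h.eq]; group

theorem conj_inv_of_commute {G : Type} [Group G] {g z n : G} (h : Commute (z * g) n)
    (hz : Commute g z) : g⁻¹ * n * g = z * n * z⁻¹ := by
  have : Commute (z⁻¹ * g⁻¹) n := by
    rw [← mul_inv_rev, hz.eq]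
    exact h.inv_left
  have := conj_of_commute this
  rwa [inv_inv, inv_inv] at this

/-- The product is `x_34`, a loop which does not meet the points `1`, `2` and `5`. -/
theorem commute_x15_mul_x25_mul_x12 (i : Fin 3) (hi : i ≠ 2) :
    Commute (x5 0 * x5 1 * x p12) (x5 i) := by
  rw [← commute_x12_x15_mul_x25.eq, x12_mul_x15_mul_x25]
  fin_cases i
  · exact commute_x34_x15
  · exact commute_x34_x25
  · exact absurd rfl hi

/-- The product is `x14'`, a conjugate of `x_14`, which commutes with `x_25` and `x_35`. -/
theorem commute_x25_mul_x35_mul_x23 (i : Fin 3) (hi : i ≠ 0) :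
    Commute (x5 1 * x5 2 * x p23) (x5 i) := by
  rw [x25_mul_x35_mul_x23]
  fin_cases i
  · exact absurd rfl hi
  · exact commute_x14'_x25
  · exact commute_x14'_x35

theorem x34_eq : x p34 = x p12 * x5 0 * x5 1 := by rw [mul_assoc, x12_mul_x15_mul_x25]

theorem x24_eq : x p24 = (x p23)⁻¹ * (x p12)⁻¹ * (x5 1)⁻¹ := by
  change x p24 = (x p23)⁻¹ * (x p12)⁻¹ * ((x p12 * x p23 * x p24)⁻¹)⁻¹
  group

theorem x13_eq : x p13 = (x5 2)⁻¹ * (x5 1)⁻¹ * (x5 0)⁻¹ * (x p12)⁻¹ * (x p23)⁻¹ := by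
  have h : (x5 1)⁻¹ * (x5 0)⁻¹ * (x p12)⁻¹ = (x p34)⁻¹ := by rw [x34_eq]; group
  rw [mul_assoc (x5 2)⁻¹, mul_assoc (x5 2)⁻¹, h]
  change x p13 = ((x p13 * x p23 * x p34)⁻¹)⁻¹ * (x p34)⁻¹ * (x p23)⁻¹
  group

theorem x14_eq : x p14 = (x p13)⁻¹ * (x p12)⁻¹ * (x5 0)⁻¹ := by
  change x p14 = (x p13)⁻¹ * (x p12)⁻¹ * ((x p12 * x p13 * x p14)⁻¹)⁻¹
  group

/-- The subgroup generated by `x_15`, `x_25`, `x_35`. -/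
def subgroupX5 : Subgroup P5 := Subgroup.closure (Set.range x5)

theorem x5_mem (i : Fin 3) : x5 i ∈ subgroupX5 := Subgroup.subset_closure ⟨i, rfl⟩

/-- Conjugation by the images of the generators of `F_2` and their inverses moves each `x_i5`
inside its conjugacy class in the group generated by `x_15`, `x_25`, `x_35`. -/
theorem conj_x5 (h : P5)
    (hh : h = x p12 ∨ h = (x p12)⁻¹ ∨ h = x p23 ∨ h = (x p23)⁻¹) (i : Fin 3) :
    ∃ z ∈ subgroupX5, h * x5 i * h⁻¹ = z⁻¹ * x5 i * z := by
  have hz : x5 0 * x5 1 ∈ subgroupX5 := mul_mem (x5_mem 0) (x5_mem 1)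
  have hz' : x5 1 * x5 2 ∈ subgroupX5 := mul_mem (x5_mem 1) (x5_mem 2)
  rcases hh with rfl | rfl | rfl | rfl
  · by_cases hi : i = 2
    · subst hi
      exact ⟨1, one_mem _, by rw [commute_x12_x35.eq]; group⟩
    · exact ⟨_, hz, conj_of_commute (commute_x15_mul_x25_mul_x12 i hi)⟩
  · by_cases hi : i = 2
    · subst hi
      exact ⟨1, one_mem _, by rw [commute_x12_x35.inv_left.eq]; group⟩
    · refine ⟨_, inv_mem hz, ?_⟩
      rw [inv_inv, inv_inv]
      exact conj_inv_of_commute (commute_x15_mul_x25_mul_x12 i hi) commute_x12_x15_mul_x25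
  · by_cases hi : i = 0
    · subst hi
      exact ⟨1, one_mem _, by rw [commute_x23_x15.eq]; group⟩
    · exact ⟨_, hz', conj_of_commute (commute_x25_mul_x35_mul_x23 i hi)⟩
  · by_cases hi : i = 0
    · subst hi
      exact ⟨1, one_mem _, by rw [commute_x23_x15.inv_left.eq]; group⟩
    · refine ⟨_, inv_mem hz', ?_⟩
      rw [inv_inv, inv_inv]
      exact conj_inv_of_commute (commute_x25_mul_x35_mul_x23 i hi) commute_x23_x25_mul_x35

theorem closure_x : Subgroup.closure (Set.range x) = ⊤ := by
  have h : Subgroup.closure (Set.range x) = projP5.range := by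
    have : Set.range x = projP5 '' Set.range y := by
      rw [← Set.range_comp]; rfl
    rw [this, ← MonoidHom.map_closure, MonoidHom.range_eq_map]
    congr 1
    exact FreeGroup.closure_range_of Pair
  rw [h, MonoidHom.range_eq_top]
  exact (QuotientGroup.mk'_surjective _).comp (PresentedGroup.mk_surjective relsK4)

/-- The group `P_5^*` is generated by the image of `ℓ` and the `x_i5`. -/
theorem closure_x12_x23_x5 :
    Subgroup.closure ({x p12, x p23} ∪ Set.range x5) = ⊤ := by
  rw [eq_top_iff, ← closure_x, Subgroup.closure_le]
  set H := Subgroup.closure ({x p12, x p23} ∪ Set.range x5)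
  have h12 : x p12 ∈ H := Subgroup.subset_closure (Or.inl (Or.inl rfl))
  have h23 : x p23 ∈ H := Subgroup.subset_closure (Or.inl (Or.inr rfl))
  have h5 : ∀ i, x5 i ∈ H := fun i => Subgroup.subset_closure (Or.inr ⟨i, rfl⟩)
  have h13 : x p13 ∈ H := by
    rw [x13_eq]
    exact mul_mem (mul_mem (mul_mem (mul_mem (inv_mem (h5 2)) (inv_mem (h5 1)))
      (inv_mem (h5 0))) (inv_mem h12)) (inv_mem h23)
  rintro _ ⟨i, rfl⟩
  cases i
  · exact h12
  · exact h13
  · rw [x14_eq]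
    exact mul_mem (mul_mem (inv_mem h13) (inv_mem h12)) (inv_mem (h5 0))
  · exact h23
  · rw [x24_eq]
    exact mul_mem (mul_mem (inv_mem h23) (inv_mem h12)) (inv_mem (h5 1))
  · rw [x34_eq]
    exact mul_mem (mul_mem h12 (h5 0)) (h5 1)

end Group

end Betti

end

end BFSTheory

namespace BFSTheory

noncomputable section

namespace Betti

open Pair

open scoped commutatorElement

/-! ### The semidirect product decomposition of `P_5^*` -/

section Relations

variable {G : Type} [Group G]

/-- Elements `a`, `c`, `m_0`, `m_1`, `m_2` of a group which satisfy the relations of `x_12`, `x_23`,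
`x_15`, `x_25`, `x_35`: conjugation by `a` is conjugation by `(m_0 m_1)⁻¹` on `m_0`, `m_1` and is
trivial on `m_2`, and conjugation by `c` is conjugation by `(m_1 m_2)⁻¹` on `m_1`, `m_2` and is
trivial on `m_0`. -/
structure TwistRel (a c : G) (m : Fin 3 → G) : Prop where
  am0 : Commute (a * (m 0 * m 1)) (m 0)
  am1 : Commute (a * (m 0 * m 1)) (m 1)
  am2 : Commute a (m 2)
  cm0 : Commute c (m 0)
  cm1 : Commute (c * (m 1 * m 2)) (m 1)
  cm2 : Commute (c * (m 1 * m 2)) (m 2)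

/-- The elements `x_ij` expressed through `x_12`, `x_23` and the `x_i5`. -/
def pairFun (a c : G) (m : Fin 3 → G) : Pair → G
  | p12 => a
  | p13 => (m 2)⁻¹ * (m 1)⁻¹ * (m 0)⁻¹ * a⁻¹ * c⁻¹
  | p14 => c * a * (m 0 * m 1 * m 2) * a⁻¹ * (m 0)⁻¹
  | p23 => c
  | p24 => c⁻¹ * a⁻¹ * (m 1)⁻¹
  | p34 => a * (m 0 * m 1)

namespace TwistRel

variable {a c : G} {m : Fin 3 → G}

theorem a_z (h : TwistRel a c m) : Commute a (m 0 * m 1) := by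
  have := (h.am0.mul_right h.am1).mul_left ((Commute.refl (m 0 * m 1)).inv_left)
  rwa [mul_inv_cancel_right] at this

theorem c_z (h : TwistRel a c m) : Commute c (m 1 * m 2) := by
  have := (h.cm1.mul_right h.cm2).mul_left ((Commute.refl (m 1 * m 2)).inv_left)
  rwa [mul_inv_cancel_right] at this

theorem a_n (h : TwistRel a c m) : Commute a (m 0 * m 1 * m 2) := h.a_z.mul_right h.am2

theorem c_n (h : TwistRel a c m) : Commute c (m 0 * m 1 * m 2) := by
  rw [mul_assoc]; exact h.cm0.mul_right h.c_z

theorem a_conj (h : TwistRel a c m) {k : G} (hk : Commute (a * (m 0 * m 1)) k) :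
    a * k * a⁻¹ = (m 0 * m 1)⁻¹ * k * (m 0 * m 1) :=
  conj_of_commute (h.a_z.eq ▸ hk)

theorem a_conj_inv (h : TwistRel a c m) {k : G} (hk : Commute (a * (m 0 * m 1)) k) :
    a⁻¹ * k * a = (m 0 * m 1) * k * (m 0 * m 1)⁻¹ :=
  conj_inv_of_commute (h.a_z.eq ▸ hk) h.a_z

theorem p14_eq (h : TwistRel a c m) : pairFun a c m p14 = m 0 * (c * (m 1 * m 2)) * (m 0)⁻¹ := by
  have e1 := h.a_n.eq
  have e2 := h.cm0.eq
  calc c * a * (m 0 * m 1 * m 2) * a⁻¹ * (m 0)⁻¹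
      = c * (a * (m 0 * m 1 * m 2)) * a⁻¹ * (m 0)⁻¹ := by group
    _ = (c * m 0) * (m 1 * m 2) * (m 0)⁻¹ := by rw [e1]; group
    _ = _ := by rw [e2]; group

theorem prod_123 (h : TwistRel a c m) : pairFun a c m p12 * pairFun a c m p13 * pairFun a c m p23 =
    (m 0 * m 1 * m 2)⁻¹ := by
  have e1 := h.a_n.inv_right.eq
  calc a * ((m 2)⁻¹ * (m 1)⁻¹ * (m 0)⁻¹ * a⁻¹ * c⁻¹) * c
      = a * (m 0 * m 1 * m 2)⁻¹ * a⁻¹ := by group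
    _ = _ := by rw [e1]; group

theorem prod_124 (h : TwistRel a c m) : pairFun a c m p12 * pairFun a c m p14 * pairFun a c m p24 =
    m 0 * m 1 * m 2 * (m 0 * m 1)⁻¹ := by
  have e1 := h.c_n.eq
  have e3 := h.a_n.eq
  have e2 := h.a_conj h.am0.inv_right
  calc a * (c * a * (m 0 * m 1 * m 2) * a⁻¹ * (m 0)⁻¹) * (c⁻¹ * a⁻¹ * (m 1)⁻¹)
      = a * c * (a * (m 0 * m 1 * m 2)) * a⁻¹ * ((m 0)⁻¹ * c⁻¹) * a⁻¹ * (m 1)⁻¹ := by group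
    _ = a * (c * (m 0 * m 1 * m 2)) * c⁻¹ * (m 0)⁻¹ * a⁻¹ * (m 1)⁻¹ := by
      rw [e3, h.cm0.inv_inv.eq.symm]; group
    _ = (a * (m 0 * m 1 * m 2)) * (m 0)⁻¹ * a⁻¹ * (m 1)⁻¹ := by rw [e1]; group
    _ = (m 0 * m 1 * m 2) * (a * (m 0)⁻¹ * a⁻¹) * (m 1)⁻¹ := by rw [e3]; group
    _ = _ := by rw [e2]; group

theorem prod_134 (h : TwistRel a c m) : pairFun a c m p13 * pairFun a c m p14 * pairFun a c m p34 =
    m 0 * m 1 * (m 0)⁻¹ := by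
  have e2 := h.a_conj_inv h.am0.inv_right
  calc (m 2)⁻¹ * (m 1)⁻¹ * (m 0)⁻¹ * a⁻¹ * c⁻¹ * (c * a * (m 0 * m 1 * m 2) * a⁻¹ * (m 0)⁻¹) *
      (a * (m 0 * m 1)) = (a⁻¹ * (m 0)⁻¹ * a) * (m 0 * m 1) := by group
    _ = _ := by rw [e2]; group

theorem prod_234 (h : TwistRel a c m) :
    pairFun a c m p23 * pairFun a c m p24 * pairFun a c m p34 = m 0 := by
  have e2 := h.a_conj_inv h.am1.inv_right
  calc c * (c⁻¹ * a⁻¹ * (m 1)⁻¹) * (a * (m 0 * m 1))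
      = (a⁻¹ * (m 1)⁻¹ * a) * (m 0 * m 1) := by group
    _ = _ := by rw [e2]; group

theorem commute_p13_p24 (h : TwistRel a c m) :
    Commute (pairFun a c m p13)
      ((pairFun a c m p12)⁻¹ * pairFun a c m p24 * pairFun a c m p12) := by
  -- the conjugate of `x_24` by `x_12⁻¹` is `(c a)⁻¹ k`, where `k = m_0 m_1⁻¹ m_0⁻¹`
  have ha : a⁻¹ * (m 1)⁻¹ * a = m 0 * (m 1)⁻¹ * (m 0)⁻¹ := by
    rw [h.a_conj_inv h.am1.inv_right]; group
  have hk : Commute (c * a * (m 0 * m 1 * m 2)) (m 0 * (m 1)⁻¹ * (m 0)⁻¹) := by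
    have e2 := h.a_conj ((h.am0.mul_right h.am1.inv_right).mul_right h.am0.inv_right)
    have e3 := h.cm1.inv_right.eq
    have e4 := h.a_n.eq
    have e5 := h.cm0.eq
    calc c * a * (m 0 * m 1 * m 2) * (m 0 * (m 1)⁻¹ * (m 0)⁻¹)
        = c * (a * (m 0 * m 1 * m 2)) * (m 0 * (m 1)⁻¹ * (m 0)⁻¹) := by group
      _ = c * (m 0 * m 1 * m 2) * (a * (m 0 * (m 1)⁻¹ * (m 0)⁻¹) * a⁻¹) * a := by rw [e4]; group
      _ = (c * m 0) * (m 1 * m 2) * (m 1)⁻¹ * a := by rw [e2]; group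
      _ = m 0 * (c * (m 1 * m 2) * (m 1)⁻¹) * a := by rw [e5]; group
      _ = m 0 * (m 1)⁻¹ * (m 0)⁻¹ * (m 0 * c) * (m 1 * m 2) * a := by rw [e3]; group
      _ = m 0 * (m 1)⁻¹ * (m 0)⁻¹ * c * ((m 0 * m 1 * m 2) * a) := by rw [← e5]; group
      _ = m 0 * (m 1)⁻¹ * (m 0)⁻¹ * (c * a * (m 0 * m 1 * m 2)) := by rw [← e4]; group
  have hg : Commute (c * a * (m 0 * m 1 * m 2)) (c * a) :=
    (Commute.refl (c * a)).mul_left (h.c_n.symm.mul_right h.a_n.symm)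
  have e1 : pairFun a c m p13 = (c * a * (m 0 * m 1 * m 2))⁻¹ := by rw [pairFun]; group
  have e2 : (pairFun a c m p12)⁻¹ * pairFun a c m p24 * pairFun a c m p12 =
      (c * a)⁻¹ * (m 0 * (m 1)⁻¹ * (m 0)⁻¹) := by
    rw [← ha, pairFun, pairFun]; group
  rw [e1, e2]
  exact (hg.inv_right.mul_right hk).inv_left

theorem commute_p14_p23 (h : TwistRel a c m) :
    Commute (pairFun a c m p14) (pairFun a c m p23) := by
  rw [h.p14_eq]
  exact ((h.cm0.symm.mul_left ((Commute.refl c).mul_left h.c_z.symm)).mul_left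
    h.cm0.symm.inv_left)

theorem lift_tripleRels {f : Pair → G} {i j k : Pair}
    (h1 : Commute (f i * f j * f k) (f i)) (h3 : Commute (f i * f j * f k) (f k))
    {r : FreeGroup Pair} (hr : r ∈ tripleRels (y i) (y j) (y k)) : FreeGroup.lift f r = 1 := by
  have h2 : Commute (f i * f j * f k) (f j) := by
    have := (h1.inv_right.mul_right (Commute.refl _)).mul_right h3.inv_right
    rwa [← mul_assoc, ← mul_assoc, inv_mul_cancel, one_mul, mul_inv_cancel_right] at this
  rcases hr with rfl | rfl | rfl <;>
    simpa only [map_commutatorElement, commutatorElement_eq_one_iff_commute, map_mul, y,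
      FreeGroup.lift_apply_of]

theorem rel (h : TwistRel a c m) (r : FreeGroup Pair) (hr : r ∈ relsK4) :
    FreeGroup.lift (pairFun a c m) r = 1 := by
  have hz : Commute (m 0) (a * (m 0 * m 1)) := h.am0.symm
  rcases hr with (((hr | hr) | hr) | hr) | hr
  · refine lift_tripleRels ?_ ?_ hr <;> rw [h.prod_123]
    exacts [h.a_n.symm.inv_left, h.c_n.symm.inv_left]
  · have hE : Commute (pairFun a c m p12 * pairFun a c m p14 * pairFun a c m p24)
        (pairFun a c m p12) := by
      rw [h.prod_124]
      exact h.a_n.symm.mul_left h.a_z.symm.inv_left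
    have hD : Commute (pairFun a c m p12 * pairFun a c m p14 * pairFun a c m p24)
        (pairFun a c m p14) := by
      rw [h.prod_124, h.p14_eq]
      refine (commute_conj_iff.2 ?_).symm
      have : (m 0)⁻¹ * (m 0 * m 1 * m 2 * (m 0 * m 1)⁻¹) * m 0 = m 1 * m 2 * (m 1)⁻¹ := by group
      rw [this]
      exact (h.cm1.mul_right h.cm2).mul_right h.cm1.inv_right
    refine lift_tripleRels hE ?_ hr
    have := (hE.mul_right hD).inv_right.mul_right
      (Commute.refl (pairFun a c m p12 * pairFun a c m p14 * pairFun a c m p24))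
    rwa [inv_mul_cancel_left] at this
  · have hF : Commute (pairFun a c m p13 * pairFun a c m p14 * pairFun a c m p34)
        (pairFun a c m p34) := by
      rw [h.prod_134]
      exact ((hz.mul_left h.am1.symm).mul_left hz.inv_left)
    have hD : Commute (pairFun a c m p13 * pairFun a c m p14 * pairFun a c m p34)
        (pairFun a c m p14) := by
      rw [h.prod_134, h.p14_eq]
      refine (commute_conj_iff.2 ?_).symm
      have : (m 0)⁻¹ * (m 0 * m 1 * (m 0)⁻¹) * m 0 = m 1 := by group
      rw [this]
      exact h.cm1
    refine lift_tripleRels ?_ hF hr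
    have := (Commute.refl (pairFun a c m p13 * pairFun a c m p14 * pairFun a c m p34)).mul_right
      (hD.mul_right hF).inv_right
    rwa [mul_assoc (pairFun a c m p13), mul_inv_cancel_right, ← mul_assoc] at this
  · refine lift_tripleRels ?_ ?_ hr <;> rw [h.prod_234]
    exacts [h.cm0.symm, hz]
  · rcases hr with rfl | rfl | rfl <;>
      simp only [map_commutatorElement, commutatorElement_eq_one_iff_commute, map_mul, map_inv, y,
        FreeGroup.lift_apply_of]
    exacts [(Commute.refl a).mul_right h.a_z, h.commute_p13_p24, h.commute_p14_p23]

theorem prod_eq_one (h : TwistRel a c m) :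
    pairFun a c m p12 * pairFun a c m p13 * pairFun a c m p23 * pairFun a c m p14 *
      pairFun a c m p24 * pairFun a c m p34 = 1 := by
  have h1 := h.prod_124
  have h2 : pairFun a c m p14 * pairFun a c m p24 =
      a⁻¹ * (m 0 * m 1 * m 2 * (m 0 * m 1)⁻¹) := by
    rw [← h1, pairFun]; group
  rw [h.prod_123, mul_assoc _ (pairFun a c m p14), h2]
  change _ * (a * (m 0 * m 1)) = 1
  have e : Commute (m 0 * m 1 * m 2 * (m 0 * m 1)⁻¹) a :=
    (h.a_n.mul_right h.a_z.inv_right).symm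
  calc (m 0 * m 1 * m 2)⁻¹ * (a⁻¹ * (m 0 * m 1 * m 2 * (m 0 * m 1)⁻¹)) * (a * (m 0 * m 1))
      = (m 0 * m 1 * m 2)⁻¹ * (a⁻¹ * ((m 0 * m 1 * m 2 * (m 0 * m 1)⁻¹) * a) * (m 0 * m 1)) := by
        group
    _ = 1 := by rw [e.eq]; group

/-- The morphism `P_5^* → G` given by elements satisfying the relations of `x_12`, `x_23` and the
`x_i5`. -/
def lift (h : TwistRel a c m) : P5 →* G := P5lift (pairFun a c m) h.rel h.prod_eq_one

theorem lift_x (h : TwistRel a c m) (i : Pair) : h.lift (x i) = pairFun a c m i := P5lift_x _ _ _ i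

end TwistRel

end Relations

section Semidirect

/-- The free group `F_3` on three generators `n_0`, `n_1`, `n_2`. -/
abbrev F3 : Type := FreeGroup (Fin 3)

/-- The generators of `F_3`. -/
def n (i : Fin 3) : F3 := FreeGroup.of i

/-- Conjugation of `n_0`, `n_1` by `(n_0 n_1)⁻¹`. -/
def twist01 : MulAut F3 :=
  MonoidHom.toMulEquiv
    (FreeGroup.lift ![(n 0 * n 1)⁻¹ * n 0 * (n 0 * n 1), (n 0 * n 1)⁻¹ * n 1 * (n 0 * n 1), n 2])
    (FreeGroup.lift ![(n 0 * n 1) * n 0 * (n 0 * n 1)⁻¹, (n 0 * n 1) * n 1 * (n 0 * n 1)⁻¹, n 2])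
    (by ext i; fin_cases i <;> decide)
    (by ext i; fin_cases i <;> decide)

/-- Conjugation of `n_1`, `n_2` by `(n_1 n_2)⁻¹`. -/
def twist12 : MulAut F3 :=
  MonoidHom.toMulEquiv
    (FreeGroup.lift ![n 0, (n 1 * n 2)⁻¹ * n 1 * (n 1 * n 2), (n 1 * n 2)⁻¹ * n 2 * (n 1 * n 2)])
    (FreeGroup.lift ![n 0, (n 1 * n 2) * n 1 * (n 1 * n 2)⁻¹, (n 1 * n 2) * n 2 * (n 1 * n 2)⁻¹])
    (by ext i; fin_cases i <;> decide)
    (by ext i; fin_cases i <;> decide)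

/-- The action of `F_2` on `F_3` modelling the conjugation of the `x_i5` by `x_23` and `x_12`. -/
def twist : F2 →* MulAut F3 := FreeGroup.lift ![twist12, twist01]

/-- The semidirect product `F_3 ⋊ F_2`. -/
abbrev F3F2 : Type := F3 ⋊[twist] F2

/-- The relations hold by construction of `twist`; each is an equality of reduced words. -/
theorem twistRel_F3F2 : TwistRel (G := F3F2) (.inr (X 1)) (.inr (X 0)) (fun i => .inl (n i)) := by
  constructor <;> refine SemidirectProduct.ext ?_ ?_
  all_goals decide +kernel

/-- The morphism `P_5^* → F_3 ⋊ F_2` sending `x_12`, `x_23` to the generators `X_1`, `X_0` of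
`F_2` and the `x_i5` to the generators of `F_3`. -/
def toF3F2 : P5 →* F3F2 := twistRel_F3F2.lift

theorem toF3F2_x (i : Pair) :
    toF3F2 (x i) = pairFun (.inr (X 1)) (.inr (X 0)) (fun i => .inl (n i)) i :=
  twistRel_F3F2.lift_x i

theorem toF3F2_x5 (i : Fin 3) : toF3F2 (x5 i) = .inl (n i) := by
  have h := twistRel_F3F2
  fin_cases i
  · change toF3F2 (x p12 * x p13 * x p14)⁻¹ = .inl (n 0)
    simp only [map_mul, map_inv, toF3F2_x, pairFun]
    group
  · change toF3F2 (x p12 * x p23 * x p24)⁻¹ = .inl (n 1)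
    simp only [map_mul, map_inv, toF3F2_x, pairFun]
    group
  · change toF3F2 (x p13 * x p23 * x p34)⁻¹ = .inl (n 2)
    simp only [map_mul, map_inv, toF3F2_x, pairFun]
    group

/-- The morphism `F_3 → P_5^*` sending the generators to the `x_i5`. -/
def fromF3 : F3 →* P5 := FreeGroup.lift x5

theorem fromF3_n (i : Fin 3) : fromF3 (n i) = x5 i := FreeGroup.lift_apply_of

/-- The action `twist` models the conjugation by `ℓ(F_2)`, so that `fromF3` and `ℓ` assemble into a
morphism out of the semidirect product. -/
theorem fromF3_twist (g : F2) (k : F3) : fromF3 (twist g k) = ell g * fromF3 k * (ell g)⁻¹ := by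
  have key : ∀ (g : F2) (h : ∀ i, fromF3 (twist g (n i)) = ell g * x5 i * (ell g)⁻¹) (k : F3),
      fromF3 (twist g k) = ell g * fromF3 k * (ell g)⁻¹ := by
    intro g h k
    have : fromF3.comp (twist g).toMonoidHom = (MulAut.conj (ell g)).toMonoidHom.comp fromF3 :=
      FreeGroup.ext_hom _ _ fun i =>
        (h i).trans (congrArg (fun t => ell g * t * (ell g)⁻¹) (fromF3_n i).symm)
    exact DFunLike.congr_fun this k
  induction g using FreeGroup.induction_on generalizing k with
  | C1 => simp
  | mul g g' h h' => rw [map_mul, MulAut.mul_apply, h, h', map_mul]; group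
  | inv_of i h =>
    have := h (twist (FreeGroup.of i)⁻¹ k)
    rw [← MulAut.mul_apply, ← map_mul, mul_inv_cancel, map_one, MulAut.one_apply] at this
    rw [this, map_inv ell]
    group
  | of i =>
    refine key _ (fun j => ?_) k
    have e1 : ell (FreeGroup.of 1) = x p12 := FreeGroup.lift_apply_of
    have e0 : ell (FreeGroup.of 0) = x p23 := FreeGroup.lift_apply_of
    have t1 : twist (FreeGroup.of 1) = twist01 := FreeGroup.lift_apply_of
    have t0 : twist (FreeGroup.of 0) = twist12 := FreeGroup.lift_apply_of
    fin_cases i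
    · change fromF3 (twist (FreeGroup.of 0) (n j)) =
        ell (FreeGroup.of 0) * x5 j * (ell (FreeGroup.of 0))⁻¹
      rw [e0, t0]
      by_cases hj : j = 0
      · subst hj
        rw [commute_x23_x15.eq, mul_inv_cancel_right, ← fromF3_n]
        rfl
      · rw [conj_of_commute (commute_x25_mul_x35_mul_x23 j hj)]
        simp only [← fromF3_n, ← map_mul, ← map_inv]
        congr 1
        fin_cases j
        exacts [absurd rfl hj, rfl, rfl]
    · change fromF3 (twist (FreeGroup.of 1) (n j)) =
        ell (FreeGroup.of 1) * x5 j * (ell (FreeGroup.of 1))⁻¹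
      rw [e1, t1]
      by_cases hj : j = 2
      · subst hj
        rw [commute_x12_x35.eq, mul_inv_cancel_right, ← fromF3_n]
        rfl
      · rw [conj_of_commute (commute_x15_mul_x25_mul_x12 j hj)]
        simp only [← fromF3_n, ← map_mul, ← map_inv]
        congr 1
        fin_cases j
        exacts [rfl, rfl, absurd rfl hj]

/-- The morphism `F_3 ⋊ F_2 → P_5^*` equal to `fromF3` on `F_3` and to `ℓ` on `F_2`. -/
def fromF3F2 : F3F2 →* P5 :=
  SemidirectProduct.lift fromF3 ell fun g => MonoidHom.ext fun k => fromF3_twist g k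

theorem eq_of_eqOn_x12_x23_x5 {G : Type} [Group G] {f g : P5 →* G} (h12 : f (x p12) = g (x p12))
    (h23 : f (x p23) = g (x p23)) (h5 : ∀ i, f (x5 i) = g (x5 i)) : f = g := by
  refine MonoidHom.eq_of_eqOn_dense closure_x12_x23_x5 ?_
  rintro _ ((rfl | rfl) | ⟨i, rfl⟩)
  exacts [h12, h23, h5 i]

theorem fromF3F2_toF3F2 (g : P5) : fromF3F2 (toF3F2 g) = g := by
  have : fromF3F2.comp toF3F2 = MonoidHom.id P5 := by
    refine eq_of_eqOn_x12_x23_x5 ?_ ?_ fun i => ?_ <;>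
      rw [MonoidHom.comp_apply, MonoidHom.id_apply]
    · rw [toF3F2_x, pairFun, fromF3F2, SemidirectProduct.lift_inr]
      exact FreeGroup.lift_apply_of
    · rw [toF3F2_x, pairFun, fromF3F2, SemidirectProduct.lift_inr]
      exact FreeGroup.lift_apply_of
    · rw [toF3F2_x5, fromF3F2, SemidirectProduct.lift_inl, fromF3_n]
  exact DFunLike.congr_fun this g

theorem toF3F2_right (g : P5) : (toF3F2 g).right = pr5 g := by
  have : SemidirectProduct.rightHom.comp toF3F2 = pr5 := by
    refine eq_of_eqOn_x12_x23_x5 ?_ ?_ fun i => ?_ <;> rw [MonoidHom.comp_apply]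
    · rw [toF3F2_x, pr5_x, pairFun, SemidirectProduct.rightHom_inr, pr5Fun]
    · rw [toF3F2_x, pr5_x, pairFun, SemidirectProduct.rightHom_inr, pr5Fun]
    · rw [toF3F2_x5, SemidirectProduct.rightHom_inl, pr5_x5]
  exact DFunLike.congr_fun this g

/-- Every `g ∈ P_5^*` is a product of an element of the group generated by the `x_i5` and of
`ℓ (pr_5 g)`. -/
theorem fromF3_mul_ell (g : P5) : fromF3 (toF3F2 g).left * ell (pr5 g) = g := by
  rw [← toF3F2_right]
  exact fromF3F2_toF3F2 g

end Semidirect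

end Betti

end

end BFSTheory

namespace BFSTheory

noncomputable section

/-! ### Kernels generated as right ideals -/

section RightSpan

variable {K : Type u} [CommRing K] {P V W : Type u} [Ring P] [Algebra K P] [Ring V] [Algebra K V]
  [Ring W] [Algebra K W]

/-- The sums `∑ i, u_i a_i` with all `a_i` in `S`. -/
def rightSpan (u : Fin 3 → P) (S : Submodule K P) : Submodule K P :=
  (Submodule.pi Set.univ fun _ : Fin 3 => S).map
    (∑ i, (LinearMap.mulLeft K (u i)).comp (LinearMap.proj i))

variable {u : Fin 3 → P} {S T : Submodule K P}

theorem mem_rightSpan {x : P} :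
    x ∈ rightSpan u S ↔ ∃ a : Fin 3 → P, (∀ i, a i ∈ S) ∧ ∑ i, u i * a i = x := by
  simp [rightSpan, Submodule.mem_map, Submodule.mem_pi]

theorem rightSpan_le {N : Submodule K P} (h : ∀ i, ∀ a ∈ S, u i * a ∈ N) : rightSpan u S ≤ N := by
  intro x hx
  obtain ⟨a, ha, rfl⟩ := mem_rightSpan.1 hx
  exact sum_mem fun i _ => h i _ (ha i)

theorem mul_mem_rightSpan (i : Fin 3) {a : P} (ha : a ∈ S) : u i * a ∈ rightSpan u S := by
  refine mem_rightSpan.2 ⟨Pi.single i a, fun j => ?_, ?_⟩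
  · by_cases h : j = i
    · subst h; rwa [Pi.single_eq_same]
    · rw [Pi.single_eq_of_ne h]; exact zero_mem _
  · rw [Finset.sum_eq_single i (fun j _ h => by rw [Pi.single_eq_of_ne h, mul_zero])
      (fun h => absurd (Finset.mem_univ i) h), Pi.single_eq_same]

theorem mul_mem_rightSpan_of_mem {x b : P} (hx : x ∈ rightSpan u S) (h : ∀ a ∈ S, a * b ∈ T) :
    x * b ∈ rightSpan u T := by
  have : rightSpan u S ≤ (rightSpan u T).comap (LinearMap.mulRight K b) :=
    rightSpan_le fun i a ha => by
      rw [Submodule.mem_comap, LinearMap.mulRight_apply, mul_assoc]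
      exact mul_mem_rightSpan i (h a ha)
  exact this hx

/-- If the algebra generators `b` of `P` satisfy `b u_i ∈ J` and `b ∈ J + ℓ(V)`, where `J` is the
right ideal generated by the `u_i`, then `J` is a two-sided ideal and `x ∈ ℓ (p x) + J` for all `x`.
In particular `J` is the kernel of `p`. -/
theorem sub_mem_rightSpan (p : P →ₐ[K] V) (ℓ : V →ₐ[K] P) (hℓ : ∀ v, p (ℓ v) = v)
    (hu : ∀ i, p (u i) = 0) {s : Set P} (hs : Algebra.adjoin K s = ⊤)
    (h1 : ∀ b ∈ s, ∀ i, b * u i ∈ rightSpan u (⊤ : Submodule K P))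
    (h2 : ∀ b ∈ s, ∃ v, b - ℓ v ∈ rightSpan u (⊤ : Submodule K P)) (x : P) :
    x - ℓ (p x) ∈ rightSpan u (⊤ : Submodule K P) := by
  set J := rightSpan u (⊤ : Submodule K P)
  have hJr : ∀ y ∈ J, ∀ b, y * b ∈ J := fun y hy b => mul_mem_rightSpan_of_mem hy fun _ _ => trivial
  have hJ0 : ∀ y ∈ J, p y = 0 := fun y hy => by
    have : J ≤ LinearMap.ker p.toLinearMap := rightSpan_le fun i a _ => by
      rw [LinearMap.mem_ker, AlgHom.toLinearMap_apply, map_mul, hu, zero_mul]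
    exact this hy
  have hJl : ∀ b : P, ∀ y ∈ J, b * y ∈ J := by
    intro b y hy
    have hb : b ∈ Algebra.adjoin K s := hs ▸ Algebra.mem_top
    have key : ∀ b : P, (∀ i, b * u i ∈ J) → ∀ y ∈ J, b * y ∈ J := fun b h y hy => by
      have : J ≤ J.comap (LinearMap.mulLeft K b) := rightSpan_le fun i a _ => by
        rw [Submodule.mem_comap, LinearMap.mulLeft_apply, ← mul_assoc]
        exact hJr _ (h i) a
      exact this hy
    induction hb using Algebra.adjoin_induction generalizing y with
    | mem b hb => exact key b (h1 b hb) y hy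
    | algebraMap r => rw [← Algebra.smul_def]; exact Submodule.smul_mem _ _ hy
    | add a b _ _ h h' => rw [add_mul]; exact add_mem (h y hy) (h' y hy)
    | mul a b _ _ h h' => rw [mul_assoc]; exact h _ (h' y hy)
  have hx : x ∈ Algebra.adjoin K s := hs ▸ Algebra.mem_top
  induction hx using Algebra.adjoin_induction with
  | mem b hb =>
    obtain ⟨v, hv⟩ := h2 b hb
    have h0 := hJ0 _ hv
    rw [map_sub, hℓ, sub_eq_zero] at h0
    rwa [h0]
  | algebraMap r => rw [AlgHom.commutes, AlgHom.commutes, sub_self]; exact zero_mem _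
  | add a b _ _ h h' => rw [map_add, map_add, add_sub_add_comm]; exact add_mem h h'
  | mul a b _ _ h h' =>
    have : a * b - ℓ (p (a * b)) = (a - ℓ (p a)) * b + ℓ (p a) * (b - ℓ (p b)) := by
      rw [map_mul, map_mul]; noncomm_ring
    rw [this]
    exact add_mem (hJr _ h b) (hJl _ _ h')

/-- An expression of `x` as `∑ i, u_i a_i` gives the coordinates of `x ⊗ w` with respect to the
`u_i ⊗ 1`. -/
theorem tmul_eq_kappa {p : P →ₐ[K] V} (q : P →ₐ[K] W) (u : Fin 3 → KerMod p) (x : KerMod p)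
    (a : Fin 3 → P) (hx : ∑ i, KerMod.incl p (u i) * a i = KerMod.incl p x) (w : W) :
    KerTensor.tmul p q x w = KerTensor.kappa p q u (fun i => q (a i) * w) := by
  have : x = ∑ i, KerMod.mulRight p (a i) (u i) := KerMod.ext (by
    rw [← hx, map_sum]
    rfl)
  rw [this, map_sum, LinearMap.sum_apply]
  exact Finset.sum_congr rfl fun i _ => KerTensor.tmul_mul (u i) (a i) w

theorem kappa_surjective {p : P →ₐ[K] V} (q : P →ₐ[K] W) {u : Fin 3 → KerMod p}
    (h : ∀ x : KerMod p,
      KerMod.incl p x ∈ rightSpan (fun i => KerMod.incl p (u i)) (⊤ : Submodule K P)) :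
    Function.Surjective (KerTensor.kappa p q u) := by
  intro m
  induction m using KerTensor.induction with
  | h0 => exact ⟨0, map_zero _⟩
  | ht x w =>
    obtain ⟨a, -, ha⟩ := mem_rightSpan.1 (h x)
    exact ⟨_, (tmul_eq_kappa q u x a ha w).symm⟩
  | ha a b h h' =>
    obtain ⟨a, rfl⟩ := h
    obtain ⟨b, rfl⟩ := h'
    exact ⟨a + b, map_add _ _ _⟩

end RightSpan

namespace Betti

open Pair

variable (K : Type u) [CommRing K]

/-- The element `x_i5 - 1` of `K P_5^*`. -/
def uP (i : Fin 3) : KP5 K := MonoidAlgebra.of K P5 (x5 i) - 1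

theorem incl_u (i : Fin 3) : KerMod.incl (Kpr5 K) (u K i) = uP K i := rfl

theorem Kpr5_uP (i : Fin 3) : Kpr5 K (uP K i) = 0 := KerMod.map_incl (u K i)

theorem pr5_ell (g : F2) : pr5 (ell g) = g := by
  have : pr5.comp ell = MonoidHom.id F2 := FreeGroup.ext_hom _ _ fun i => by
    rw [MonoidHom.comp_apply, ell, FreeGroup.lift_apply_of]
    fin_cases i
    exacts [pr5_x p23, pr5_x p12]
  exact DFunLike.congr_fun this g

theorem Kpr5_Kell (v : V K) : Kpr5 K (Kell K v) = v := by
  induction v using MonoidAlgebra.induction_on with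
  | of g => rw [Kell_of, Kpr5_of, pr5_ell]
  | add a b h h' => rw [map_add, map_add, h, h']
  | smul r a h => rw [map_smul, map_smul, h]

theorem of_sub_one_mem_rightSpan {g : P5} (hg : g ∈ subgroupX5) :
    MonoidAlgebra.of K P5 g - 1 ∈ rightSpan (uP K) (⊤ : Submodule K (KP5 K)) := by
  have hr : ∀ y ∈ rightSpan (uP K) (⊤ : Submodule K (KP5 K)), ∀ b,
      y * b ∈ rightSpan (uP K) (⊤ : Submodule K (KP5 K)) :=
    fun y hy b => mul_mem_rightSpan_of_mem hy fun _ _ => trivial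
  induction hg using Subgroup.closure_induction with
  | mem g hg =>
    obtain ⟨i, rfl⟩ := hg
    have := mul_mem_rightSpan (u := uP K) i (Submodule.mem_top (R := K) (x := (1 : KP5 K)))
    rwa [mul_one] at this
  | one => rw [map_one, sub_self]; exact zero_mem _
  | mul g h _ _ hg hh =>
    have : MonoidAlgebra.of K P5 (g * h) - 1 = (MonoidAlgebra.of K P5 g - 1) *
        MonoidAlgebra.of K P5 h + (MonoidAlgebra.of K P5 h - 1) := by
      rw [map_mul]; noncomm_ring
    rw [this]
    exact add_mem (hr _ hg _) hh
  | inv g _ hg =>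
    have : MonoidAlgebra.of K P5 g⁻¹ - 1 = -((MonoidAlgebra.of K P5 g - 1) *
        MonoidAlgebra.of K P5 g⁻¹) := by
      rw [sub_mul, ← map_mul, mul_inv_cancel, map_one]; noncomm_ring
    rw [this]
    exact neg_mem (hr _ hg _)

theorem adjoin_of_eq_top {G : Type} [Group G] {s : Set G} (hs : Subgroup.closure s = ⊤) :
    Algebra.adjoin K (MonoidAlgebra.of K G '' (s ∪ s⁻¹)) = ⊤ := by
  rw [eq_top_iff]
  intro a _
  induction a using MonoidAlgebra.induction_on with
  | add a b h h' => exact add_mem (h trivial) (h' trivial)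
  | smul r a h => exact Subalgebra.smul_mem _ (h trivial) r
  | of g =>
    clear * - hs
    have hg : g ∈ Submonoid.closure (s ∪ s⁻¹) := by
      rw [← Subgroup.closure_toSubmonoid, hs]; trivial
    induction hg using Submonoid.closure_induction with
    | mem g hg => exact Algebra.subset_adjoin ⟨g, hg, rfl⟩
    | one => rw [map_one]; exact one_mem _
    | mul a b _ _ h h' => rw [map_mul]; exact mul_mem h h'

theorem conj_mem_subgroupX5 {h : P5}
    (hh : h = x p12 ∨ h = (x p12)⁻¹ ∨ h = x p23 ∨ h = (x p23)⁻¹) (i : Fin 3) :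
    h * x5 i * h⁻¹ ∈ subgroupX5 := by
  obtain ⟨z, hz, e⟩ := conj_x5 h hh i
  rw [e]
  exact mul_mem (mul_mem (inv_mem hz) (x5_mem i)) hz

/-- `K P_5^*` is the sum of the right ideal generated by the `x_i5 - 1` and of the image
of `K ℓ`. -/
theorem sub_Kell_mem (a : KP5 K) :
    a - Kell K (Kpr5 K a) ∈ rightSpan (uP K) (⊤ : Submodule K (KP5 K)) := by
  have hgen : ∀ g ∈ ({x p12, x p23} ∪ Set.range x5) ∪ ({x p12, x p23} ∪ Set.range x5)⁻¹,
      g ∈ subgroupX5 ∨ ((g = x p12 ∨ g = (x p12)⁻¹ ∨ g = x p23 ∨ g = (x p23)⁻¹) ∧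
        ∃ h, g = ell h) := by
    have e12 : x p12 = ell (FreeGroup.of 1) := FreeGroup.lift_apply_of.symm
    have e23 : x p23 = ell (FreeGroup.of 0) := FreeGroup.lift_apply_of.symm
    rintro g (((rfl | rfl) | ⟨i, rfl⟩) | ((h | h) | ⟨i, h⟩))
    · exact Or.inr ⟨Or.inl rfl, _, e12⟩
    · exact Or.inr ⟨Or.inr (Or.inr (Or.inl rfl)), _, e23⟩
    · exact Or.inl (x5_mem i)
    · rw [inv_eq_iff_eq_inv] at h
      exact Or.inr ⟨Or.inr (Or.inl h), _, by rw [h, e12, ← map_inv]⟩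
    · rw [Set.mem_singleton_iff, inv_eq_iff_eq_inv] at h
      exact Or.inr ⟨Or.inr (Or.inr (Or.inr h)), _, by rw [h, e23, ← map_inv]⟩
    · rw [← inv_inv g, ← h]
      exact Or.inl (inv_mem (x5_mem i))
  refine sub_mem_rightSpan (Kpr5 K) (Kell K) (Kpr5_Kell K) (Kpr5_uP K)
    (adjoin_of_eq_top K closure_x12_x23_x5) ?_ ?_ a
  · rintro _ ⟨g, hg, rfl⟩ i
    rcases hgen g hg with hg | ⟨hg, -⟩
    · have : MonoidAlgebra.of K P5 g * uP K i = (MonoidAlgebra.of K P5 g - 1) * uP K i +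
          uP K i * 1 := by noncomm_ring
      rw [this]
      exact add_mem (mul_mem_rightSpan_of_mem (of_sub_one_mem_rightSpan K hg) fun _ _ => trivial)
        (mul_mem_rightSpan i trivial)
    · have : MonoidAlgebra.of K P5 g * uP K i =
          (MonoidAlgebra.of K P5 (g * x5 i * g⁻¹) - 1) * MonoidAlgebra.of K P5 g := by
        rw [sub_mul, ← map_mul, inv_mul_cancel_right, uP, mul_sub, ← map_mul, mul_one, one_mul]
      rw [this]
      exact mul_mem_rightSpan_of_mem
        (of_sub_one_mem_rightSpan K (conj_mem_subgroupX5 hg i)) fun _ _ => trivial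
  · rintro _ ⟨g, hg, rfl⟩
    rcases hgen g hg with hg | ⟨-, h, rfl⟩
    · exact ⟨1, by rw [map_one]; exact of_sub_one_mem_rightSpan K hg⟩
    · exact ⟨MonoidAlgebra.of K F2 h, by rw [Kell_of, sub_self]; exact zero_mem _⟩

theorem kappa_surjective : Function.Surjective (kappa K) := by
  refine BFSTheory.kappa_surjective _ fun x => ?_
  have := sub_Kell_mem K (KerMod.incl _ x)
  rwa [KerMod.map_incl, map_zero, sub_zero] at this

/-! #### Fox derivatives -/

/-- The anti-morphism from `F_3` to the affine transformations of `V^B ⊗ V^B`, with the linear part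
given by right multiplication, which sends `n_i` to `v ↦ v (K pr_12)(x_i5) + δ_ij`. -/
def foxAffine (j : Fin 3) : F3 →* (Equiv.Perm (VV K))ᵐᵒᵖ :=
  FreeGroup.lift fun i => MulOpposite.op
    { toFun := fun v => v * Kpr12 K (MonoidAlgebra.of K P5 (x5 i)) +
        Pi.single (M := fun _ => VV K) i 1 j
      invFun := fun v => (v - Pi.single (M := fun _ => VV K) i 1 j) *
        Kpr12 K (MonoidAlgebra.of K P5 (x5 i)⁻¹)
      left_inv := fun v => by
        dsimp only
        rw [add_sub_cancel_right, mul_assoc, ← map_mul, ← map_mul, mul_inv_cancel, map_one, map_one,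
          mul_one]
      right_inv := fun v => by
        dsimp only
        rw [mul_assoc, ← map_mul, ← map_mul, inv_mul_cancel, map_one, map_one, mul_one,
          sub_add_cancel] }

theorem foxAffine_n (i j : Fin 3) (v : VV K) : (foxAffine K j (n i)).unop v =
    v * Kpr12 K (MonoidAlgebra.of K P5 (x5 i)) + Pi.single (M := fun _ => VV K) i 1 j := by
  rw [foxAffine, n, FreeGroup.lift_apply_of]
  rfl

/-- The linear part of the affine transformation attached to `k` is the right multiplication by
`(K pr_12)(k)`. -/
theorem foxAffine_sub (j : Fin 3) (k : F3) (v w : VV K) :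
    (foxAffine K j k).unop v - (foxAffine K j k).unop w =
      (v - w) * Kpr12 K (MonoidAlgebra.of K P5 (fromF3 k)) := by
  induction k using FreeGroup.induction_on generalizing v w with
  | C1 =>
    rw [map_one fromF3, map_one (MonoidAlgebra.of K P5), map_one (Kpr12 K), mul_one, map_one]
    rfl
  | of i =>
    have e : fromF3 (FreeGroup.of i) = x5 i := fromF3_n i
    change (foxAffine K j (n i)).unop v - (foxAffine K j (n i)).unop w = _
    rw [foxAffine_n, foxAffine_n, add_sub_add_right_eq_sub, ← sub_mul, e]
  | inv_of i h =>
    have h' := h ((foxAffine K j (FreeGroup.of i)⁻¹).unop v)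
      ((foxAffine K j (FreeGroup.of i)⁻¹).unop w)
    have e : ∀ v, (foxAffine K j (FreeGroup.of i)).unop
        ((foxAffine K j (FreeGroup.of i)⁻¹).unop v) = v := fun v => by
      rw [← Equiv.Perm.mul_apply, ← MulOpposite.unop_mul, ← map_mul, inv_mul_cancel, map_one]
      rfl
    rw [e, e] at h'
    rw [h', mul_assoc, ← map_mul, ← map_mul, map_inv fromF3, mul_inv_cancel, map_one, map_one,
      mul_one]
  | mul a b ha hb =>
    rw [map_mul, MulOpposite.unop_mul, Equiv.Perm.mul_apply, Equiv.Perm.mul_apply, hb, ha,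
      map_mul fromF3, map_mul, map_mul, mul_assoc]

/-- The Fox derivative `g ↦ ∂_j g` of `P_5^*` with values in `V^B ⊗ V^B`, which vanishes on the
image of `ℓ`. -/
def foxGroup (j : Fin 3) (g : P5) : VV K :=
  (foxAffine K j (toF3F2 g).left).unop 0 * Kpr12 K (MonoidAlgebra.of K P5 (ell (pr5 g)))

/-- The rule `∂_j (x_i5 g) = δ_ij pr_12(g) + ∂_j g` for Fox derivatives, here with `x_i5` on the
left, because `ker (K pr_5)` is described as a right ideal. -/
theorem foxGroup_x5_mul (i j : Fin 3) (g : P5) : foxGroup K j (x5 i * g) =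
    Pi.single (M := fun _ => VV K) i 1 j * Kpr12 K (MonoidAlgebra.of K P5 g) + foxGroup K j g := by
  have e1 : (toF3F2 (x5 i * g)).left = n i * (toF3F2 g).left := by
    rw [map_mul, toF3F2_x5, SemidirectProduct.mul_left, SemidirectProduct.left_inl,
      SemidirectProduct.right_inl, map_one, MulAut.one_apply]
  have e2 : pr5 (x5 i * g) = pr5 g := by rw [map_mul, pr5_x5, one_mul]
  have e3 := foxAffine_sub K j (toF3F2 g).left (Pi.single (M := fun _ => VV K) i 1 j) 0
  rw [sub_zero, sub_eq_iff_eq_add] at e3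
  rw [foxGroup, e1, e2, map_mul, MulOpposite.unop_mul, Equiv.Perm.mul_apply, foxAffine_n, zero_mul,
    zero_add, e3, add_mul, mul_assoc, ← map_mul, ← map_mul, fromF3_mul_ell, foxGroup]

/-- The linear extension of the Fox derivative to `K P_5^*`. -/
def fox (j : Fin 3) : KP5 K →ₗ[K] VV K :=
  (Finsupp.lsum K fun g => LinearMap.toSpanSingleton K (VV K) (foxGroup K j g)).comp
    (MonoidAlgebra.coeffLinearEquiv K).toLinearMap

theorem fox_of (j : Fin 3) (g : P5) : fox K j (MonoidAlgebra.of K P5 g) = foxGroup K j g := by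
  simp [fox]

theorem fox_uP_mul (i j : Fin 3) (a : KP5 K) :
    fox K j (uP K i * a) = Pi.single (M := fun _ => VV K) i 1 j * Kpr12 K a := by
  induction a using MonoidAlgebra.induction_on with
  | of g =>
    rw [uP, sub_mul, one_mul, ← map_mul, map_sub, fox_of, fox_of, foxGroup_x5_mul,
      add_sub_cancel_right]
  | add a b h h' => rw [mul_add, map_add, map_add, h, h', mul_add]
  | smul r a h => rw [mul_smul_comm, map_smul, map_smul, h, mul_smul_comm]

/-- On `ker (K pr_5)`, the Fox derivatives are right linear over `K P_5^*`, hence define functions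
on `M^B`. -/
theorem fox_mul (j : Fin 3) (x : KerMod (Kpr5 K)) (a : KP5 K) :
    fox K j (KerMod.incl _ x * a) = fox K j (KerMod.incl _ x) * Kpr12 K a := by
  have hx := sub_Kell_mem K (KerMod.incl _ x)
  rw [KerMod.map_incl, map_zero, sub_zero] at hx
  obtain ⟨b, -, hb⟩ := mem_rightSpan.1 hx
  rw [← hb, Finset.sum_mul, map_sum, map_sum, Finset.sum_mul]
  refine Finset.sum_congr rfl fun i _ => ?_
  rw [mul_assoc, fox_uP_mul, fox_uP_mul, map_mul, mul_assoc]

/-- The `j`-th coordinate function of `M^B` in the basis `(x_i5 - 1) ⊗ 1`. -/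
def coord (j : Fin 3) : KerTensor (Kpr5 K) (Kpr12 K) →ₗ[K] VV K :=
  (kerTensorRel (Kpr5 K) (Kpr12 K)).liftQ
    (TensorProduct.lift ((LinearMap.mul K (VV K)).comp ((fox K j).comp (KerMod.incl (Kpr5 K)))))
    (Submodule.span_le.2 (by
      rintro _ ⟨x, a, w, rfl⟩
      rw [SetLike.mem_coe, LinearMap.mem_ker, map_sub, TensorProduct.lift.tmul,
        TensorProduct.lift.tmul, sub_eq_zero]
      change fox K j (KerMod.incl _ x * a) * w = fox K j (KerMod.incl _ x) * (Kpr12 K a * w)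
      rw [fox_mul, mul_assoc]))

theorem coord_tmul (j : Fin 3) (x : KerMod (Kpr5 K)) (w : VV K) :
    coord K j (KerTensor.tmul _ _ x w) = fox K j (KerMod.incl _ x) * w := rfl

theorem coord_kappa (j : Fin 3) (a : Fin 3 → VV K) : coord K j (kappa K a) = a j := by
  change coord K j (∑ i, KerTensor.tmul _ _ (u K i) (a i)) = a j
  rw [map_sum]
  simp only [coord_tmul, incl_u]
  have : ∀ i, fox K j (uP K i) = Pi.single (M := fun _ => VV K) i 1 j := fun i => by
    have := fox_uP_mul K i j 1
    rwa [mul_one, map_one, mul_one] at this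
  rw [Finset.sum_eq_single j (fun i _ h => by rw [this, Pi.single_eq_of_ne h.symm, zero_mul])
    (fun h => absurd (Finset.mem_univ j) h), this, Pi.single_eq_same, one_mul]

theorem kappa_bijective : Function.Bijective (kappa K) :=
  ⟨fun a b h => funext fun j => by rw [← coord_kappa K j a, h, coord_kappa], kappa_surjective K⟩

end Betti

end

end BFSTheory

namespace BFSTheory

noncomputable section

namespace Betti

open Pair

variable (K : Type u) [CommRing K]

/-! ### The filtration of the kernel -/

section Strict

theorem augFil_of_nonpos {G : Type} [Group G] {n : ℤ} (hn : n ≤ 0) : augFil K G n = ⊤ :=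
  powFil_of_nonpos _ hn

/-- The sums `∑ i, (x_i5 - 1) a_i` with `a_i ∈ F^n (K P_5^*)`. -/
def rightFil (n : ℤ) : Submodule K (KP5 K) := rightSpan (uP K) (augFil K P5 n)

variable {K}

theorem rightFil_of_nonpos {n : ℤ} (hn : n ≤ 0) : rightFil K n = rightSpan (uP K) ⊤ := by
  rw [rightFil, augFil_of_nonpos K hn]

theorem mul_mem_rightFil {i j n : ℤ} (hn : i + j = n) {a b : KP5 K} (ha : a ∈ rightFil K i)
    (hb : b ∈ augFil K P5 j) : a * b ∈ rightFil K n :=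
  hn ▸ mul_mem_rightSpan_of_mem ha fun a ha => IsAlgFiltration.mul_mem i j a ha b hb

theorem mul_mem_rightFil_right {i : ℤ} {a : KP5 K} (ha : a ∈ rightFil K i) (b : KP5 K) :
    a * b ∈ rightFil K i :=
  mul_mem_rightFil (add_zero i) ha (b := b) (by rw [augFil_of_nonpos K le_rfl]; trivial)

theorem sub_one_mem_rightFil {g : P5} (hg : g ∈ subgroupX5) :
    MonoidAlgebra.of K P5 g - 1 ∈ rightFil K 0 := by
  rw [rightFil_of_nonpos le_rfl]
  exact of_sub_one_mem_rightSpan K hg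

theorem sub_one_mul_sub_one_mem {g : P5} (hg : g ∈ subgroupX5) (h : P5) :
    (MonoidAlgebra.of K P5 g - 1) * (MonoidAlgebra.of K P5 h - 1) ∈ rightFil K 1 :=
  mul_mem_rightFil (zero_add 1) (sub_one_mem_rightFil hg) (of_sub_one_mem_augFil K h)

/-- The group generated by the `x_i5` acts trivially on its abelianization: a conjugate of `x_i5`
differs from `x_i5` by a sum `∑ j, (x_j5 - 1) a_j` with all `a_j` in the augmentation ideal. -/
theorem conj_sub_mem {z : P5} (hz : z ∈ subgroupX5) (i : Fin 3) :
    MonoidAlgebra.of K P5 (z⁻¹ * x5 i * z) - MonoidAlgebra.of K P5 (x5 i) ∈ rightFil K 1 := by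
  set a := MonoidAlgebra.of K P5 (x5 i)
  set b := MonoidAlgebra.of K P5 z
  set b' := MonoidAlgebra.of K P5 z⁻¹
  have hb : b' * b = 1 := by rw [← map_mul, inv_mul_cancel, map_one]
  have h1 : (a - 1) * (b - 1) - (b - 1) * (a - 1) ∈ rightFil K 1 :=
    sub_mem (sub_one_mul_sub_one_mem (x5_mem i) _) (sub_one_mul_sub_one_mem hz _)
  have h2 : (b' - 1) * ((a - 1) * (b - 1) - (b - 1) * (a - 1)) ∈ rightFil K 1 := by
    refine mul_mem_rightFil (zero_add 1) (sub_one_mem_rightFil (inv_mem hz)) ?_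
    have hab := augIdeal_mul_mem_left K (a - 1) (b - 1) (of_sub_one_mem K z)
    have hba := augIdeal_mul_mem_left K (b - 1) (a - 1) (of_sub_one_mem K (x5 i))
    rw [augFil, powFil_one]
    exact sub_mem hab hba
  have : MonoidAlgebra.of K P5 (z⁻¹ * x5 i * z) - a =
      (a - 1) * (b - 1) - (b - 1) * (a - 1) +
        (b' - 1) * ((a - 1) * (b - 1) - (b - 1) * (a - 1)) := by
    have e : b' * a * b - a = b' * a * b - b' * b * a := by rw [hb, one_mul]
    rw [map_mul, map_mul]
    change b' * a * b - a = _
    rw [e]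
    noncomm_ring
  rw [this]
  exact add_mem h1 h2

/-- Left multiplication by `h - 1`, for `h` a generator of `ℓ(F_2)`, raises the degree of the
coefficients of the `x_i5 - 1` by one. -/
theorem sub_one_mul_uP_mem {h : P5} (hh : h = x p12 ∨ h = (x p12)⁻¹ ∨ h = x p23 ∨ h = (x p23)⁻¹)
    (i : Fin 3) : (MonoidAlgebra.of K P5 h - 1) * uP K i ∈ rightFil K 1 := by
  obtain ⟨z, hz, e⟩ := conj_x5 h hh i
  have e' : MonoidAlgebra.of K P5 h * MonoidAlgebra.of K P5 (x5 i) =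
      MonoidAlgebra.of K P5 (z⁻¹ * x5 i * z) * MonoidAlgebra.of K P5 h := by
    rw [← map_mul, ← map_mul, ← e, inv_mul_cancel_right]
  have : (MonoidAlgebra.of K P5 h - 1) * uP K i =
      (MonoidAlgebra.of K P5 (z⁻¹ * x5 i * z) - 1) * (MonoidAlgebra.of K P5 h - 1) +
        (MonoidAlgebra.of K P5 (z⁻¹ * x5 i * z) - MonoidAlgebra.of K P5 (x5 i)) := by
    rw [uP, mul_sub, sub_mul, e']
    noncomm_ring
  rw [this]
  exact add_mem (sub_one_mul_sub_one_mem (mul_mem (mul_mem (inv_mem hz) (x5_mem i)) hz) _)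
    (conj_sub_mem hz i)

theorem mul_mem_rightFil_one {b : KP5 K} (hb : ∀ i, (b - 1) * uP K i ∈ rightFil K 1)
    {a : KP5 K} (ha : a ∈ rightFil K 1) : b * a ∈ rightFil K 1 := by
  have : rightFil K 1 ≤ (rightFil K 1).comap (LinearMap.mulLeft K b) :=
    rightSpan_le fun i c hc => by
      have e : b * (uP K i * c) = (b - 1) * uP K i * c + uP K i * c := by noncomm_ring
      rw [Submodule.mem_comap, LinearMap.mulLeft_apply, e]
      exact add_mem (mul_mem_rightFil_right (hb i) c) (mul_mem_rightSpan i hc)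
  exact this ha

/-- The group `ℓ(F_2)` acts trivially on the abelianization of the group generated by the `x_i5`. -/
theorem ell_sub_one_mul_uP_mem (g : F2) (i : Fin 3) :
    (MonoidAlgebra.of K P5 (ell g) - 1) * uP K i ∈ rightFil K 1 := by
  have e12 : ell (FreeGroup.of 1) = x p12 := FreeGroup.lift_apply_of
  have e23 : ell (FreeGroup.of 0) = x p23 := FreeGroup.lift_apply_of
  induction g using FreeGroup.induction_on generalizing i with
  | C1 => rw [map_one, map_one, sub_self, zero_mul]; exact zero_mem _
  | of j =>
    fin_cases j
    · exact sub_one_mul_uP_mem (Or.inr (Or.inr (Or.inl e23))) i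
    · exact sub_one_mul_uP_mem (Or.inl e12) i
  | inv_of j =>
    fin_cases j
    · exact sub_one_mul_uP_mem
        (Or.inr (Or.inr (Or.inr ((map_inv ell _).trans (congrArg _ e23))))) i
    · exact sub_one_mul_uP_mem (Or.inr (Or.inl ((map_inv ell _).trans (congrArg _ e12)))) i
  | mul a b ha hb =>
    have : (MonoidAlgebra.of K P5 (ell (a * b)) - 1) * uP K i =
        MonoidAlgebra.of K P5 (ell a) * ((MonoidAlgebra.of K P5 (ell b) - 1) * uP K i) +
          (MonoidAlgebra.of K P5 (ell a) - 1) * uP K i := by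
      rw [map_mul, map_mul]; noncomm_ring
    rw [this]
    exact add_mem (mul_mem_rightFil_one ha (hb i)) (ha i)

theorem Kell_mul_uP_mem {v : V K} (hv : v ∈ augFil K F2 1) (i : Fin 3) :
    Kell K v * uP K i ∈ rightFil K 1 := by
  rw [augFil, powFil_one] at hv
  have : augIdeal K F2 ≤ (rightFil K 1).comap
      ((LinearMap.mulRight K (uP K i)).comp (Kell K).toLinearMap) := by
    refine Submodule.span_le.2 ?_
    rintro _ ⟨g, rfl⟩
    have := ell_sub_one_mul_uP_mem (K := K) g i
    rw [← Kell_of, ← map_one (Kell K), ← map_sub] at this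
    exact this
  exact this hv

theorem Kell_mul_mem_rightFil {v : V K} (hv : v ∈ augFil K F2 1) {n : ℤ} {a : KP5 K}
    (ha : a ∈ rightFil K n) : Kell K v * a ∈ rightFil K (n + 1) := by
  have : rightFil K n ≤ (rightFil K (n + 1)).comap (LinearMap.mulLeft K (Kell K v)) :=
    rightSpan_le fun i c hc => by
      rw [Submodule.mem_comap, LinearMap.mulLeft_apply, ← mul_assoc]
      exact mul_mem_rightFil (add_comm 1 n) (Kell_mul_uP_mem hv i) hc
  exact this ha

theorem Kpr5_mem (n : ℤ) (a : KP5 K) (ha : a ∈ augFil K P5 n) : Kpr5 K a ∈ augFil K F2 n :=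
  map_augFil_le K (F := augFil K F2) (fun _ hn => powFil_of_nonpos _ hn) (Kpr5 K)
    (fun g => by rw [Kpr5_of]; exact of_sub_one_mem_augFil K _) n a ha

/-- The filtration of `K P_5^*` is the product of those of the group algebras of `F_3` and `F_2`:
modulo the image of `ℓ`, an element of `F^n` is a sum `∑ i, (x_i5 - 1) a_i` with
`a_i ∈ F^{n-1}`. -/
theorem sub_Kell_mem_rightFil (n : ℤ) (a : KP5 K) (ha : a ∈ augFil K P5 n) :
    a - Kell K (Kpr5 K a) ∈ rightFil K (n - 1) := by
  rcases le_or_gt n 0 with hn | hn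
  · rw [rightFil_of_nonpos (by omega)]
    exact sub_Kell_mem K a
  obtain ⟨m, rfl⟩ : ∃ m : ℕ, n = (m + 1 : ℕ) := ⟨(n - 1).toNat, by omega⟩
  clear hn
  induction m generalizing a with
  | zero =>
    rw [rightFil_of_nonpos (by omega)]
    exact sub_Kell_mem K a
  | succ m ih =>
    rw [augFil, powFil_succ, pow_succ'] at ha
    have e : ((m + 1 + 1 : ℕ) : ℤ) - 1 = ((m + 1 : ℕ) : ℤ) := by push_cast; ring
    rw [e]
    induction ha using Submodule.mul_induction_on' with
    | add x _ y _ hx hy => rw [map_add, map_add, add_sub_add_comm]; exact add_mem hx hy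
    | mem_mul_mem x hx y hy =>
      rw [← powFil_one (augIdeal K P5)] at hx
      rw [← powFil_succ] at hy
      have : x * y - Kell K (Kpr5 K (x * y)) = (x - Kell K (Kpr5 K x)) * y +
          Kell K (Kpr5 K x) * (y - Kell K (Kpr5 K y)) := by
        rw [map_mul, map_mul]; noncomm_ring
      rw [this]
      refine add_mem ?_ ?_
      · have h0 : x - Kell K (Kpr5 K x) ∈ rightFil K 0 := by
          rw [rightFil_of_nonpos le_rfl]; exact sub_Kell_mem K x
        exact mul_mem_rightFil (zero_add _) h0 hy
      · have := Kell_mul_mem_rightFil (Kpr5_mem 1 x hx) (ih y hy)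
        rwa [sub_add_cancel] at this

/-- In the coordinates given by `κ`, the filtration of `M^B` is that of `(V^B ⊗ V^B)^3`, shifted
by one. -/
theorem coord_mem {n : ℤ} {m : KerTensor (Kpr5 K) (Kpr12 K)}
    (hm : m ∈ KerTensor.fil (Kpr5 K) (Kpr12 K) (augFil K P5) n) (j : Fin 3) :
    coord K j m ∈ filVV K (n - 1) := by
  obtain ⟨x, hx, rfl⟩ := hm
  have h := sub_Kell_mem_rightFil n _ hx
  rw [KerMod.map_incl, map_zero, sub_zero] at h
  obtain ⟨a, ha, e⟩ := mem_rightSpan.1 h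
  rw [LinearMap.flip_apply, tmul_eq_kappa (Kpr12 K) (u K) x a e 1]
  change coord K j (kappa K _) ∈ _
  rw [coord_kappa, mul_one, ← map_Kpr12]
  exact ⟨a j, ha j, rfl⟩

/-- The converse of `coord_mem`: `κ` maps families in `F^{n-1}` to `F^n`. -/
theorem kappa_mem {n : ℤ} {a : Fin 3 → VV K} (ha : ∀ i, a i ∈ filVV K (n - 1)) :
    kappa K a ∈ KerTensor.fil (Kpr5 K) (Kpr12 K) (augFil K P5) n := by
  change ∑ i, KerTensor.tmul _ _ (u K i) (a i) ∈ KerTensor.fil (Kpr5 K) (Kpr12 K) _ n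
  refine sum_mem fun i _ => ?_
  have h := ha i
  rw [← map_Kpr12] at h
  obtain ⟨b, hb, e⟩ := h
  refine ⟨KerMod.mulRight _ b (u K i), ?_, ?_⟩
  · have := IsAlgFiltration.mul_mem (F := augFil K P5) 1 (n - 1) (uP K i)
      (of_sub_one_mem_augFil K _) b hb
    rw [add_sub_cancel] at this
    exact this
  · rw [LinearMap.flip_apply, KerTensor.tmul_mul, mul_one, ← e]
    rfl

end Strict

end Betti

end

end BFSTheory

namespace BFSTheory

noncomputable section

open MulOpposite

namespace Betti

open Pair

variable (K : Type u) [CommRing K]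

/-! ### The factorization structure on the Betti side -/

section Factorization

theorem Kpr12_x12 : Kpr12 K (MonoidAlgebra.of K P5 (x p12)) = 1 := by
  rw [Kpr12_of, pr1_x, pr2_x, pr1Fun, pr2Fun, map_one]
  rfl

theorem pr1_x5 (i : Fin 3) : pr1 (x5 i) = ![1, X 1, (X 0 * X 1)⁻¹] i := by
  fin_cases i <;> simp [x5, pr1_x, pr1Fun]

theorem pr2_x5 (i : Fin 3) : pr2 (x5 i) = ![X 1, 1, (X 1)⁻¹ * (X 0 * X 1)] i := by
  fin_cases i <;> simp [x5, pr2_x, pr2Fun]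

theorem Kpr12_x15 : Kpr12 K (MonoidAlgebra.of K P5 (x5 0)) = Y1 K := by
  rw [Kpr12_of, pr1_x5, pr2_x5]
  change MonoidAlgebra.of K F2 1 ⊗ₜ _ = _
  rw [map_one]
  rfl

theorem Kpr12_x25 : Kpr12 K (MonoidAlgebra.of K P5 (x5 1)) = X1 K := by
  rw [Kpr12_of, pr1_x5, pr2_x5]
  change _ ⊗ₜ MonoidAlgebra.of K F2 1 = _
  rw [map_one]
  rfl

theorem Y1inv_mul_Y1 : Y1inv K * Y1 K = 1 := by
  rw [Y1inv, Y1, Algebra.TensorProduct.tmul_mul_tmul, ← map_mul, inv_mul_cancel, map_one, one_mul]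
  rfl

theorem X1_mul_Y1 : X1 K * Y1 K = Y1 K * X1 K := by
  rw [X1, Y1, Algebra.TensorProduct.tmul_mul_tmul, Algebra.TensorProduct.tmul_mul_tmul, one_mul,
    mul_one]

/-- The coefficients `a_ij` in `(x_12 - 1) (x_i5 - 1) = ∑ j, (x_j5 - 1) a_ij`. -/
def leftCoeff : Fin 3 → Fin 3 → KP5 K :=
  let a := MonoidAlgebra.of K P5 (x p12)
  let n := MonoidAlgebra.of K P5 (x5 1)
  let c := MonoidAlgebra.of K P5 ((x5 1)⁻¹ * x5 0 * x5 1)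
  ![![n * a - 1, (1 - c) * a, 0], ![n * a - n * a * n, a - 1 - (1 - c) * a * n, 0], ![0, 0, a - 1]]

/-- The entries come from the conjugation rules of `x_12`: `x_12 x_15 x_12⁻¹ = x_25⁻¹ x_15 x_25`,
and `x_12` commutes with `x_15 x_25` and with `x_35`. -/
theorem sub_one_mul_uP (i : Fin 3) :
    (MonoidAlgebra.of K P5 (x p12) - 1) * uP K i = ∑ j, uP K j * leftCoeff K i j := by
  have h0 : MonoidAlgebra.of K P5 (x p12) * uP K 0 =
      uP K 0 * (MonoidAlgebra.of K P5 (x5 1) * MonoidAlgebra.of K P5 (x p12)) +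
        uP K 1 * ((1 - MonoidAlgebra.of K P5 ((x5 1)⁻¹ * x5 0 * x5 1)) *
          MonoidAlgebra.of K P5 (x p12)) := by
    have e : x p12 * x5 0 = (x5 1)⁻¹ * x5 0 * x5 1 * x p12 := by
      have := conj_of_commute (commute_x15_mul_x25_mul_x12 0 (by decide))
      rw [mul_inv_eq_iff_eq_mul] at this
      rw [this]; group
    have e1 : uP K 0 * MonoidAlgebra.of K P5 (x5 1) + uP K 1 *
        (1 - MonoidAlgebra.of K P5 ((x5 1)⁻¹ * x5 0 * x5 1)) =
        MonoidAlgebra.of K P5 ((x5 1)⁻¹ * x5 0 * x5 1) - 1 := by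
      have : MonoidAlgebra.of K P5 (x5 1) * MonoidAlgebra.of K P5 ((x5 1)⁻¹ * x5 0 * x5 1) =
          MonoidAlgebra.of K P5 (x5 0) * MonoidAlgebra.of K P5 (x5 1) := by
        rw [← map_mul, ← map_mul]; congr 1; group
      rw [uP, uP, sub_mul, sub_mul, mul_sub, mul_sub, this]
      noncomm_ring
    calc _ = (MonoidAlgebra.of K P5 ((x5 1)⁻¹ * x5 0 * x5 1) - 1) *
        MonoidAlgebra.of K P5 (x p12) := by
          rw [uP, mul_sub, ← map_mul, e, map_mul _ _ (x p12)]; noncomm_ring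
      _ = _ := by rw [← e1]; noncomm_ring
  have h1 : MonoidAlgebra.of K P5 (x p12) * (uP K 0 * MonoidAlgebra.of K P5 (x5 1) + uP K 1) =
      (uP K 0 * MonoidAlgebra.of K P5 (x5 1) + uP K 1) * MonoidAlgebra.of K P5 (x p12) := by
    have e : uP K 0 * MonoidAlgebra.of K P5 (x5 1) + uP K 1 =
        MonoidAlgebra.of K P5 (x5 0 * x5 1) - 1 := by
      rw [uP, uP, map_mul]; noncomm_ring
    rw [e, mul_sub, sub_mul, ← map_mul, ← map_mul, commute_x12_x15_mul_x25.eq]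
    noncomm_ring
  have h2 : MonoidAlgebra.of K P5 (x p12) * uP K 2 = uP K 2 * MonoidAlgebra.of K P5 (x p12) := by
    rw [uP, mul_sub, sub_mul, ← map_mul, ← map_mul, commute_x12_x35.eq]
    noncomm_ring
  rw [Fin.sum_univ_three]
  fin_cases i
  · change _ * uP K 0 = uP K 0 * (_ * _ - 1) + uP K 1 * ((1 - _) * _) + uP K 2 * 0
    rw [sub_mul, h0]
    noncomm_ring
  · change _ * uP K 1 = uP K 0 * (_ * _ - _ * _ * _) + uP K 1 * (_ - 1 - (1 - _) * _ * _) +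
      uP K 2 * 0
    have h1' : MonoidAlgebra.of K P5 (x p12) * uP K 1 =
        (uP K 0 * MonoidAlgebra.of K P5 (x5 1) + uP K 1) * MonoidAlgebra.of K P5 (x p12) -
          (MonoidAlgebra.of K P5 (x p12) * uP K 0) * MonoidAlgebra.of K P5 (x5 1) := by
      rw [← h1]; noncomm_ring
    rw [sub_mul, h1', h0]
    noncomm_ring
  · change _ * uP K 2 = uP K 0 * 0 + uP K 1 * 0 + uP K 2 * (_ - 1)
    rw [sub_mul, h2]
    noncomm_ring

theorem col_mul_row_aux {R : Type u} [Ring R] {X Y Y' : R} (hY : Y' * Y = 1)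
    (hXY : X * Y = Y * X) : Y' * (X - 1) * Y = X - 1 ∧ Y' * (1 - Y) * Y = 1 - Y ∧
      Y' * (X - 1) * (-X * Y) = X - X * X ∧ Y' * (1 - Y) * (-X * Y) = 0 - (1 - Y) * X := by
  have key : ∀ w, w * Y = Y * w → Y' * w * Y = w := fun w hw => by
    rw [mul_assoc, hw, ← mul_assoc, hY, one_mul]
  have e1 := key (X - 1) (by rw [sub_mul, mul_sub, hXY, one_mul, mul_one])
  have e2 := key (1 - Y) (by rw [sub_mul, mul_sub, one_mul, mul_one])
  refine ⟨e1, e2, ?_, ?_⟩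
  · rw [neg_mul, hXY, mul_neg, ← mul_assoc, e1]; noncomm_ring
  · rw [neg_mul, hXY, mul_neg, ← mul_assoc, e2]; noncomm_ring

/-- The matrix of the left multiplication by `x_12 - 1` has rank one after projection by `pr_12`;
this is the source of the factorization `ρ(e) = c ∘ r`. -/
theorem Kpr12_leftCoeff (i j : Fin 3) : Kpr12 K (leftCoeff K i j) = col K j * row K i := by
  have hc : Kpr12 K (MonoidAlgebra.of K P5 (x5 1)⁻¹) * Kpr12 K (MonoidAlgebra.of K P5 (x5 0)) *
      X1 K = Y1 K := by
    have e : Kpr12 K (MonoidAlgebra.of K P5 (x5 1)⁻¹) * X1 K = 1 := by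
      rw [← Kpr12_x25, ← map_mul, ← map_mul, inv_mul_cancel, map_one, map_one]
    rw [Kpr12_x15, mul_assoc, ← X1_mul_Y1, ← mul_assoc, e, one_mul]
  obtain ⟨e1, e2, e3, e4⟩ := col_mul_row_aux (Y1inv_mul_Y1 K) (X1_mul_Y1 K)
  fin_cases i <;> fin_cases j <;>
    simp only [leftCoeff, col, row, Matrix.cons_val_zero, Matrix.cons_val_one, Matrix.cons_val,
      Fin.zero_eta, Fin.mk_one, Fin.reduceFinMk, map_sub, map_mul, map_zero, map_one, hc,
      Kpr12_x12, Kpr12_x25, mul_zero, zero_mul, sub_self, mul_one]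
  exacts [e1.symm, e2.symm, e3.symm, e4.symm]

theorem actL_e_tmul (i : Fin 3) (w : VV K) :
    KerTensor.actL (Kpr5 K) (Kpr12 K) (Kell K (e K 1)) (KerTensor.tmul _ _ (u K i) w) =
      kappa K (colMap (col K) (row K i * w)) := by
  have he : Kell K (e K 1) = MonoidAlgebra.of K P5 (x p12) - 1 := by
    rw [e, map_sub, map_one, Kell_of]
    congr 2
  rw [KerTensor.actL_tmul, tmul_eq_kappa (Kpr12 K) (u K) _ (leftCoeff K i) ?_ w]
  · refine congrArg (kappa K) (funext fun j => ?_)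
    rw [Kpr12_leftCoeff, mul_assoc]
    rfl
  · rw [he]
    exact (sub_one_mul_uP K i).symm

/-- In the coordinates given by `κ_B`, the left action of `e = X_1 - 1` is the multiplication by the
matrix `col * row`. -/
theorem actL_e_kappa (a : Fin 3 → VV K) :
    KerTensor.actL (Kpr5 K) (Kpr12 K) (Kell K (e K 1)) (kappa K a) =
      kappa K (colMap (col K) (rowMap (row K) a)) := by
  change KerTensor.actL (Kpr5 K) (Kpr12 K) (Kell K (e K 1))
    (∑ i, KerTensor.tmul _ _ (u K i) (a i)) = kappa K (colMap (col K) (∑ i, row K i * a i))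
  rw [map_sum, map_sum, map_sum]
  exact Finset.sum_congr rfl fun i _ => actL_e_tmul K i (a i)

theorem col_mem (j : Fin 3) : col K j ∈ filVV K 1 := by
  have hY : Y1inv K ∈ filVV K 0 := by rw [filVV_of_nonpos K 0 le_rfl]; trivial
  have h1 : X1 K - 1 ∈ filVV K 1 := by
    have := e_tmul_mem K 1
    rwa [e, TensorProduct.sub_tmul] at this
  have h2 : 1 - Y1 K ∈ filVV K 1 := by
    have := neg_mem (tmul_e_mem K 1)
    rwa [e, TensorProduct.tmul_sub, neg_sub] at this
  have key : ∀ w ∈ filVV K 1, Y1inv K * w ∈ filVV K 1 := fun w hw => by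
    have := IsAlgFiltration.mul_mem (F := filVV K) 0 1 _ hY _ hw
    rwa [zero_add] at this
  fin_cases j
  · exact key _ h1
  · exact key _ h2
  · exact Submodule.zero_mem _

theorem row_mem (j : Fin 3) : row K j ∈ filVV K 0 := by
  rw [filVV_of_nonpos K 0 le_rfl]; trivial

/-- `κ` as an isomorphism of right modules. -/
def kappaEquiv : (Fin 3 → VV K) ≃ₗ[(VV K)ᵐᵒᵖ] KerTensor (Kpr5 K) (Kpr12 K) :=
  LinearEquiv.ofBijective (kappa K) (kappa_bijective K)

theorem kappaEquiv_symm_apply (m : KerTensor (Kpr5 K) (Kpr12 K)) (j : Fin 3) :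
    (kappaEquiv K).symm m j = coord K j m := by
  obtain ⟨a, rfl⟩ := (kappa_bijective K).2 m
  rw [coord_kappa]
  exact congrFun ((kappaEquiv K).symm_apply_apply a) j

/-- The morphism `r` of `O^B_fil`: the row, applied to the coordinates given by `κ_B`. -/
def factR : KerTensor (Kpr5 K) (Kpr12 K) →ₗ[(VV K)ᵐᵒᵖ] VV K :=
  rowMap (row K) ∘ₗ (kappaEquiv K).symm.toLinearMap

/-- The morphism `c` of `O^B_fil`: the column, seen in `M^B` through `κ_B`. -/
def factC : VV K →ₗ[(VV K)ᵐᵒᵖ] KerTensor (Kpr5 K) (Kpr12 K) := kappa K ∘ₗ colMap (col K)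

theorem factR_kappa (a : Fin 3 → VV K) : factR K (kappa K a) = rowMap (row K) a :=
  congrArg (rowMap (row K)) ((kappaEquiv K).symm_apply_apply a)

theorem factR_mem {n : ℤ} {m : KerTensor (Kpr5 K) (Kpr12 K)}
    (hm : m ∈ KerTensor.fil (Kpr5 K) (Kpr12 K) (augFil K P5) (n + 1)) :
    factR K m ∈ filVV K n := by
  change ∑ i, row K i * (kappaEquiv K).symm m i ∈ filVV K n
  refine sum_mem fun i _ => ?_
  have h1 := coord_mem hm i
  rw [← kappaEquiv_symm_apply, add_sub_cancel_right] at h1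
  have := IsAlgFiltration.mul_mem (F := filVV K) 0 n _ (row_mem K i) _ h1
  rwa [zero_add] at this

theorem factC_mem {n : ℤ} {a : VV K} (ha : a ∈ filVV K n) :
    factC K a ∈ KerTensor.fil (Kpr5 K) (Kpr12 K) (augFil K P5) (n + 1 + 1) := by
  refine kappa_mem fun i => ?_
  have := IsAlgFiltration.mul_mem (F := filVV K) 1 n _ (col_mem K i) _ ha
  rw [add_sub_cancel_right]
  rwa [add_comm 1 n] at this

/-- The factorization structure of `O^B_fil`. -/
def factorization : FilFactorization (bimodule K 1) where
  e := e K 1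
  r := factR K
  c := factC K
  ρ_e := LinearMap.ext fun m => by
    obtain ⟨a, rfl⟩ := (kappa_bijective K).2 m
    exact (actL_e_kappa K a).trans (congrArg (factC K) (factR_kappa K a).symm)
  e_mem := e_mem K 1
  r_mem n m hm := factR_mem K hm
  c_mem n a ha := factC_mem K ha

theorem isFactorization_factorization : IsFactorization K (factorization K) :=
  ⟨rfl, LinearMap.ext (f := factR K ∘ₗ kappa K) (factR_kappa K), rfl⟩

variable {K} in
theorem IsFactorization.r_kappa {S : FilFactorization (bimodule K 1)} (hS : IsFactorization K S)
    (a : Fin 3 → VV K) : S.r (kappa K a) = rowMap (row K) a :=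
  congrArg (fun f : (Fin 3 → VV K) →ₗ[(VV K)ᵐᵒᵖ] VV K => f a) hS.2.1

theorem existsUnique_factorization :
    ∃! S : FilFactorization (bimodule K 1), IsFactorization K S := by
  refine ⟨factorization K, isFactorization_factorization K, fun S hS => ?_⟩
  refine FilFactorization.ext hS.1 ?_ hS.2.2
  refine LinearMap.ext fun m => ?_
  obtain ⟨a, rfl⟩ := (kappa_bijective K).2 m
  exact (hS.r_kappa a).trans (factR_kappa K a).symm

end Factorization

end Betti

end

end BFSTheory

namespace BFSTheory

noncomputable section

open MulOpposite

namespace DeRham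

open Pair

attribute [local instance] LieRing.ofAssociativeRing

variable (K : Type u) [CommRing K]

/-! ### The enveloping algebra of `p_5` -/

/-- The generator `t_ij` of `U(p_5)`. -/
def tU (i : Pair) : Up5 K := UniversalEnvelopingAlgebra.ι K (t K i)

/-- The element `t_i5` of `U(p_5)`. -/
def uU (i : Fin 3) : Up5 K := UniversalEnvelopingAlgebra.ι K (t5 K i)

theorem incl_u (i : Fin 3) : KerMod.incl (Upr5 K) (u K i) = uU K i := rfl

theorem commute_of_lie_eq_zero {a b : p5 K} (h : ⁅a, b⁆ = 0) :
    Commute (UniversalEnvelopingAlgebra.ι K a) (UniversalEnvelopingAlgebra.ι K b) := by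
  have : ⁅UniversalEnvelopingAlgebra.ι K a, UniversalEnvelopingAlgebra.ι K b⁆ = 0 := by
    rw [← LieHom.map_lie, h, map_zero]
  rwa [LieRing.of_associative_ring_bracket, sub_eq_zero] at this

theorem commute_of_rel {i j : Pair} (h : ⁅s K i, s K j⁆ ∈ relst4 K) :
    Commute (tU K i) (tU K j) := by
  refine commute_of_lie_eq_zero K ?_
  have := p5mk_eq_zero h
  rwa [LieHom.map_lie] at this

theorem commute_add_of_rel {i j k : Pair} (h : ⁅s K i, s K j + s K k⁆ ∈ relst4 K) :
    Commute (tU K i) (tU K j + tU K k) := by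
  have h' := p5mk_eq_zero h
  rw [LieHom.map_lie, map_add] at h'
  have := commute_of_lie_eq_zero K h'
  rwa [map_add] at this

theorem uU_zero : uU K 0 = -(tU K p12 + (tU K p13 + tU K p14)) := by
  change UniversalEnvelopingAlgebra.ι K (-t K p12 - t K p13 - t K p14) = _
  rw [map_sub, map_sub, map_neg, tU, tU, tU]; abel

theorem uU_one : uU K 1 = -(tU K p12 + tU K p23 + tU K p24) := by
  change UniversalEnvelopingAlgebra.ι K (-t K p12 - t K p23 - t K p24) = _
  rw [map_sub, map_sub, map_neg, tU, tU, tU]; abel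

theorem uU_two : uU K 2 = -(tU K p13 + tU K p23 + tU K p34) := by
  change UniversalEnvelopingAlgebra.ι K (-t K p13 - t K p23 - t K p34) = _
  rw [map_sub, map_sub, map_neg, tU, tU, tU]; abel

theorem sum_tU : tU K p12 + tU K p13 + tU K p23 + tU K p14 + tU K p24 + tU K p34 = 0 := by
  have := congrArg (UniversalEnvelopingAlgebra.ι K) (sum_t (K := K))
  simp only [map_add, map_zero] at this
  exact this

theorem tU_34 : tU K p34 = tU K p12 + uU K 0 + uU K 1 := by
  rw [← sub_eq_zero, uU_zero, uU_one, ← sum_tU K]; abel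

theorem tU_14 : tU K p14 = tU K p23 + uU K 1 + uU K 2 := by
  rw [← sub_eq_zero, uU_one, uU_two, ← sum_tU K]; abel

theorem commute_12_34 : Commute (tU K p12) (tU K p34) := commute_of_rel K (Or.inr (Or.inl rfl))

theorem commute_14_23 : Commute (tU K p14) (tU K p23) :=
  commute_of_rel K (Or.inr (Or.inr (Or.inr rfl)))

theorem commute_34_15 : Commute (tU K p34) (uU K 0) := by
  rw [uU_zero]
  exact ((commute_12_34 K).symm.add_right (commute_add_of_rel K
    (Or.inl (Or.inl (Or.inr (Or.inr (Or.inr rfl))))))).neg_right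

theorem commute_34_25 : Commute (tU K p34) (uU K 1) := by
  rw [uU_one, add_assoc]
  exact ((commute_12_34 K).symm.add_right (commute_add_of_rel K
    (Or.inl (Or.inr (Or.inr (Or.inr rfl)))))).neg_right

theorem commute_12_35 : Commute (tU K p12) (uU K 2) := by
  rw [uU_two]
  exact ((commute_add_of_rel K (Or.inl (Or.inl (Or.inl (Or.inl (Or.inl rfl)))))).add_right
    (commute_12_34 K)).neg_right

theorem commute_23_15 : Commute (tU K p23) (uU K 0) := by
  rw [uU_zero, ← add_assoc]
  exact ((commute_add_of_rel K (Or.inl (Or.inl (Or.inl (Or.inl (Or.inr (Or.inr rfl))))))).add_right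
    (commute_14_23 K).symm).neg_right

theorem commute_14_25 : Commute (tU K p14) (uU K 1) := by
  rw [uU_one, add_right_comm]
  exact ((commute_add_of_rel K (Or.inl (Or.inl (Or.inl (Or.inr (Or.inr (Or.inl rfl))))))).add_right
    (commute_14_23 K)).neg_right

theorem commute_14_35 : Commute (tU K p14) (uU K 2) := by
  rw [uU_two, add_right_comm]
  exact ((commute_add_of_rel K (Or.inl (Or.inl (Or.inr (Or.inr (Or.inl rfl)))))).add_right
    (commute_14_23 K)).neg_right

/-- The form in which an infinitesimal braid relation moves `s` to the right of `a`. -/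
theorem mul_eq_of_commute {R : Type u} [Ring R] {s a b : R} (h : Commute (s + a + b) a) :
    s * a = a * (s + b) - b * a := by
  have := h.eq
  rw [add_mul, add_mul, mul_add, mul_add] at this
  rw [mul_add, eq_sub_iff_add_eq]
  have h2 : s * a + b * a + a * a = a * s + a * b + a * a := by
    calc _ = s * a + a * a + b * a := by abel
      _ = a * s + a * a + a * b := this
      _ = _ := by abel
  exact add_right_cancel h2

/-- The coefficients `a_ij` in `t_12 t_i5 = ∑ j, t_j5 a_ij`. -/
def leftCoeff : Fin 3 → Fin 3 → Up5 K :=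
  ![![tU K p12 + uU K 1, -uU K 0, 0], ![-uU K 1, tU K p12 + uU K 0, 0], ![0, 0, tU K p12]]

theorem tU_12_mul_uU (i : Fin 3) : tU K p12 * uU K i = ∑ j, uU K j * leftCoeff K i j := by
  rw [Fin.sum_univ_three]
  fin_cases i
  · change _ * uU K 0 = uU K 0 * (_ + _) + uU K 1 * (-_) + uU K 2 * 0
    have h := commute_34_15 K
    rw [tU_34] at h
    rw [mul_eq_of_commute h, mul_neg, mul_zero, add_zero, sub_eq_add_neg]
  · change _ * uU K 1 = uU K 0 * (-_) + uU K 1 * (_ + _) + uU K 2 * 0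
    have h := commute_34_25 K
    rw [tU_34, add_right_comm] at h
    rw [mul_eq_of_commute h, mul_neg, mul_zero, add_zero, sub_eq_add_neg, add_comm]
  · change _ * uU K 2 = uU K 0 * 0 + uU K 1 * 0 + uU K 2 * _
    rw [mul_zero, mul_zero, zero_add, zero_add, (commute_12_35 K).eq]
    rfl

theorem adjoin_ι {L : Type u} [LieRing L] [LieAlgebra K L] :
    Algebra.adjoin K (Set.range (UniversalEnvelopingAlgebra.ι K : L → _)) = ⊤ := by
  set S := Algebra.adjoin K (Set.range (UniversalEnvelopingAlgebra.ι K : L → _))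
  let g : UniversalEnvelopingAlgebra K L →ₐ[K] S := UniversalEnvelopingAlgebra.lift K
    { toFun := fun a => ⟨UniversalEnvelopingAlgebra.ι K a, Algebra.subset_adjoin ⟨a, rfl⟩⟩
      map_add' := fun a b => Subtype.ext (map_add (UniversalEnvelopingAlgebra.ι K) a b)
      map_smul' := fun k a => Subtype.ext (map_smul (UniversalEnvelopingAlgebra.ι K) k a)
      map_lie' := fun {a b} =>
        Subtype.ext (LieHom.map_lie (UniversalEnvelopingAlgebra.ι K) a b) }
  have h : S.val.comp g = AlgHom.id K _ := by
    apply UniversalEnvelopingAlgebra.hom_ext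
    ext a
    change ((g (UniversalEnvelopingAlgebra.ι K a) : S) : UniversalEnvelopingAlgebra K L) = _
    rw [UniversalEnvelopingAlgebra.lift_ι_apply]
    rfl
  rw [eq_top_iff]
  intro a _
  have := AlgHom.congr_fun h a
  rw [AlgHom.id_apply] at this
  rw [← this]
  exact (g a).2

/-- The algebra `U(p_5)` is generated by the `t_ij`. -/
theorem eq_top_of_tU_mem {S : Subalgebra K (Up5 K)} (h : ∀ i, tU K i ∈ S) : S = ⊤ := by
  rw [eq_top_iff, ← adjoin_ι K, Algebra.adjoin_le_iff]
  rintro _ ⟨a, rfl⟩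
  exact p5_gen ((lieSubalgebraOfSubalgebra K _ S).comap (UniversalEnvelopingAlgebra.ι K)) h a

theorem adjoin_tU_uU :
    Algebra.adjoin K ({tU K p12, tU K p23} ∪ Set.range (uU K)) = ⊤ := by
  set S := Algebra.adjoin K ({tU K p12, tU K p23} ∪ Set.range (uU K))
  have h12 : tU K p12 ∈ S := Algebra.subset_adjoin (Or.inl (Or.inl rfl))
  have h23 : tU K p23 ∈ S := Algebra.subset_adjoin (Or.inl (Or.inr rfl))
  have h5 : ∀ i, uU K i ∈ S := fun i => Algebra.subset_adjoin (Or.inr ⟨i, rfl⟩)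
  have h34 : tU K p34 ∈ S := by rw [tU_34]; exact add_mem (add_mem h12 (h5 0)) (h5 1)
  refine eq_top_of_tU_mem K fun i => ?_
  cases i
  · exact h12
  · have : tU K p13 = -uU K 2 - tU K p23 - tU K p34 := by rw [uU_two]; abel
    rw [this]
    exact sub_mem (sub_mem (neg_mem (h5 2)) h23) h34
  · rw [tU_14]; exact add_mem (add_mem h23 (h5 1)) (h5 2)
  · exact h23
  · have : tU K p24 = -uU K 1 - tU K p12 - tU K p23 := by rw [uU_one]; abel
    rw [this]
    exact sub_mem (sub_mem (neg_mem (h5 1)) h12) h23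
  · exact h34

theorem Upr5_Uell (v : V K) : Upr5 K (Uell K v) = v := by
  have h : (Upr5 K).comp (Uell K) = AlgHom.id K _ := by
    apply UniversalEnvelopingAlgebra.hom_ext
    refine LieHom.ext fun a => ?_
    change Upr5 K (Uell K (UniversalEnvelopingAlgebra.ι K a)) = UniversalEnvelopingAlgebra.ι K a
    rw [Upr5, Uell, Umap_ι, Umap_ι]
    congr 1
    have : (pr5 K).comp (ell K) = LieHom.id := FreeLieAlgebra.hom_ext fun i => by
      change pr5 K (ell K (e K i)) = e K i
      rw [ell_e]
      fin_cases i
      exacts [pr5_t K p23, pr5_t K p12]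
    exact LieHom.congr_fun this a
  exact AlgHom.congr_fun h v

theorem Uell_ee_zero : Uell K (ee K 0) = tU K p23 := by
  rw [Uell, ee, Umap_ι, ell_e]; rfl

theorem Uell_ee_one : Uell K (ee K 1) = tU K p12 := by
  rw [Uell, ee, Umap_ι, ell_e]; rfl

/-- `U(p_5)` is the sum of the right ideal generated by the `t_i5` and of the image of `U(ℓ)`. -/
theorem sub_Uell_mem (a : Up5 K) :
    a - Uell K (Upr5 K a) ∈ rightSpan (uU K) (⊤ : Submodule K (Up5 K)) := by
  refine sub_mem_rightSpan (u := uU K) (Upr5 K) (Uell K) (Upr5_Uell K)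
    (fun i => KerMod.map_incl (u K i)) (adjoin_tU_uU K) ?_ ?_ a
  · have hm : ∀ i b, uU K i * b ∈ rightSpan (uU K) (⊤ : Submodule K (Up5 K)) :=
      fun i b => mul_mem_rightSpan i trivial
    rintro _ ((rfl | rfl) | ⟨j, rfl⟩) i
    · rw [tU_12_mul_uU]
      exact sum_mem fun j _ => hm j _
    · fin_cases i
      · change tU K p23 * uU K 0 ∈ _
        rw [(commute_23_15 K).eq]
        exact hm _ _
      · change tU K p23 * uU K 1 ∈ _
        have h := commute_14_25 K
        rw [tU_14] at h
        rw [mul_eq_of_commute h]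
        exact sub_mem (hm _ _) (hm _ _)
      · change tU K p23 * uU K 2 ∈ _
        have h := commute_14_35 K
        rw [tU_14, add_right_comm] at h
        rw [mul_eq_of_commute h]
        exact sub_mem (hm _ _) (hm _ _)
    · exact hm j _
  · rintro _ ((rfl | rfl) | ⟨j, rfl⟩)
    · exact ⟨ee K 1, by rw [Uell_ee_one, sub_self]; exact zero_mem _⟩
    · exact ⟨ee K 0, by rw [Uell_ee_zero, sub_self]; exact zero_mem _⟩
    · refine ⟨0, ?_⟩
      rw [map_zero, sub_zero, ← mul_one (uU K j)]
      exact mul_mem_rightSpan j trivial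

theorem kappa_surjective : Function.Surjective (kappa K) := by
  refine BFSTheory.kappa_surjective _ fun x => ?_
  have := sub_Uell_mem K (KerMod.incl _ x)
  rwa [KerMod.map_incl, map_zero, sub_zero] at this

theorem Upr12_tU (i : Pair) : Upr12 K (tU K i) =
    UniversalEnvelopingAlgebra.ι K (pr1Fun K i) ⊗ₜ 1 +
      1 ⊗ₜ UniversalEnvelopingAlgebra.ι K (pr2Fun K i) := by
  rw [tU, Upr12_ι, pr1_t, pr2_t]

theorem Upr12_uU_zero : Upr12 K (uU K 0) = 1 ⊗ₜ ee K 1 := by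
  have h1 : pr1 K (t5 K 0) = 0 := by simp [t5, pr1_t, pr1Fun]
  have h2 : pr2 K (t5 K 0) = e K 1 := by simp [t5, pr2_t, pr2Fun, einf]
  rw [uU, Upr12_ι, h1, h2, map_zero, TensorProduct.zero_tmul, zero_add, ee]

theorem Upr12_uU_one : Upr12 K (uU K 1) = ee K 1 ⊗ₜ 1 := by
  have h1 : pr1 K (t5 K 1) = e K 1 := by simp [t5, pr1_t, pr1Fun, einf]
  have h2 : pr2 K (t5 K 1) = 0 := by simp [t5, pr2_t, pr2Fun]
  rw [uU, Upr12_ι, h1, h2, map_zero, TensorProduct.tmul_zero, add_zero, ee]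

/-- The infinitesimal version of `Betti.Kpr12_leftCoeff`. -/
theorem Upr12_leftCoeff (i j : Fin 3) : Upr12 K (leftCoeff K i j) = col K j * row K i := by
  have h : Upr12 K (tU K p12) = 0 := by
    rw [Upr12_tU, pr1Fun, pr2Fun, map_zero, TensorProduct.zero_tmul, TensorProduct.tmul_zero,
      add_zero]
  fin_cases i <;> fin_cases j <;>
    simp [leftCoeff, col, row, h, Upr12_uU_zero, Upr12_uU_one]

/-- In the coordinates given by `κ_DR`, the left action of `e_1` is the multiplication by the matrix
`col * row`. -/
theorem actL_e_kappa (a : Fin 3 → VV K) :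
    KerTensor.actL (Upr5 K) (Upr12 K) (Uell K (ee K 1)) (kappa K a) =
      kappa K (colMap (col K) (rowMap (row K) a)) := by
  change KerTensor.actL (Upr5 K) (Upr12 K) (Uell K (ee K 1))
    (∑ i, KerTensor.tmul _ _ (u K i) (a i)) = kappa K (colMap (col K) (∑ i, row K i * a i))
  rw [map_sum, map_sum, map_sum]
  refine Finset.sum_congr rfl fun i _ => ?_
  rw [KerTensor.actL_tmul, tmul_eq_kappa (Upr12 K) (u K) _ (leftCoeff K i) ?_ (a i)]
  · refine congrArg (kappa K) (funext fun j => ?_)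
    rw [Upr12_leftCoeff, mul_assoc]
    rfl
  · rw [Uell_ee_one]
    exact (tU_12_mul_uU K i).symm

end DeRham

end

end BFSTheory

namespace BFSTheory

noncomputable section

open MulOpposite

/-! ### Algebra morphisms between associated graded algebras -/

section GrAlg

variable {K : Type u} [CommRing K] {A B : Type u} [Ring A] [Algebra K A] [Ring B] [Algebra K B]
  {F : ℤ → Submodule K A} [IsAlgFiltration F] {G : ℤ → Submodule K B} [IsAlgFiltration G]

/-- The algebra morphism `gr A → gr B` induced by a filtered algebra morphism `A → B`. -/
def grAlgHom (f : A →ₐ[K] B) (h : ∀ n, ∀ x ∈ F n, f x ∈ G n) : Gr F →ₐ[K] Gr G :=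
  AlgHom.ofLinearMap
    (grMap F G 0 f.toLinearMap fun n x hx => by rw [add_zero]; exact h n x hx)
    (by
      rw [gr_one, grMap_cls]
      exact cls_congr (add_zero 0) (map_one f))
    (fun a b => by
      induction a using gr_induction with
      | h0 => simp only [zero_mul, map_zero]
      | ha a a' h h' => simp only [add_mul, map_add, h, h']
      | hc i a =>
        induction b using gr_induction with
        | h0 => simp only [mul_zero, map_zero]
        | ha b b' h h' => simp only [mul_add, map_add, h, h']
        | hc j b =>
          rw [gr_mul_cls, grMap_cls, grMap_cls, grMap_cls, gr_mul_cls]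
          exact cls_congr (by ring) (map_mul f (a : A) (b : A)))

theorem grAlgHom_cls (f : A →ₐ[K] B) (h : ∀ n, ∀ x ∈ F n, f x ∈ G n) (n : ℤ) (x : F n) :
    grAlgHom (G := G) f h (cls F n x) = cls G n ⟨f x, h n x x.2⟩ := by
  change grMap F G 0 f.toLinearMap _ (cls F n x) = _
  rw [grMap_cls]
  exact cls_congr (add_zero n) rfl

theorem grAlgHom_mem_grPart (f : A →ₐ[K] B) (h : ∀ n, ∀ x ∈ F n, f x ∈ G n) (n : ℤ) (a : Gr F)
    (ha : a ∈ grPart F n) : grAlgHom (G := G) f h a ∈ grPart G n := by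
  obtain ⟨x, rfl⟩ := ha
  rw [grAlgHom_cls]
  exact ⟨_, rfl⟩

theorem grAlgHom_surjective (f : A →ₐ[K] B) (h : ∀ n, ∀ x ∈ F n, f x ∈ G n)
    (hs : ∀ n, ∀ y ∈ G n, ∃ x ∈ F n, f x = y) : Function.Surjective (grAlgHom (G := G) f h) := by
  intro b
  induction b using gr_induction with
  | h0 => exact ⟨0, map_zero _⟩
  | ha a b ha hb =>
    obtain ⟨a', rfl⟩ := ha
    obtain ⟨b', rfl⟩ := hb
    exact ⟨a' + b', map_add _ _ _⟩
  | hc n y =>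
    obtain ⟨x, hx, hxy⟩ := hs n y y.2
    exact ⟨cls F n ⟨x, hx⟩, by rw [grAlgHom_cls]; exact cls_congr rfl hxy⟩

end GrAlg

/-! ### The associated graded algebra of a group algebra -/

namespace Betti

section GrGroup

variable (K : Type u) [CommRing K] {G H : Type} [Group G] [Group H]

theorem augFil_one_eq : augFil K G 1 = augIdeal K G := powFil_one _

theorem augFil_succ (n : ℕ) : augFil K G ((n + 1 : ℕ) + 1 : ℤ) =
    augFil K G (n + 1 : ℕ) * augFil K G 1 := by
  rw [augFil_one_eq, augFil, powFil_succ, ← Nat.cast_succ, powFil_succ, pow_succ]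

/-- The class `[g - 1]_1`. -/
def grGen (g : G) : Gr (augFil K G) :=
  cls _ 1 ⟨MonoidAlgebra.of K G g - 1, of_sub_one_mem_augFil K g⟩

/-- The term `(g - 1) (h - 1)` of `g h - 1` lies in `F^2`. -/
theorem grGen_mul (g h : G) : grGen K (g * h) = grGen K g + grGen K h := by
  rw [grGen, grGen, grGen, ← map_add, ← sub_eq_zero, ← map_sub]
  refine cls_eq_zero _ ?_
  have : MonoidAlgebra.of K G (g * h) - 1 -
      (MonoidAlgebra.of K G g - 1 + (MonoidAlgebra.of K G h - 1)) =
      (MonoidAlgebra.of K G g - 1) * (MonoidAlgebra.of K G h - 1) := by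
    rw [map_mul]; noncomm_ring
  change MonoidAlgebra.of K G (g * h) - 1 -
      (MonoidAlgebra.of K G g - 1 + (MonoidAlgebra.of K G h - 1)) ∈ _
  rw [this]
  exact IsAlgFiltration.mul_mem (F := augFil K G) 1 1 _ (of_sub_one_mem_augFil K g) _
    (of_sub_one_mem_augFil K h)

theorem grGen_one : grGen K (1 : G) = 0 := by
  have := grGen_mul K (1 : G) 1
  rwa [mul_one, left_eq_add] at this

theorem grGen_inv (g : G) : grGen K g⁻¹ = -grGen K g := by
  rw [eq_neg_iff_add_eq_zero, ← grGen_mul, inv_mul_cancel, grGen_one]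

theorem commute_grGen {g h : G} (hc : Commute g h) : Commute (grGen K g) (grGen K h) := by
  change _ * _ = _ * _
  rw [grGen, grGen, gr_mul_cls, gr_mul_cls]
  refine cls_congr rfl ?_
  have : Commute (MonoidAlgebra.of K G g - 1) (MonoidAlgebra.of K G h - 1) :=
    ((hc.map (MonoidAlgebra.of K G)).sub_left (Commute.one_left _)).sub_right (Commute.one_right _)
  exact this

theorem sub_algebraMap_mem_augIdeal (a : MonoidAlgebra K G) :
    ∃ k : K, a - algebraMap K _ k ∈ augIdeal K G := by
  induction a using MonoidAlgebra.induction_on with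
  | of g => exact ⟨1, by rw [map_one]; exact of_sub_one_mem K g⟩
  | add a b ha hb =>
    obtain ⟨k, hk⟩ := ha
    obtain ⟨l, hl⟩ := hb
    exact ⟨k + l, by rw [map_add, add_sub_add_comm]; exact add_mem hk hl⟩
  | smul k a ha =>
    obtain ⟨l, hl⟩ := ha
    refine ⟨k * l, ?_⟩
    have : k • a - algebraMap K (MonoidAlgebra K G) (k * l) = k • (a - algebraMap K _ l) := by
      rw [smul_sub, map_mul, ← Algebra.smul_def]
    rw [this]
    exact Submodule.smul_mem _ _ hl

/-- The algebra `gr (K G)` is generated by the classes `[g - 1]_1`. -/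
theorem eq_top_of_grGen_mem {S : Subalgebra K (Gr (augFil K G))} (h : ∀ g : G, grGen K g ∈ S) :
    S = ⊤ := by
  have h1 : ∀ (x : MonoidAlgebra K G) (hx : x ∈ augFil K G 1), cls (augFil K G) 1 ⟨x, hx⟩ ∈ S := by
    intro x hx
    have hx' : x ∈ augIdeal K G := by rwa [augFil_one_eq] at hx
    have key : augIdeal K G ≤ ((Subalgebra.toSubmodule S).comap (cls (augFil K G) 1)).map
        (augFil K G 1).subtype := Submodule.span_le.2 (by
      rintro _ ⟨g, rfl⟩
      exact ⟨⟨_, of_sub_one_mem_augFil K g⟩, h g, rfl⟩)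
    obtain ⟨y, hy, rfl⟩ := key hx'
    exact hy
  rw [eq_top_iff]
  intro a _
  induction a using gr_induction with
  | h0 => exact zero_mem _
  | ha a b ha hb => exact add_mem (ha trivial) (hb trivial)
  | hc n x =>
    rcases lt_trichotomy n 0 with hn | rfl | hn
    · rw [cls_eq_zero x (by rw [augFil_of_nonpos K (by omega)]; trivial)]
      exact zero_mem _
    · obtain ⟨k, hk⟩ := sub_algebraMap_mem_augIdeal K (x : MonoidAlgebra K G)
      have : cls (augFil K G) 0 x = k • 1 := by
        rw [gr_one, ← map_smul, ← sub_eq_zero, ← map_sub]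
        refine cls_eq_zero _ ?_
        rw [zero_add, augFil_one_eq]
        rwa [Algebra.algebraMap_eq_smul_one] at hk
      rw [this]
      exact S.smul_mem (one_mem S) k
    · obtain ⟨m, rfl⟩ : ∃ m : ℕ, n = (m + 1 : ℕ) := ⟨(n - 1).toNat, by omega⟩
      clear hn
      induction m with
      | zero =>
        obtain ⟨x, hx⟩ := x
        have := h1 x hx
        exact this
      | succ m ih =>
        have key : augFil K G ((m + 1 : ℕ) + 1 : ℤ) ≤
            ((Subalgebra.toSubmodule S).comap (cls (augFil K G) ((m + 1 : ℕ) + 1 : ℤ))).map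
              (augFil K G ((m + 1 : ℕ) + 1 : ℤ)).subtype := by
          conv_lhs => rw [augFil_succ]
          refine Submodule.mul_le.2 fun a ha b hb => ?_
          refine ⟨⟨a * b, IsAlgFiltration.mul_mem _ _ _ ha _ hb⟩, ?_, rfl⟩
          have := mul_mem (ih ⟨a, ha⟩ trivial) (h1 b hb)
          rwa [gr_mul_cls] at this
        obtain ⟨x, hx⟩ := x
        obtain ⟨y, hy, rfl⟩ := key hx
        exact hy

/-- If `T` generates the group `G`, the classes `[g - 1]_1` with `g ∈ T` generate the algebra
`gr (K G)`. -/
theorem eq_top_of_grGen_mem_of_closure {S : Subalgebra K (Gr (augFil K G))} {T : Set G}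
    (hT : Subgroup.closure T = ⊤) (h : ∀ g ∈ T, grGen K g ∈ S) : S = ⊤ := by
  refine eq_top_of_grGen_mem K fun g => ?_
  have hg : g ∈ Subgroup.closure T := hT ▸ Subgroup.mem_top g
  induction hg using Subgroup.closure_induction with
  | mem g hg => exact h g hg
  | one => rw [grGen_one]; exact zero_mem _
  | mul g g' _ _ h h' => rw [grGen_mul]; exact add_mem h h'
  | inv g _ h => rw [grGen_inv]; exact neg_mem h

end GrGroup

section GrMaps

variable (K : Type u) [CommRing K]

theorem Kpr12_mem_filVV (n : ℤ) (a : KP5 K) (ha : a ∈ augFil K P5 n) : Kpr12 K a ∈ filVV K n := by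
  rw [← map_Kpr12]
  exact ⟨a, ha, rfl⟩

theorem tmul_one_mem (n : ℤ) (a : V K) (ha : a ∈ augFil K F2 n) :
    (Algebra.TensorProduct.includeLeft : V K →ₐ[K] VV K) a ∈ filVV K n :=
  mem_convolve' (β := TensorProduct.mk K (V K) (V K)) (add_zero n) ha IsAlgFiltration.one_mem

theorem one_tmul_mem (n : ℤ) (a : V K) (ha : a ∈ augFil K F2 n) :
    (Algebra.TensorProduct.includeRight : V K →ₐ[K] VV K) a ∈ filVV K n :=
  mem_convolve' (β := TensorProduct.mk K (V K) (V K)) (zero_add n) IsAlgFiltration.one_mem ha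

/-- `gr (K pr_5)`. -/
def grPr5 : Gr (augFil K P5) →ₐ[K] Gr (augFil K F2) := grAlgHom (Kpr5 K) (Kpr5_mem)

/-- `gr (K ℓ)`. -/
def grEll : Gr (augFil K F2) →ₐ[K] Gr (augFil K P5) := grAlgHom (Kell K) (Kell_mem K)

/-- `gr (K pr_12)`. -/
def grPr12 : Gr (augFil K P5) →ₐ[K] Gr (filVV K) := grAlgHom (Kpr12 K) (Kpr12_mem_filVV K)

/-- The morphism `[a]_n ↦ [a ⊗ 1]_n`. -/
def grLeft : Gr (augFil K F2) →ₐ[K] Gr (filVV K) :=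
  grAlgHom Algebra.TensorProduct.includeLeft (tmul_one_mem K)

/-- The morphism `[a]_n ↦ [1 ⊗ a]_n`. -/
def grRight : Gr (augFil K F2) →ₐ[K] Gr (filVV K) :=
  grAlgHom Algebra.TensorProduct.includeRight (one_tmul_mem K)

theorem grPr5_grGen (g : P5) : grPr5 K (grGen K g) = grGen K (pr5 g) := by
  rw [grPr5, grGen, grAlgHom_cls]
  refine cls_congr rfl ?_
  change Kpr5 K (MonoidAlgebra.of K P5 g - 1) = MonoidAlgebra.of K F2 (pr5 g) - 1
  rw [map_sub, map_one, Kpr5_of]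

theorem grEll_grGen (g : F2) : grEll K (grGen K g) = grGen K (ell g) := by
  rw [grEll, grGen, grAlgHom_cls]
  refine cls_congr rfl ?_
  change Kell K (MonoidAlgebra.of K F2 g - 1) = MonoidAlgebra.of K P5 (ell g) - 1
  rw [map_sub, map_one, Kell_of]

theorem grPr12_surjective : Function.Surjective (grPr12 K) :=
  grAlgHom_surjective _ _ fun n y hy => by
    rw [← map_Kpr12] at hy
    exact hy

/-- The coproduct `g ↦ g ⊗ g` becomes the infinitesimal one, as `(g_1 - 1) ⊗ (g_2 - 1)` lies in
`F^2`. -/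
theorem grPr12_grGen (g : P5) :
    grPr12 K (grGen K g) = grLeft K (grGen K (pr1 g)) + grRight K (grGen K (pr2 g)) := by
  rw [grPr12, grGen, grLeft, grRight, grGen, grGen, grAlgHom_cls, grAlgHom_cls, grAlgHom_cls,
    ← map_add, ← sub_eq_zero, ← map_sub]
  refine cls_eq_zero _ ?_
  have : Kpr12 K (MonoidAlgebra.of K P5 g - 1) -
      ((MonoidAlgebra.of K F2 (pr1 g) - 1) ⊗ₜ 1 + 1 ⊗ₜ (MonoidAlgebra.of K F2 (pr2 g) - 1)) =
      (MonoidAlgebra.of K F2 (pr1 g) - 1) ⊗ₜ[K] (MonoidAlgebra.of K F2 (pr2 g) - 1) := by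
    rw [map_sub, map_one, Kpr12_of]
    simp only [TensorProduct.sub_tmul, TensorProduct.tmul_sub, Algebra.TensorProduct.one_def]
    abel
  change Kpr12 K (MonoidAlgebra.of K P5 g - 1) -
      ((MonoidAlgebra.of K F2 (pr1 g) - 1) ⊗ₜ 1 + 1 ⊗ₜ (MonoidAlgebra.of K F2 (pr2 g) - 1)) ∈ _
  rw [this]
  exact mem_convolve (β := TensorProduct.mk K (V K) (V K)) (of_sub_one_mem_augFil K _)
    (of_sub_one_mem_augFil K _)

theorem commute_grLeft_grRight (a b : Gr (augFil K F2)) :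
    Commute (grLeft K a) (grRight K b) := by
  induction a using gr_induction with
  | h0 => rw [map_zero]; exact Commute.zero_left _
  | ha a a' h h' => rw [map_add]; exact h.add_left h'
  | hc i a =>
    induction b using gr_induction with
    | h0 => rw [map_zero]; exact Commute.zero_right _
    | ha a a' h h' => rw [map_add]; exact h.add_right h'
    | hc j b =>
      change _ * _ = _ * _
      rw [grLeft, grRight, grAlgHom_cls, grAlgHom_cls, gr_mul_cls, gr_mul_cls]
      refine cls_congr (add_comm i j) ?_
      change ((a : V K) ⊗ₜ[K] (1 : V K)) * ((1 : V K) ⊗ₜ[K] (b : V K)) =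
        ((1 : V K) ⊗ₜ[K] (b : V K)) * ((a : V K) ⊗ₜ[K] (1 : V K))
      rw [Algebra.TensorProduct.tmul_mul_tmul, Algebra.TensorProduct.tmul_mul_tmul, one_mul,
        mul_one, one_mul, mul_one]

end GrMaps

end Betti

end

end BFSTheory

namespace BFSTheory

noncomputable section

open MulOpposite

/-! ### Leading coefficients of power series -/

section PowerSeries

variable {K : Type u} [CommRing K] {A : Type u} [Ring A] [Algebra K A]

variable (K A) in
/-- The power series over `A` which are divisible by `X ^ n`. -/
def ordFil (n : ℤ) : Submodule K (PowerSeries A) where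
  carrier := {p | ∀ k : ℕ, (k : ℤ) < n → PowerSeries.coeff k p = 0}
  add_mem' ha hb k hk := by rw [map_add, ha k hk, hb k hk, add_zero]
  zero_mem' k _ := map_zero _
  smul_mem' c p hp k hk := by
    change c • PowerSeries.coeff k p = 0
    rw [hp k hk, smul_zero]

theorem ordFil_of_nonpos (n : ℤ) (hn : n ≤ 0) : ordFil K A n = ⊤ := by
  rw [eq_top_iff]
  intro p _ k hk
  omega

/-- The coefficient of degree `i + j` of a product of series divisible by `X ^ i` and `X ^ j` is
the product of the coefficients of degrees `i` and `j`. -/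
theorem coeff_mul_of_mem_ordFil {i j : ℕ} {p q : PowerSeries A} (hp : p ∈ ordFil K A i)
    (hq : q ∈ ordFil K A j) :
    PowerSeries.coeff (i + j) (p * q) = PowerSeries.coeff i p * PowerSeries.coeff j q := by
  rw [PowerSeries.coeff_mul]
  refine Finset.sum_eq_single (i, j) (fun ⟨a, b⟩ hab hne => ?_) fun h => ?_
  · rw [Finset.HasAntidiagonal.mem_antidiagonal] at hab
    rcases lt_or_ge a i with ha | ha
    · change PowerSeries.coeff a p * _ = 0
      rw [hp a (by exact_mod_cast ha), zero_mul]
    · have hb : b < j := by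
        by_contra hb
        exact hne (Prod.ext (by simp only at hab ⊢; omega) (by simp only at hab ⊢; omega))
      change _ * PowerSeries.coeff b q = 0
      rw [hq b (by exact_mod_cast hb), mul_zero]
  · exact absurd (Finset.HasAntidiagonal.mem_antidiagonal (a := (i, j)).2 rfl) h

instance : IsAlgFiltration (ordFil K A) where
  antitone m n h p hp k hk := hp k (hk.trans_le h)
  one_mem := by rw [ordFil_of_nonpos 0 le_rfl]; trivial
  mul_mem i j p hp q hq k hk := by
    rw [PowerSeries.coeff_mul]
    refine Finset.sum_eq_zero fun ⟨a, b⟩ hab => ?_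
    rw [Finset.HasAntidiagonal.mem_antidiagonal] at hab
    rcases lt_or_ge (a : ℤ) i with ha | ha
    · change PowerSeries.coeff a p * _ = 0
      rw [hp a ha, zero_mul]
    · change _ * PowerSeries.coeff b q = 0
      rw [hq b (by simp only at hab; omega), mul_zero]

variable (K A) in
/-- The coefficient of degree `n` on power series divisible by `X ^ n`, set to `0` for `n < 0`. -/
def ordCoeff (n : ℤ) : ordFil K A n →ₗ[K] A where
  toFun p := if 0 ≤ n then PowerSeries.coeff n.toNat (p : PowerSeries A) else 0
  map_add' p q := by
    split_ifs
    · exact map_add _ _ _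
    · rw [add_zero]
  map_smul' c p := by
    split_ifs
    · rfl
    · rw [smul_zero]

theorem ordCoeff_natCast (n : ℕ) (p : ordFil K A n) :
    ordCoeff K A n p = PowerSeries.coeff n (p : PowerSeries A) := by
  change (if (0 : ℤ) ≤ n then PowerSeries.coeff (n : ℤ).toNat (p : PowerSeries A) else 0) = _
  rw [if_pos (by omega), Int.toNat_natCast]

theorem ordCoeff_of_neg {n : ℤ} (hn : n < 0) (p : ordFil K A n) : ordCoeff K A n p = 0 :=
  if_neg (by omega)

theorem ordCoeff_eq_zero (n : ℤ) (p : ordFil K A n)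
    (hp : (p : PowerSeries A) ∈ ordFil K A (n + 1)) :
    ordCoeff K A n p = 0 := by
  rcases lt_or_ge n 0 with hn | hn
  · exact ordCoeff_of_neg hn p
  · lift n to ℕ using hn
    rw [ordCoeff_natCast]
    exact hp n (by omega)

/-- The leading coefficient `gr (A⟦X⟧) → A`. -/
def leadLin : Gr (ordFil K A) →ₗ[K] A := grLift _ (ordCoeff K A) ordCoeff_eq_zero

variable (K A) in
/-- The leading coefficient, as an algebra morphism `gr (A⟦X⟧) → A`. -/
def leadCoeff : Gr (ordFil K A) →ₐ[K] A :=
  AlgHom.ofLinearMap leadLin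
    (by
      rw [gr_one, leadLin, grLift_cls]
      refine (ordCoeff_natCast 0 _).trans ?_
      change PowerSeries.coeff 0 (1 : PowerSeries A) = 1
      rw [PowerSeries.coeff_zero_one])
    (fun a b => by
      induction a using gr_induction with
      | h0 => simp only [zero_mul, map_zero]
      | ha a a' h h' => simp only [add_mul, map_add, h, h']
      | hc i a =>
        induction b using gr_induction with
        | h0 => simp only [mul_zero, map_zero]
        | ha b b' h h' => simp only [mul_add, map_add, h, h']
        | hc j b =>
          -- a class of negative degree vanishes, since the filtration is constant in degrees `≤ 0`
          rcases lt_or_ge i 0 with hi | hi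
          · rw [cls_eq_zero a (by rw [ordFil_of_nonpos _ (by omega)]; trivial), zero_mul, map_zero,
              zero_mul]
          rcases lt_or_ge j 0 with hj | hj
          · rw [cls_eq_zero b (by rw [ordFil_of_nonpos _ (by omega)]; trivial), mul_zero, map_zero,
              mul_zero]
          lift i to ℕ using hi
          lift j to ℕ using hj
          rw [gr_mul_cls, leadLin, grLift_cls, grLift_cls, grLift_cls, ordCoeff_natCast,
            ordCoeff_natCast, ← coeff_mul_of_mem_ordFil a.2 b.2]
          exact ordCoeff_natCast (i + j) ⟨_, IsAlgFiltration.mul_mem _ _ _ a.2 _ b.2⟩)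

theorem leadCoeff_cls_one (p : ordFil K A 1) :
    leadCoeff K A (cls _ 1 p) = PowerSeries.coeff 1 (p : PowerSeries A) :=
  (grLift_cls _ _ _ _ _).trans (ordCoeff_natCast 1 p)

/-- The invertible power series `1 + a X`. -/
def unitSeries (a : A) : (PowerSeries A)ˣ where
  val := 1 + PowerSeries.C a * PowerSeries.X
  inv := PowerSeries.mk fun n => (-a) ^ n
  val_inv := by
    ext n
    rw [add_mul, one_mul, map_add, mul_assoc, PowerSeries.coeff_C_mul, PowerSeries.coeff_mk]
    cases n with
    | zero => simp
    | succ n =>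
      rw [PowerSeries.coeff_succ_X_mul, PowerSeries.coeff_mk, pow_succ', PowerSeries.coeff_one,
        if_neg (by omega)]
      rw [neg_mul, neg_add_cancel]
  inv_val := by
    ext n
    rw [mul_add, mul_one, map_add, ← mul_assoc, PowerSeries.coeff_mk]
    cases n with
    | zero => simp
    | succ n =>
      rw [PowerSeries.coeff_succ_mul_X, PowerSeries.coeff_mul_C, PowerSeries.coeff_mk, pow_succ,
        PowerSeries.coeff_one, if_neg (by omega)]
      rw [mul_neg, neg_add_cancel]

theorem coeff_mapAlgHom {B : Type u} [Ring B] [Algebra K B] (f : A →ₐ[K] B) (n : ℕ)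
    (p : PowerSeries A) : PowerSeries.coeff n (PowerSeries.mapAlgHom f p) =
      f (PowerSeries.coeff n p) := by
  rw [PowerSeries.mapAlgHom_apply, PowerSeries.coeff_map]
  rfl

theorem mapAlgHom_mem_ordFil {B : Type u} [Ring B] [Algebra K B] (f : A →ₐ[K] B) (n : ℤ)
    (p : PowerSeries A) (hp : p ∈ ordFil K A n) : PowerSeries.mapAlgHom f p ∈ ordFil K B n :=
  fun k hk => by rw [coeff_mapAlgHom, hp k hk, map_zero]

end PowerSeries

/-! ### Magnus expansions -/

namespace Magnus

variable (K : Type u) [CommRing K] {A : Type u} [Ring A] [Algebra K A]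

/-- The Magnus expansion `K F_2 → A⟦X⟧`, sending the generator `X_i` to `1 + a_i X`. -/
def expansion (a : Fin 2 → A) : Betti.V K →ₐ[K] PowerSeries A :=
  MonoidAlgebra.lift K (PowerSeries A) Betti.F2
    ((Units.coeHom (PowerSeries A)).comp (FreeGroup.lift fun i => unitSeries (a i)))

theorem expansion_of (a : Fin 2 → A) (g : Betti.F2) :
    expansion K a (MonoidAlgebra.of K Betti.F2 g) =
      (FreeGroup.lift (fun i => unitSeries (a i)) g : (PowerSeries A)ˣ) := by
  rw [expansion, MonoidAlgebra.lift_of]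
  rfl

/-- The Magnus expansion of a group element has constant term `1`, so the expansion maps the
augmentation ideal to series without constant term. -/
theorem coeff_zero_expansion_of (a : Fin 2 → A) (g : Betti.F2) :
    PowerSeries.coeff 0 (expansion K a (MonoidAlgebra.of K Betti.F2 g)) = 1 := by
  rw [expansion_of]
  have : (Units.map (PowerSeries.constantCoeff : PowerSeries A →+* A).toMonoidHom).comp
      (FreeGroup.lift fun i => unitSeries (a i)) = 1 := by
    refine FreeGroup.ext_hom _ _ fun i => Units.ext ?_
    rw [MonoidHom.comp_apply, FreeGroup.lift_apply_of]
    change PowerSeries.constantCoeff (1 + PowerSeries.C (a i) * PowerSeries.X) = 1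
    simp
  have h := congrArg Units.val (DFunLike.congr_fun this g)
  rw [PowerSeries.coeff_zero_eq_constantCoeff_apply]
  exact h

theorem expansion_mem (a : Fin 2 → A) (n : ℤ) (v : Betti.V K) (hv : v ∈ Betti.augFil K Betti.F2 n) :
    expansion K a v ∈ ordFil K A n := by
  refine Betti.map_augFil_le K (F := ordFil K A) ordFil_of_nonpos (expansion K a)
    (fun g k hk => ?_) n v hv
  obtain rfl : k = 0 := by omega
  rw [map_sub, coeff_zero_expansion_of, PowerSeries.coeff_zero_one, sub_self]

theorem coeff_one_expansion_e (a : Fin 2 → A) (i : Fin 2) :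
    PowerSeries.coeff 1 (expansion K a (Betti.e K i)) = a i := by
  rw [Betti.e, map_sub, map_one, expansion_of, Betti.X, FreeGroup.lift_apply_of]
  change PowerSeries.coeff 1 (1 + PowerSeries.C (a i) * PowerSeries.X - 1) = a i
  rw [add_sub_cancel_left, PowerSeries.coeff_C_mul, PowerSeries.coeff_one_X, mul_one]

/-- The leading term of the Magnus expansion, an algebra morphism `gr (K F_2) → A`. -/
def lead (a : Fin 2 → A) : Gr (Betti.augFil K Betti.F2) →ₐ[K] A :=
  (leadCoeff K A).comp (grAlgHom (expansion K a) (expansion_mem K a))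

theorem lead_grGen (a : Fin 2 → A) (i : Fin 2) : lead K a (Betti.grGen K (Betti.X i)) = a i := by
  rw [lead, AlgHom.comp_apply, Betti.grGen, grAlgHom_cls, leadCoeff_cls_one]
  exact coeff_one_expansion_e K a i

theorem commute_map (p q : PowerSeries A) :
    Commute (PowerSeries.mapAlgHom (Algebra.TensorProduct.includeLeft : A →ₐ[K] A ⊗[K] A) p)
      (PowerSeries.mapAlgHom (Algebra.TensorProduct.includeRight : A →ₐ[K] A ⊗[K] A) q) := by
  refine PowerSeries.ext fun n => ?_
  rw [PowerSeries.coeff_mul, PowerSeries.coeff_mul, ← Finset.Nat.sum_antidiagonal_swap]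
  refine Finset.sum_congr rfl fun ⟨i, j⟩ _ => ?_
  simp [coeff_mapAlgHom]

/-- The tensor product of two Magnus expansions, with a common variable `X`, so that its order gives
the total degree on `V^B ⊗ V^B`. -/
def expansion₂ (a : Fin 2 → A) : Betti.VV K →ₐ[K] PowerSeries (A ⊗[K] A) :=
  Algebra.TensorProduct.lift
    ((PowerSeries.mapAlgHom Algebra.TensorProduct.includeLeft).comp (expansion K a))
    ((PowerSeries.mapAlgHom Algebra.TensorProduct.includeRight).comp (expansion K a))
    fun _ _ => commute_map K _ _

theorem expansion₂_tmul (a : Fin 2 → A) (x y : Betti.V K) : expansion₂ K a (x ⊗ₜ y) =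
    PowerSeries.mapAlgHom (Algebra.TensorProduct.includeLeft : A →ₐ[K] A ⊗[K] A)
        (expansion K a x) *
      PowerSeries.mapAlgHom (Algebra.TensorProduct.includeRight : A →ₐ[K] A ⊗[K] A)
        (expansion K a y) :=
  Algebra.TensorProduct.lift_tmul _ _ _ _ _

theorem expansion₂_mem (a : Fin 2 → A) (n : ℤ) (w : Betti.VV K) (hw : w ∈ Betti.filVV K n) :
    expansion₂ K a w ∈ ordFil K (A ⊗[K] A) n := by
  have : Betti.filVV K n ≤ (ordFil K (A ⊗[K] A) n).comap (expansion₂ K a).toLinearMap := by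
    refine convolve_le fun i j hij x hx y hy => ?_
    rw [Submodule.mem_comap, AlgHom.toLinearMap_apply, TensorProduct.mk_apply,
      expansion₂_tmul, ← hij]
    exact IsAlgFiltration.mul_mem _ _ _ (mapAlgHom_mem_ordFil _ _ _ (expansion_mem K a i x hx)) _
      (mapAlgHom_mem_ordFil _ _ _ (expansion_mem K a j y hy))
  exact this hw

/-- The leading term of the tensor product of two Magnus expansions, an algebra morphism
`gr (V^B ⊗ V^B) → A ⊗ A`. -/
def lead₂ (a : Fin 2 → A) : Gr (Betti.filVV K) →ₐ[K] A ⊗[K] A :=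
  (leadCoeff K (A ⊗[K] A)).comp (grAlgHom (expansion₂ K a) (expansion₂_mem K a))

theorem lead₂_grLeft (a : Fin 2 → A) (i : Fin 2) :
    lead₂ K a (Betti.grLeft K (Betti.grGen K (Betti.X i))) = a i ⊗ₜ 1 := by
  rw [lead₂, AlgHom.comp_apply, Betti.grLeft, Betti.grGen, grAlgHom_cls, grAlgHom_cls,
    leadCoeff_cls_one]
  change PowerSeries.coeff 1 (expansion₂ K a (Betti.e K i ⊗ₜ 1)) = _
  rw [expansion₂_tmul, map_one, map_one, mul_one, coeff_mapAlgHom, coeff_one_expansion_e]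
  rfl

theorem lead₂_grRight (a : Fin 2 → A) (i : Fin 2) :
    lead₂ K a (Betti.grRight K (Betti.grGen K (Betti.X i))) = 1 ⊗ₜ a i := by
  rw [lead₂, AlgHom.comp_apply, Betti.grRight, Betti.grGen, grAlgHom_cls, grAlgHom_cls,
    leadCoeff_cls_one]
  change PowerSeries.coeff 1 (expansion₂ K a (1 ⊗ₜ Betti.e K i)) = _
  rw [expansion₂_tmul, map_one, map_one, one_mul, coeff_mapAlgHom, coeff_one_expansion_e]
  rfl

end Magnus

end

end BFSTheory

namespace BFSTheory

noncomputable section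

open MulOpposite

namespace DeRham

open Pair

attribute [local instance] LieRing.ofAssociativeRing

variable (K : Type u) [CommRing K]

/-! ### Comparison of the algebras -/

section HomExt

variable {K} {B : Type u} [Ring B] [Algebra K B]

theorem V_hom_ext {f g : V K →ₐ[K] B} (h : ∀ i, f (ee K i) = g (ee K i)) : f = g := by
  apply UniversalEnvelopingAlgebra.hom_ext
  exact FreeLieAlgebra.hom_ext h

theorem Up5_hom_ext {f g : Up5 K →ₐ[K] B} (h : ∀ i, f (tU K i) = g (tU K i)) : f = g := by
  have : AlgHom.equalizer f g = ⊤ := eq_top_of_tU_mem K h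
  exact AlgHom.ext fun a => (this ▸ Algebra.mem_top : a ∈ AlgHom.equalizer f g)

theorem VV_hom_ext {f g : VV K →ₐ[K] B} (h0 : ∀ i, f (ee K i ⊗ₜ 1) = g (ee K i ⊗ₜ 1))
    (h1 : ∀ i, f (1 ⊗ₜ ee K i) = g (1 ⊗ₜ ee K i)) : f = g :=
  Algebra.TensorProduct.ext (V_hom_ext h0) (V_hom_ext h1)

end HomExt

/-- The morphism `V^DR → gr V^B`, `e_i ↦ [X_i - 1]_1`. -/
def gV : V K →ₐ[K] Gr (Betti.augFil K Betti.F2) :=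
  UniversalEnvelopingAlgebra.lift K (FreeLieAlgebra.lift K fun i => Betti.grGen K (Betti.X i))

theorem gV_ee (i : Fin 2) : gV K (ee K i) = Betti.grGen K (Betti.X i) := by
  rw [gV, ee, UniversalEnvelopingAlgebra.lift_ι_apply]
  exact FreeLieAlgebra.lift_of_apply _ _

theorem gV_e (i : Fin 2) :
    gV K (UniversalEnvelopingAlgebra.ι K (e K i)) = Betti.grGen K (Betti.X i) := gV_ee K i

theorem gV_einf : gV K (UniversalEnvelopingAlgebra.ι K (einf K)) =
    -Betti.grGen K (Betti.X 0) - Betti.grGen K (Betti.X 1) := by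
  rw [einf, map_sub, map_neg, map_sub, map_neg, gV_e, gV_e]

/-- The morphism `V^DR ⊗ V^DR → gr (V^B ⊗ V^B)`, `e_i ⊗ 1 ↦ [(X_i - 1) ⊗ 1]_1`,
`1 ⊗ e_i ↦ [1 ⊗ (X_i - 1)]_1`. -/
def fW : VV K →ₐ[K] Gr (Betti.filVV K) :=
  Algebra.TensorProduct.lift ((Betti.grLeft K).comp (gV K)) ((Betti.grRight K).comp (gV K))
    fun _ _ => Betti.commute_grLeft_grRight K _ _

theorem fW_tmul_one (a : V K) : fW K (a ⊗ₜ 1) = Betti.grLeft K (gV K a) := by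
  refine (Algebra.TensorProduct.lift_tmul _ _ _ _ _).trans ?_
  rw [map_one]
  exact mul_one (Betti.grLeft K (gV K a))

theorem fW_one_tmul (a : V K) : fW K (1 ⊗ₜ a) = Betti.grRight K (gV K a) := by
  refine (Algebra.TensorProduct.lift_tmul _ _ _ _ _).trans ?_
  rw [map_one]
  exact one_mul (Betti.grRight K (gV K a))

/-- The class `[x_ij - 1]_1`. -/
def grX (i : Pair) : Gr (Betti.augFil K Betti.P5) := Betti.grGen K (Betti.x i)

theorem lie_eq_zero_of_commute {A : Type u} [Ring A] {a b : A} (h : Commute a b) : ⁅a, b⁆ = 0 := by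
  rw [LieRing.of_associative_ring_bracket, h.eq, sub_self]

/-- If `abc` commutes with `a`, `b` and `c`, the infinitesimal relations hold between the classes
of `a - 1`, `b - 1` and `c - 1`. -/
theorem lift_grX_triple {i j k : Pair}
    (h : Betti.tripleRels (Betti.y i) (Betti.y j) (Betti.y k) ⊆ Betti.relsK4) :
    ∀ r ∈ tripleRels (s K i) (s K j) (s K k), FreeLieAlgebra.lift K (grX K) r = 0 := by
  obtain ⟨h1, h2, h3⟩ := Betti.commute_of_tripleRels h
  have key : Betti.grGen K (Betti.projP5 (Betti.y i) * Betti.projP5 (Betti.y j) *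
      Betti.projP5 (Betti.y k)) = grX K i + grX K j + grX K k := by
    rw [Betti.grGen_mul, Betti.grGen_mul]; rfl
  have h1 : Commute (grX K i + grX K j + grX K k) (grX K i) := key ▸ Betti.commute_grGen K h1
  have h2 : Commute (grX K i + grX K j + grX K k) (grX K j) := key ▸ Betti.commute_grGen K h2
  have h3 : Commute (grX K i + grX K j + grX K k) (grX K k) := key ▸ Betti.commute_grGen K h3
  rintro r (rfl | rfl | rfl) <;>
    simp only [s, LieHom.map_lie, map_add, FreeLieAlgebra.lift_of_apply] <;>
    refine lie_eq_zero_of_commute ?_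
  · have := h1.symm.sub_right (Commute.refl _)
    rwa [add_assoc, add_sub_cancel_left] at this
  · have := h2.symm.sub_right (Commute.refl _)
    rwa [add_right_comm, add_sub_cancel_right] at this
  · have := h3.symm.sub_right (Commute.refl _)
    rwa [add_sub_cancel_right] at this

/-- The classes `[x_ij - 1]_1` satisfy the relations of `t_4`: commutators of group elements become
Lie brackets of classes, and the conjugate of `x_24` by `x_12` has the same class as `x_24`. -/
theorem lift_grX_rel (r : FreeLieAlgebra K Pair) (hr : r ∈ relst4 K) :
    FreeLieAlgebra.lift K (grX K) r = 0 := by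
  rcases hr with (((h | h) | h) | h) | h
  · exact lift_grX_triple K Betti.triple_123 r h
  · exact lift_grX_triple K Betti.triple_124 r h
  · exact lift_grX_triple K Betti.triple_134 r h
  · exact lift_grX_triple K Betti.triple_234 r h
  · rcases h with rfl | rfl | rfl <;>
      simp only [s, LieHom.map_lie, FreeLieAlgebra.lift_of_apply] <;>
      refine lie_eq_zero_of_commute ?_
    · exact Betti.commute_grGen K Betti.commute_12_34
    · have := Betti.commute_grGen K Betti.commute_13_24
      rwa [Betti.grGen_mul, Betti.grGen_mul, Betti.grGen_inv, neg_add_cancel_comm] at this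
    · exact Betti.commute_grGen K Betti.commute_14_23

/-- The relation `z_4 = 0` is the linear part of `ω_4 = 1`. -/
theorem sum_grX : grX K p12 + grX K p13 + grX K p23 + grX K p14 + grX K p24 + grX K p34 = 0 := by
  have := Betti.prod_x ▸ Betti.grGen_one K (G := Betti.P5)
  rwa [Betti.grGen_mul, Betti.grGen_mul, Betti.grGen_mul, Betti.grGen_mul, Betti.grGen_mul] at this

/-- The morphism `U(p_5) → gr (K P_5^*)`, `t_ij ↦ [x_ij - 1]_1`. -/
def Theta : Up5 K →ₐ[K] Gr (Betti.augFil K Betti.P5) :=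
  UniversalEnvelopingAlgebra.lift K (p5lift (grX K) (lift_grX_rel K) (sum_grX K))

theorem Theta_tU (i : Pair) : Theta K (tU K i) = grX K i := by
  rw [Theta, tU, UniversalEnvelopingAlgebra.lift_ι_apply, p5lift_t]

theorem Theta_uU (i : Fin 3) : Theta K (uU K i) = Betti.grGen K (Betti.x5 i) := by
  fin_cases i
  · change Theta K (uU K 0) = Betti.grGen K (Betti.x p12 * Betti.x p13 * Betti.x p14)⁻¹
    rw [uU_zero, Betti.grGen_inv, Betti.grGen_mul, Betti.grGen_mul, map_neg, map_add, map_add,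
      Theta_tU, Theta_tU, Theta_tU, add_assoc]
    rfl
  · change Theta K (uU K 1) = Betti.grGen K (Betti.x p12 * Betti.x p23 * Betti.x p24)⁻¹
    rw [uU_one, Betti.grGen_inv, Betti.grGen_mul, Betti.grGen_mul, map_neg, map_add, map_add,
      Theta_tU, Theta_tU, Theta_tU]
    rfl
  · change Theta K (uU K 2) = Betti.grGen K (Betti.x p13 * Betti.x p23 * Betti.x p34)⁻¹
    rw [uU_two, Betti.grGen_inv, Betti.grGen_mul, Betti.grGen_mul, map_neg, map_add, map_add,
      Theta_tU, Theta_tU, Theta_tU]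
    rfl

theorem Theta_surjective : Function.Surjective (Theta K) := by
  rw [← AlgHom.range_eq_top]
  refine Betti.eq_top_of_grGen_mem_of_closure K Betti.closure_x ?_
  rintro _ ⟨i, rfl⟩
  exact ⟨tU K i, Theta_tU K i⟩

theorem gV_surjective : Function.Surjective (gV K) := by
  rw [← AlgHom.range_eq_top]
  refine Betti.eq_top_of_grGen_mem_of_closure K (FreeGroup.closure_range_of (Fin 2)) ?_
  rintro _ ⟨i, rfl⟩
  exact ⟨ee K i, gV_ee K i⟩

/-- The leading term of the Magnus expansion `X_i ↦ 1 + e_i X` is a left inverse of `gV`. -/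
theorem lead_gV (a : V K) : Magnus.lead K (ee K) (gV K a) = a := by
  have : (Magnus.lead K (ee K)).comp (gV K) = AlgHom.id K _ := V_hom_ext fun i => by
    rw [AlgHom.comp_apply, gV_ee, Magnus.lead_grGen, AlgHom.id_apply]
  exact AlgHom.congr_fun this a

/-- The leading term of the tensor product of two Magnus expansions is a left inverse of `fW`. -/
theorem lead₂_fW (a : VV K) : Magnus.lead₂ K (ee K) (fW K a) = a := by
  have : (Magnus.lead₂ K (ee K)).comp (fW K) = AlgHom.id K _ := VV_hom_ext
    (fun i => by
      rw [AlgHom.comp_apply, fW_tmul_one, gV_ee, Magnus.lead₂_grLeft, AlgHom.id_apply])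
    (fun i => by
      rw [AlgHom.comp_apply, fW_one_tmul, gV_ee, Magnus.lead₂_grRight, AlgHom.id_apply])
  exact AlgHom.congr_fun this a

theorem gV_bijective : Function.Bijective (gV K) :=
  ⟨Function.LeftInverse.injective (lead_gV K), gV_surjective K⟩

theorem fW_injective : Function.Injective (fW K) := Function.LeftInverse.injective (lead₂_fW K)

theorem gV_pr1Fun (i : Pair) : gV K (UniversalEnvelopingAlgebra.ι K (pr1Fun K i)) =
    Betti.grGen K (Betti.pr1Fun i) := by
  cases i <;> simp only [pr1Fun, Betti.pr1Fun, map_zero, gV_e, gV_einf, Betti.grGen_one,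
    Betti.grGen_inv, Betti.grGen_mul, neg_add']
  abel

theorem gV_pr2Fun (i : Pair) : gV K (UniversalEnvelopingAlgebra.ι K (pr2Fun K i)) =
    Betti.grGen K (Betti.pr2Fun i) := by
  cases i <;> simp only [pr2Fun, Betti.pr2Fun, map_zero, gV_e, gV_einf, Betti.grGen_one,
    Betti.grGen_inv, Betti.grGen_mul, neg_add']

theorem gV_pr5Fun (i : Pair) : gV K (UniversalEnvelopingAlgebra.ι K (pr5Fun K i)) =
    Betti.grGen K (Betti.pr5Fun i) := by
  cases i <;> simp only [pr5Fun, Betti.pr5Fun, gV_e, gV_einf, Betti.grGen_inv, Betti.grGen_mul,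
    neg_add']
  abel

theorem grPr5_Theta (a : Up5 K) : Betti.grPr5 K (Theta K a) = gV K (Upr5 K a) := by
  have : (Betti.grPr5 K).comp (Theta K) = (gV K).comp (Upr5 K) := Up5_hom_ext fun i => by
    rw [AlgHom.comp_apply, AlgHom.comp_apply, Theta_tU, grX, Betti.grPr5_grGen, Betti.pr5_x,
      ← gV_pr5Fun, tU, Upr5, Umap_ι, pr5_t]
  exact AlgHom.congr_fun this a

theorem grPr12_Theta (a : Up5 K) : Betti.grPr12 K (Theta K a) = fW K (Upr12 K a) := by
  have : (Betti.grPr12 K).comp (Theta K) = (fW K).comp (Upr12 K) := Up5_hom_ext fun i => by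
    rw [AlgHom.comp_apply, AlgHom.comp_apply, Theta_tU, grX, Betti.grPr12_grGen, Betti.pr1_x,
      Betti.pr2_x, ← gV_pr1Fun, ← gV_pr2Fun, Upr12_tU, map_add, fW_tmul_one, fW_one_tmul]
  exact AlgHom.congr_fun this a

theorem Theta_Uell (a : V K) : Theta K (Uell K a) = Betti.grEll K (gV K a) := by
  have : (Theta K).comp (Uell K) = (Betti.grEll K).comp (gV K) := V_hom_ext fun i => by
    rw [AlgHom.comp_apply, AlgHom.comp_apply, gV_ee, Betti.grEll_grGen]
    fin_cases i
    · change Theta K (Uell K (ee K 0)) = Betti.grGen K (Betti.ell (FreeGroup.of 0))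
      rw [Uell_ee_zero, Theta_tU, Betti.ell, FreeGroup.lift_apply_of]
      rfl
    · change Theta K (Uell K (ee K 1)) = Betti.grGen K (Betti.ell (FreeGroup.of 1))
      rw [Uell_ee_one, Theta_tU, Betti.ell, FreeGroup.lift_apply_of]
      rfl
  exact AlgHom.congr_fun this a

/-- Surjectivity follows from that of `K pr_12` on each step of the filtrations and from that of
`Theta`. -/
theorem fW_bijective : Function.Bijective (fW K) := by
  refine ⟨fW_injective K, fun b => ?_⟩
  obtain ⟨a, rfl⟩ := Betti.grPr12_surjective K b
  obtain ⟨a, rfl⟩ := Theta_surjective K a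
  exact ⟨Upr12 K a, (grPr12_Theta K a).symm⟩

/-! ### Compatibility with the gradings -/

theorem mul_mem_grPart {A : Type u} [Ring A] [Algebra K A] {F : ℤ → Submodule K A}
    [IsAlgFiltration F] {i j : ℤ} {a b : Gr F} (ha : a ∈ grPart F i) (hb : b ∈ grPart F j) :
    a * b ∈ grPart F (i + j) :=
  IsAlgGrading.mul_mem i j a ha b hb

theorem grGen_mem_grPart {G : Type} [Group G] (g : G) :
    Betti.grGen K g ∈ grPart (Betti.augFil K G) 1 := ⟨_, rfl⟩

theorem gV_mem (n : ℤ) (a : V K) (ha : a ∈ gradV K n) :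
    gV K a ∈ grPart (Betti.augFil K Betti.F2) n := by
  refine map_genGrading_le IsAlgGrading.one_mem IsAlgGrading.mul_mem (gV K) (fun w hw => ?_) n a ha
  have key : Submodule.span K (Set.range fun i => UniversalEnvelopingAlgebra.ι K (e K i)) ≤
      (grPart (Betti.augFil K Betti.F2) 1).comap (gV K).toLinearMap := by
    refine Submodule.span_le.2 ?_
    rintro _ ⟨i, rfl⟩
    rw [SetLike.mem_coe, Submodule.mem_comap, AlgHom.toLinearMap_apply, gV_e]
    exact grGen_mem_grPart K _
  exact key hw

theorem Theta_mem (n : ℤ) (a : Up5 K) (ha : a ∈ gradP K n) :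
    Theta K a ∈ grPart (Betti.augFil K Betti.P5) n := by
  refine map_genGrading_le IsAlgGrading.one_mem IsAlgGrading.mul_mem (Theta K)
    (fun w hw => ?_) n a ha
  have key : Submodule.span K (Set.range fun i => UniversalEnvelopingAlgebra.ι K (t K i)) ≤
      (grPart (Betti.augFil K Betti.P5) 1).comap (Theta K).toLinearMap := by
    refine Submodule.span_le.2 ?_
    rintro _ ⟨i, rfl⟩
    rw [SetLike.mem_coe, Submodule.mem_comap, AlgHom.toLinearMap_apply]
    change Theta K (tU K i) ∈ _
    rw [Theta_tU]
    exact grGen_mem_grPart K _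
  exact key hw

theorem fW_mem (n : ℤ) (a : VV K) (ha : a ∈ gradVV K n) : fW K a ∈ grPart (Betti.filVV K) n := by
  have : gradVV K n ≤ (grPart (Betti.filVV K) n).comap (fW K).toLinearMap := by
    refine convolve_le fun i j hij x hx y hy => ?_
    have h1 : fW K (x ⊗ₜ 1) ∈ grPart (Betti.filVV K) i := by
      rw [fW_tmul_one]
      exact grAlgHom_mem_grPart _ _ _ _ (gV_mem K i x hx)
    have h2 : fW K (1 ⊗ₜ y) ∈ grPart (Betti.filVV K) j := by
      rw [fW_one_tmul]
      exact grAlgHom_mem_grPart _ _ _ _ (gV_mem K j y hy)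
    have h3 := mul_mem_grPart K h1 h2
    rw [← map_mul, Algebra.TensorProduct.tmul_mul_tmul, mul_one, one_mul, hij] at h3
    exact h3
  exact this ha

end DeRham

end

end BFSTheory

namespace BFSTheory

noncomputable section

open MulOpposite

/-! ### Maps out of the tensor product over `P` -/

section Lift

variable {K : Type u} [CommRing K] {P V W Y : Type u} [Ring P] [Algebra K P] [Ring V] [Algebra K V]
  [Ring W] [Algebra K W] [AddCommGroup Y] [Module K Y]

/-- The linear map out of `ker p ⊗_P W` given by a balanced bilinear map. -/
def KerTensor.lift (p : P →ₐ[K] V) (q : P →ₐ[K] W) (β : KerMod p →ₗ[K] W →ₗ[K] Y)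
    (h : ∀ (x : KerMod p) (a : P) (w : W), β (KerMod.mulRight p a x) w = β x (q a * w)) :
    KerTensor p q →ₗ[K] Y :=
  (kerTensorRel p q).liftQ (TensorProduct.lift β) (Submodule.span_le.2 (by
    rintro _ ⟨x, a, w, rfl⟩
    rw [SetLike.mem_coe, LinearMap.mem_ker, map_sub, TensorProduct.lift.tmul,
      TensorProduct.lift.tmul, h, sub_self]))

end Lift

/-! ### The associated graded of the Betti bimodule -/

namespace Betti

variable (K : Type u) [CommRing K] (d : ℤ)

/-- The module `M^B = ker (K pr_5) ⊗ (V^B ⊗ V^B)`, the tensor product being over `K P_5^*`. -/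
abbrev M : Type u := KerTensor (Kpr5 K) (Kpr12 K)

/-- The filtration of `M^B`, shifted by `d`. -/
def filM (n : ℤ) : Submodule K (M K) := KerTensor.fil (Kpr5 K) (Kpr12 K) (augFil K P5) (n + d)

/-- The right action of `gr (V^B ⊗ V^B)` on `gr M^B`. -/
def actGr : Gr (filM K d) →ₗ[K] Gr (filVV K) →ₗ[K] Gr (filM K d) := (bimodule K d).grAct

/-- The left action of `gr V^B` on `gr M^B`. -/
def lactGr : Gr (augFil K F2) →ₗ[K] Gr (filM K d) →ₗ[K] Gr (filM K d) := (bimodule K d).grLact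

theorem op_smul_mem_filM {i j : ℤ} {m : M K} (hm : m ∈ filM K d i) {w : VV K}
    (hw : w ∈ filVV K j) : op w • m ∈ filM K d (i + j) := (bimodule K d).act_mem i j m hm w hw

theorem actL_mem_filM {i j : ℤ} {v : V K} (hv : v ∈ augFil K F2 i) {m : M K}
    (hm : m ∈ filM K d j) : KerTensor.actL (Kpr5 K) (Kpr12 K) (Kell K v) m ∈ filM K d (i + j) :=
  (bimodule K d).ρ_mem i j v hv m hm

theorem actGr_cls (i j : ℤ) (m : filM K d i) (w : filVV K j) :
    actGr K d (cls _ i m) (cls _ j w) =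
      cls (filM K d) (i + j) ⟨op (w : VV K) • (m : M K), op_smul_mem_filM K d m.2 w.2⟩ :=
  (bimodule K d).grAct_cls i j m w

theorem lactGr_cls (i j : ℤ) (v : augFil K F2 i) (m : filM K d j) :
    lactGr K d (cls _ i v) (cls _ j m) =
      cls (filM K d) (i + j) ⟨KerTensor.actL (Kpr5 K) (Kpr12 K) (Kell K (v : V K)) (m : M K),
        actL_mem_filM K d v.2 m.2⟩ :=
  (bimodule K d).grLact_cls i j v m

theorem actGr_one (μ : Gr (filM K d)) : actGr K d μ 1 = μ := (bimodule K d).grAct_one μ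

theorem actGr_mul (μ : Gr (filM K d)) (a b : Gr (filVV K)) :
    actGr K d μ (a * b) = actGr K d (actGr K d μ a) b := (bimodule K d).grAct_mul μ a b

theorem lactGr_actGr (v : Gr (augFil K F2)) (μ : Gr (filM K d)) (a : Gr (filVV K)) :
    lactGr K d v (actGr K d μ a) = actGr K d (lactGr K d v μ) a :=
  (bimodule K d).grLact_grAct v μ a

/-- The projection `a ↦ a - ℓ (pr_5 a)` of `K P_5^*` onto `ker (K pr_5)`. -/
def kerProj : KP5 K →ₗ[K] KerMod (Kpr5 K) where
  toFun a := KerMod.mk (a - Kell K (Kpr5 K a)) (by rw [map_sub, Kpr5_Kell, sub_self])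
  map_add' a b := KerMod.ext (by
    rw [map_add (KerMod.incl (Kpr5 K))]
    simp only [KerMod.incl_mk, map_add]
    abel)
  map_smul' k a := KerMod.ext (by
    rw [map_smul (KerMod.incl (Kpr5 K))]
    simp only [KerMod.incl_mk, map_smul, smul_sub, RingHom.id_apply])

theorem incl_kerProj (a : KP5 K) : KerMod.incl (Kpr5 K) (kerProj K a) = a - Kell K (Kpr5 K a) := rfl

/-- The map `K P_5^* → M^B`, `a ↦ (a - ℓ (pr_5 a)) ⊗ 1`. -/
def delta : KP5 K →ₗ[K] M K := ((KerTensor.tmul (Kpr5 K) (Kpr12 K)).flip 1).comp (kerProj K)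

theorem delta_apply (a : KP5 K) : delta K a = KerTensor.tmul _ _ (kerProj K a) 1 := rfl

theorem delta_Kell (v : V K) : delta K (Kell K v) = 0 := by
  have : kerProj K (Kell K v) = 0 := KerMod.ext (by
    rw [incl_kerProj, Kpr5_Kell, sub_self, map_zero])
  rw [delta_apply, this, map_zero, LinearMap.zero_apply]

theorem delta_uP (i : Fin 3) : delta K (uP K i) = m K i := by
  have : kerProj K (uP K i) = u K i := KerMod.ext (by
    rw [incl_kerProj, Kpr5_uP, map_zero, sub_zero, incl_u])
  rw [delta_apply, this]
  rfl

/-- The map `a ↦ (a - ℓ (pr_5 a)) ⊗ 1` is a derivation, for the right action through `pr_12` and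
the left action through `ℓ ∘ pr_5`. -/
theorem delta_mul (a b : KP5 K) : delta K (a * b) =
    op (Kpr12 K b) • delta K a +
      KerTensor.actL (Kpr5 K) (Kpr12 K) (Kell K (Kpr5 K a)) (delta K b) := by
  have : kerProj K (a * b) = KerMod.mulRight _ b (kerProj K a) +
      KerMod.mulLeft _ (Kell K (Kpr5 K a)) (kerProj K b) := KerMod.ext (by
    rw [map_add, incl_kerProj, map_mul, map_mul]
    change _ = (a - Kell K (Kpr5 K a)) * b + Kell K (Kpr5 K a) * (b - Kell K (Kpr5 K b))
    noncomm_ring)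
  rw [delta_apply, this, map_add, LinearMap.add_apply, KerTensor.tmul_mul, delta_apply, delta_apply,
    KerTensor.actL_tmul, KerTensor.op_smul_tmul, one_mul, mul_one]

theorem delta_mem (n : ℤ) (a : KP5 K) (ha : a ∈ augFil K P5 n) : delta K a ∈ filM K d (n + -d) := by
  refine ⟨kerProj K a, ?_, rfl⟩
  rw [SetLike.mem_coe, Submodule.mem_comap, incl_kerProj, neg_add_cancel_right]
  exact sub_mem ha (Kell_mem K n _ (Kpr5_mem n a ha))

/-- The map `gr (K P_5^*) → gr M^B` of degree `-d` induced by `a ↦ (a - ℓ (pr_5 a)) ⊗ 1`. -/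
def grDelta : Gr (augFil K P5) →ₗ[K] Gr (filM K d) := grMap _ _ (-d) (delta K) (delta_mem K d)

theorem grDelta_cls (n : ℤ) (a : augFil K P5 n) :
    grDelta K d (cls _ n a) = cls (filM K d) (n + -d) ⟨delta K a, delta_mem K d n a a.2⟩ :=
  grMap_cls _ _ _ _ _ _ _

theorem grDelta_grEll (v : Gr (augFil K F2)) : grDelta K d (grEll K v) = 0 := by
  induction v using gr_induction with
  | h0 => rw [map_zero, map_zero]
  | ha a b h h' => rw [map_add, map_add, h, h', add_zero]
  | hc n v =>
    rw [grEll, grAlgHom_cls, grDelta_cls]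
    refine cls_eq_zero _ ?_
    change delta K (Kell K v) ∈ _
    rw [delta_Kell]
    exact zero_mem _

theorem grDelta_grGen_x5 (i : Fin 3) : grDelta K d (grGen K (x5 i)) =
    cls (filM K d) (1 - d) ⟨m K i, m_mem K d i⟩ := by
  rw [grGen, grDelta_cls]
  exact cls_congr (sub_eq_add_neg 1 d).symm (delta_uP K i)

/-- The graded version of `delta_mul`. -/
theorem grDelta_mul (a b : Gr (augFil K P5)) : grDelta K d (a * b) =
    actGr K d (grDelta K d a) (grPr12 K b) + lactGr K d (grPr5 K a) (grDelta K d b) := by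
  induction a using gr_induction with
  | h0 => simp only [zero_mul, map_zero, LinearMap.zero_apply, add_zero]
  | ha a a' h h' =>
    simp only [add_mul, map_add, LinearMap.add_apply, h, h']
    abel
  | hc i a =>
    induction b using gr_induction with
    | h0 => simp only [mul_zero, map_zero, add_zero]
    | ha b b' h h' =>
      simp only [mul_add, map_add, h, h']
      abel
    | hc j b =>
      rw [gr_mul_cls, grPr5, grPr12, grAlgHom_cls, grAlgHom_cls, grDelta_cls, grDelta_cls,
        grDelta_cls, actGr_cls, lactGr_cls]
      have ha : Kpr5 K (a : KP5 K) ∈ augFil K F2 i := Kpr5_mem (K := K) i _ a.2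
      have hb : delta K (b : KP5 K) ∈ filM K d (j + -d) := delta_mem K d j b b.2
      have ha' : delta K (a : KP5 K) ∈ filM K d (i + -d) := delta_mem K d i a a.2
      have hb' : Kpr12 K (b : KP5 K) ∈ filVV K j := Kpr12_mem_filVV K j b b.2
      have h1 := op_smul_mem_filM K d ha' hb'
      have h2 := actL_mem_filM K d ha hb
      have e1 : cls (filM K d) (i + -d + j) ⟨_, h1⟩ =
          cls (filM K d) (i + j + -d) ⟨_, add_right_comm i (-d) j ▸ h1⟩ :=
        cls_congr (add_right_comm _ _ _) rfl
      have e2 : cls (filM K d) (i + (j + -d)) ⟨_, h2⟩ =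
          cls (filM K d) (i + j + -d) ⟨_, (add_assoc i j (-d)).symm ▸ h2⟩ :=
        cls_congr (add_assoc _ _ _).symm rfl
      refine Eq.trans ?_ (congrArg₂ (· + ·) e1 e2).symm
      rw [← map_add]
      exact cls_congr rfl (delta_mul K a b)

theorem coord_op_smul (j : Fin 3) (w : VV K) (μ : M K) :
    coord K j (op w • μ) = coord K j μ * w := by
  induction μ using KerTensor.induction with
  | h0 => rw [smul_zero, map_zero, zero_mul]
  | ha a b h h' => rw [smul_add, map_add, map_add, h, h', add_mul]
  | ht x w' => rw [KerTensor.op_smul_tmul, coord_tmul, coord_tmul, mul_assoc]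

theorem coord_mem_filVV (j : Fin 3) (n : ℤ) (μ : M K) (hμ : μ ∈ filM K d n) :
    coord K j μ ∈ filVV K (n + (d - 1)) := by
  have := coord_mem (n := n + d) hμ j
  rwa [add_sub_assoc] at this

/-- The map of degree `d - 1` induced on the associated graded by the `j`-th coordinate. -/
def grCoord (j : Fin 3) : Gr (filM K d) →ₗ[K] Gr (filVV K) :=
  grMap _ _ (d - 1) (coord K j) (coord_mem_filVV K d j)

theorem grCoord_cls (j : Fin 3) (n : ℤ) (μ : filM K d n) : grCoord K d j (cls _ n μ) =
    cls (filVV K) (n + (d - 1)) ⟨coord K j μ, coord_mem_filVV K d j n μ μ.2⟩ :=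
  grMap_cls _ _ _ _ _ _ _

theorem grCoord_actGr (j : Fin 3) (μ : Gr (filM K d)) (w : Gr (filVV K)) :
    grCoord K d j (actGr K d μ w) = grCoord K d j μ * w := by
  induction μ using gr_induction with
  | h0 => simp only [zero_mul, map_zero, LinearMap.zero_apply]
  | ha a a' h h' => simp only [add_mul, map_add, LinearMap.add_apply, h, h']
  | hc i a =>
    induction w using gr_induction with
    | h0 =>
      rw [map_zero, map_zero]
      exact (mul_zero (grCoord K d j (cls (filM K d) i a))).symm
    | ha b b' h h' => simp only [mul_add, map_add, h, h']
    | hc k b =>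
      rw [actGr_cls, grCoord_cls, grCoord_cls, gr_mul_cls]
      exact cls_congr (add_right_comm _ _ _) (coord_op_smul K j _ _)

theorem coord_m (j i : Fin 3) : coord K j (m K i) = if j = i then 1 else 0 := by
  have : m K i = kappa K (Pi.single i 1) := by
    change _ = ∑ k, KerTensor.tmul _ _ (u K k) (Pi.single (M := fun _ => VV K) i 1 k)
    rw [Finset.sum_eq_single i (fun k _ h => by rw [Pi.single_eq_of_ne h, map_zero])
      (fun h => absurd (Finset.mem_univ i) h), Pi.single_eq_same]
    rfl
  rw [this, coord_kappa, Pi.single_apply]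

/-- The class of `(x_i5 - 1) ⊗ 1` in `gr M^B`. -/
def mGr (i : Fin 3) : Gr (filM K d) := cls (filM K d) (1 - d) ⟨m K i, m_mem K d i⟩

theorem grCoord_mGr (j i : Fin 3) : grCoord K d j (mGr K d i) = if j = i then 1 else 0 := by
  rw [mGr, grCoord_cls]
  split_ifs with h
  · rw [gr_one]
    refine cls_congr (by ring) ?_
    change coord K j (m K i) = 1
    rw [coord_m, if_pos h]
  · refine cls_eq_zero _ ?_
    change coord K j (m K i) ∈ _
    rw [coord_m, if_neg h]
    exact zero_mem _

/-- The classes `[(x_i5 - 1) ⊗ 1]` are linearly independent over `gr (V^B ⊗ V^B)`, with coordinates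
`grCoord`. -/
theorem grCoord_sum (j : Fin 3) (a : Fin 3 → Gr (filVV K)) :
    grCoord K d j (∑ i, actGr K d (mGr K d i) (a i)) = a j := by
  rw [map_sum, Finset.sum_eq_single j]
  · rw [grCoord_actGr, grCoord_mGr, if_pos rfl]
    exact one_mul (a j)
  · intro i _ h
    rw [grCoord_actGr, grCoord_mGr, if_neg h.symm, zero_mul]
  · exact fun h => absurd (Finset.mem_univ j) h

/-- The elements `(x_i5 - 1) ⊗ 1` generate `M^B`, with coefficients the coordinate functions. -/
theorem eq_sum_op_smul_m (μ : M K) : μ = ∑ i, op (coord K i μ) • m K i := by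
  obtain ⟨a, rfl⟩ := (kappa_bijective K).2 μ
  simp only [coord_kappa]
  change ∑ i, KerTensor.tmul _ _ (u K i) (a i) = _
  refine Finset.sum_congr rfl fun i _ => ?_
  rw [m, KerTensor.op_smul_tmul, one_mul]

/-- The classes `[(x_i5 - 1) ⊗ 1]` generate `gr M^B`. Together with `grCoord_sum`, they form a
basis. -/
theorem sum_actGr_grCoord (μ : Gr (filM K d)) :
    ∑ i, actGr K d (mGr K d i) (grCoord K d i μ) = μ := by
  induction μ using gr_induction with
  | h0 => simp only [map_zero, Finset.sum_const_zero]
  | ha a b h h' => simp only [map_add, Finset.sum_add_distrib, h, h']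
  | hc n μ =>
    have h1 : ∀ i, op (coord K i (μ : M K)) • m K i ∈ filM K d n := fun i => by
      have := op_smul_mem_filM K d (m_mem K d i) (coord_mem_filVV K d i n μ μ.2)
      rwa [show 1 - d + (n + (d - 1)) = n by ring] at this
    have h2 : ∀ i, actGr K d (mGr K d i) (grCoord K d i (cls _ n μ)) =
        cls (filM K d) n ⟨_, h1 i⟩ := fun i => by
      rw [mGr, grCoord_cls, actGr_cls]
      exact cls_congr (by ring) rfl
    simp only [h2]
    rw [← map_sum]
    refine cls_congr rfl ?_
    rw [AddSubmonoidClass.coe_finsetSum]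
    exact (eq_sum_op_smul_m K (μ : M K)).symm

end Betti

end

end BFSTheory

namespace BFSTheory

noncomputable section

open MulOpposite

/-! ### Graded bijections -/

section GradedBij

variable {K : Type u} [CommRing K] {X Y : Type u} [AddCommGroup X] [Module K X]
  [AddCommGroup Y] [Module K Y]

/-- A bijective linear map of degree `0` between graded modules reflects homogeneity. -/
theorem mem_of_map_mem {P : ℤ → Submodule K X} {Q : ℤ → Submodule K Y}
    (hP : DirectSum.IsInternal P) (hQ : DirectSum.IsInternal Q) {f : X →ₗ[K] Y}
    (hf : Function.Injective f) (h : ∀ n, ∀ x ∈ P n, f x ∈ Q n) {n : ℤ} {x : X} (hx : f x ∈ Q n) :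
    x ∈ P n := by
  have hsup : x ∈ P n ⊔ ⨆ k, ⨆ (_ : k ≠ n), P k := by
    have : x ∈ ⨆ k, P k := hP.submodule_iSup_eq_top ▸ Submodule.mem_top
    refine (iSup_le fun k => ?_ : ⨆ k, P k ≤ _) this
    rcases eq_or_ne k n with rfl | hk
    · exact le_sup_left
    · exact le_sup_of_le_right (le_iSup₂_of_le k hk le_rfl)
  obtain ⟨a, ha, b, hb, rfl⟩ := Submodule.mem_sup.1 hsup
  have hfb : f b ∈ ⨆ k, ⨆ (_ : k ≠ n), Q k := by
    have : ⨆ k, ⨆ (_ : k ≠ n), P k ≤ (⨆ k, ⨆ (_ : k ≠ n), Q k).comap f :=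
      iSup₂_le fun k hk y hy => (le_iSup₂_of_le k hk le_rfl : Q k ≤ _) (h k y hy)
    exact this hb
  have hfb' : f b ∈ Q n := by
    rw [map_add] at hx
    exact (Submodule.add_mem_iff_right _ (h n a ha)).1 hx
  have : f b = 0 := (Submodule.disjoint_def.1 (hQ.submodule_iSupIndep n)) _ hfb' hfb
  rw [(map_eq_zero_iff f hf).1 this, add_zero]
  exact ha

end GradedBij

namespace DeRham

attribute [local instance] LieRing.ofAssociativeRing

variable (K : Type u) [CommRing K] (d : ℤ)

/-! ### Comparison of the modules -/

/-- The module `M^DR = ker (U(pr_5)) ⊗ (V^DR ⊗ V^DR)`, the tensor product being over `U(p_5)`. -/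
abbrev M : Type u := KerTensor (Upr5 K) (Upr12 K)

/-- The map `ker (U(pr_5)) → gr M^B` which composes `Theta` with the associated graded of
`a ↦ (a - ℓ (pr_5 a)) ⊗ 1`. The latter is defined on all of `gr (K P_5^*)`, so elements of the
kernel need not be lifted to `ker (K pr_5)`. -/
def kerToGr : KerMod (Upr5 K) →ₗ[K] Gr (Betti.filM K d) :=
  (Betti.grDelta K d).comp ((Theta K).toLinearMap.comp (KerMod.incl (Upr5 K)))

theorem kerToGr_apply (x : KerMod (Upr5 K)) :
    kerToGr K d x = Betti.grDelta K d (Theta K (KerMod.incl _ x)) := rfl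

/-- In the derivation rule for `grDelta`, the second term vanishes on the kernel of `U(pr_5)`. -/
theorem kerToGr_mulRight (a : Up5 K) (x : KerMod (Upr5 K)) :
    kerToGr K d (KerMod.mulRight _ a x) =
      Betti.actGr K d (kerToGr K d x) (fW K (Upr12 K a)) := by
  change Betti.grDelta K d (Theta K (KerMod.incl _ x * a)) = _
  rw [map_mul, Betti.grDelta_mul, grPr5_Theta, KerMod.map_incl, map_zero, map_zero,
    LinearMap.zero_apply, add_zero, grPr12_Theta, kerToGr_apply]

/-- In the derivation rule for `grDelta`, the first term vanishes on the image of `U(ℓ)`. -/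
theorem kerToGr_mulLeft (v : V K) (x : KerMod (Upr5 K)) :
    kerToGr K d (KerMod.mulLeft _ (Uell K v) x) = Betti.lactGr K d (gV K v) (kerToGr K d x) := by
  change Betti.grDelta K d (Theta K (Uell K v * KerMod.incl _ x)) = _
  rw [map_mul, Betti.grDelta_mul, Theta_Uell, Betti.grDelta_grEll, map_zero, LinearMap.zero_apply,
    zero_add, ← Theta_Uell, grPr5_Theta, Upr5_Uell, kerToGr_apply]

theorem kerToGr_u (i : Fin 3) : kerToGr K d (u K i) = Betti.mGr K d i := by
  rw [kerToGr_apply, incl_u, Theta_uU, Betti.grDelta_grGen_x5, Betti.mGr]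

/-- The morphism `φ : M^DR → gr M^B`, which sends `x ⊗ w` to `kerToGr x · fW w`. -/
def phi : M K →ₗ[K] Gr (Betti.filM K d) :=
  KerTensor.lift (Upr5 K) (Upr12 K)
    (((Betti.actGr K d).comp (kerToGr K d)).compl₂ (fW K).toLinearMap) fun x a w => by
      change Betti.actGr K d (kerToGr K d (KerMod.mulRight _ a x)) (fW K w) =
        Betti.actGr K d (kerToGr K d x) (fW K (Upr12 K a * w))
      rw [kerToGr_mulRight, map_mul, Betti.actGr_mul]

theorem phi_tmul (x : KerMod (Upr5 K)) (w : VV K) :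
    phi K d (KerTensor.tmul _ _ x w) = Betti.actGr K d (kerToGr K d x) (fW K w) := rfl

theorem phi_op_smul (w : VV K) (μ : M K) :
    phi K d (op w • μ) = Betti.actGr K d (phi K d μ) (fW K w) := by
  induction μ using KerTensor.induction with
  | h0 => rw [smul_zero, map_zero, map_zero, LinearMap.zero_apply]
  | ha a b h h' => rw [smul_add, map_add, map_add, map_add, LinearMap.add_apply, h, h']
  | ht x w' => rw [KerTensor.op_smul_tmul, phi_tmul, phi_tmul, map_mul, Betti.actGr_mul]

theorem phi_actL (v : V K) (μ : M K) :
    phi K d (KerTensor.actL _ _ (Uell K v) μ) = Betti.lactGr K d (gV K v) (phi K d μ) := by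
  induction μ using KerTensor.induction with
  | h0 => rw [map_zero, map_zero, map_zero]
  | ha a b h h' => rw [map_add, map_add, map_add, map_add, h, h']
  | ht x w => rw [KerTensor.actL_tmul, phi_tmul, phi_tmul, kerToGr_mulLeft, Betti.lactGr_actGr]

theorem phi_m (i : Fin 3) : phi K d (m K i) = Betti.mGr K d i := by
  rw [m, phi_tmul, kerToGr_u, map_one]
  exact Betti.actGr_one K d _

theorem phi_kappa (a : Fin 3 → VV K) :
    phi K d (kappa K a) = ∑ i, Betti.actGr K d (Betti.mGr K d i) (fW K (a i)) := by
  change phi K d (∑ i, KerTensor.tmul _ _ (u K i) (a i)) = _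
  rw [map_sum]
  refine Finset.sum_congr rfl fun i _ => ?_
  rw [phi_tmul, kerToGr_u]

/-- In the coordinates given by `κ_DR` and by the basis `[(x_i5 - 1) ⊗ 1]` of `gr M^B`, the morphism
`φ` is `fW` on each component. -/
theorem grCoord_phi_kappa (a : Fin 3 → VV K) (j : Fin 3) :
    Betti.grCoord K d j (phi K d (kappa K a)) = fW K (a j) := by
  rw [phi_kappa, Betti.grCoord_sum K d j fun i => fW K (a i)]

/-- A family killed by `κ_DR` is killed by `φ ∘ κ_DR`, which is `fW` on each component, and `fW` is
injective. -/
theorem kappa_bijective : Function.Bijective (kappa K) := by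
  refine ⟨fun a b h => funext fun j => fW_injective K ?_, kappa_surjective K⟩
  -- the filtration plays no role here, so any shift can be used
  rw [← grCoord_phi_kappa K 0 a j, h, grCoord_phi_kappa]

theorem phi_bijective : Function.Bijective (phi K d) := by
  constructor
  · rw [injective_iff_map_eq_zero]
    intro μ hμ
    obtain ⟨a, rfl⟩ := kappa_surjective K μ
    have : a = 0 := funext fun j => fW_injective K (by
      rw [← grCoord_phi_kappa K d a j, hμ, map_zero]
      exact (map_zero (fW K)).symm)
    rw [this, map_zero]
  · intro μ
    choose a ha using fun j => (fW_bijective K).2 (Betti.grCoord K d j μ)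
    refine ⟨kappa K a, ?_⟩
    rw [phi_kappa]
    simp only [ha]
    exact Betti.sum_actGr_grCoord K d μ

/-! ### Gradings -/

/-- The grading of `M^DR`, shifted by `d`. -/
def gradM (n : ℤ) : Submodule K (M K) :=
  KerTensor.grading (Upr5 K) (Upr12 K) (gradP K) (gradVV K) (n + d)

theorem actGr_mem {i j : ℤ} {μ : Gr (Betti.filM K d)} (hμ : μ ∈ grPart (Betti.filM K d) i)
    {w : Gr (Betti.filVV K)} (hw : w ∈ grPart (Betti.filVV K) j) :
    Betti.actGr K d μ w ∈ grPart (Betti.filM K d) (i + j) := by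
  obtain ⟨μ, rfl⟩ := hμ
  obtain ⟨w, rfl⟩ := hw
  rw [Betti.actGr_cls]
  exact ⟨_, rfl⟩

theorem grDelta_mem {n : ℤ} {a : Gr (Betti.augFil K Betti.P5)}
    (ha : a ∈ grPart (Betti.augFil K Betti.P5) n) :
    Betti.grDelta K d a ∈ grPart (Betti.filM K d) (n + -d) := by
  obtain ⟨a, rfl⟩ := ha
  rw [Betti.grDelta_cls]
  exact ⟨_, rfl⟩

theorem grCoord_mem (j : Fin 3) {n : ℤ} {μ : Gr (Betti.filM K d)}
    (hμ : μ ∈ grPart (Betti.filM K d) n) :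
    Betti.grCoord K d j μ ∈ grPart (Betti.filVV K) (n + (d - 1)) := by
  obtain ⟨μ, rfl⟩ := hμ
  rw [Betti.grCoord_cls]
  exact ⟨_, rfl⟩

theorem phi_mem (n : ℤ) (μ : M K) (hμ : μ ∈ gradM K d n) :
    phi K d μ ∈ grPart (Betti.filM K d) n := by
  have : gradM K d n ≤ (grPart (Betti.filM K d) n).comap (phi K d) := by
    refine convolve_le fun i j hij x hx w hw => ?_
    rw [Submodule.mem_comap, phi_tmul]
    have h := actGr_mem K d (grDelta_mem K d (Theta_mem K i _ hx)) (fW_mem K j w hw)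
    rwa [show i + -d + j = n by omega] at h
  exact this hμ

/-- The coordinates given by `κ` are homogeneous of degree `d - 1`. -/
theorem mem_gradVV_of_kappa_mem {n : ℤ} {a : Fin 3 → VV K} (ha : kappa K a ∈ gradM K d n)
    (j : Fin 3) : a j ∈ gradVV K (n + (d - 1)) := by
  have h := grCoord_mem K d j (phi_mem K d n _ ha)
  rw [grCoord_phi_kappa] at h
  exact mem_of_map_mem (gradVV_isAlgGrading K).isInternal (grPart_isInternal _)
    (f := (fW K).toLinearMap) (fW_injective K) (fW_mem K) h

theorem u_mem (i : Fin 3) : u K i ∈ KerMod.grading (Upr5 K) (gradP K) 1 := by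
  have h : ∀ j, tU K j ∈ gradP K 1 := fun j => ι_mem_Ugrading (t K) j
  change uU K i ∈ gradP K 1
  fin_cases i
  · change uU K 0 ∈ _
    rw [uU_zero]
    exact neg_mem (add_mem (h _) (add_mem (h _) (h _)))
  · change uU K 1 ∈ _
    rw [uU_one]
    exact neg_mem (add_mem (add_mem (h _) (h _)) (h _))
  · change uU K 2 ∈ _
    rw [uU_two]
    exact neg_mem (add_mem (add_mem (h _) (h _)) (h _))

theorem kappa_mem {n : ℤ} {a : Fin 3 → VV K} (ha : ∀ j, a j ∈ gradVV K (n + (d - 1))) :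
    kappa K a ∈ gradM K d n := by
  change ∑ i, KerTensor.tmul _ _ (u K i) (a i) ∈ gradM K d n
  exact sum_mem fun i _ => mem_convolve' (by ring) (u_mem K i) (ha i)

end DeRham

end

end BFSTheory

namespace BFSTheory

noncomputable section

open MulOpposite CategoryTheory

/-! ### Isomorphisms of graded bimodules -/

section Isos

variable {K : Type u} [CommRing K]

/-- A morphism of graded bimodules with bijective components is an isomorphism. -/
def GrBimodule.isoOfBijective {X Y : GrBimodule K} (Φ : X ⟶ Y) (hg : Function.Bijective Φ.g)
    (hφ : Function.Bijective Φ.φ) (hf : Function.Bijective Φ.f) : X ≅ Y :=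
  let g := AlgEquiv.ofBijective Φ.g hg
  let φ := LinearEquiv.ofBijective Φ.φ hφ
  let f := AlgEquiv.ofBijective Φ.f hf
  have eg : ∀ b, Φ.g (g.symm b) = b := g.apply_symm_apply
  have eφ : ∀ b, Φ.φ (φ.symm b) = b := φ.apply_symm_apply
  have ef : ∀ b, Φ.f (f.symm b) = b := f.apply_symm_apply
  { hom := Φ
    inv :=
      { g := g.symm
        φ := φ.symm
        f := f.symm
        map_act := fun m a => hφ.1 (by
          change Φ.φ (φ.symm _) = Φ.φ (op (f.symm a) • φ.symm m)
          rw [Φ.map_act, eφ, eφ, ef])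
        map_ρ := fun b m => hφ.1 (by
          change Φ.φ (φ.symm _) = Φ.φ (X.ρ (g.symm b) (φ.symm m))
          rw [Φ.map_ρ, eφ, eφ, eg])
        g_mem := fun n b hb => mem_of_map_mem X.grB.isInternal Y.grB.isInternal
          (f := Φ.g.toLinearMap) hg.1 Φ.g_mem ((eg b).symm ▸ hb)
        φ_mem := fun n b hb => mem_of_map_mem X.isInternalM Y.isInternalM hφ.1 Φ.φ_mem
          ((eφ b).symm ▸ hb)
        f_mem := fun n b hb => mem_of_map_mem X.grA.isInternal Y.grA.isInternal
          (f := Φ.f.toLinearMap) hf.1 Φ.f_mem ((ef b).symm ▸ hb) }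
    hom_inv_id := GrBimodule.Hom.ext (AlgHom.ext g.symm_apply_apply)
      (LinearMap.ext φ.symm_apply_apply) (AlgHom.ext f.symm_apply_apply)
    inv_hom_id := GrBimodule.Hom.ext (AlgHom.ext g.apply_symm_apply)
      (LinearMap.ext φ.apply_symm_apply) (AlgHom.ext f.apply_symm_apply) }

/-- An isomorphism of graded bimodules compatible with factorization structures is an isomorphism
in `BFS_gr`. -/
def BFSGr.isoOfIso {P Q : BFSGr K} (Φ : P.X ≅ Q.X) (he : Φ.hom.g P.S.e = Q.S.e)
    (hr : ∀ m, Φ.hom.f (P.S.r m) = Q.S.r (Φ.hom.φ m))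
    (hc : ∀ a, Φ.hom.φ (P.S.c a) = Q.S.c (Φ.hom.f a)) : P ≅ Q :=
  have eg : ∀ b, Φ.inv.g (Φ.hom.g b) = b := fun b =>
    congrArg (fun h : P.X ⟶ P.X => h.g b) Φ.hom_inv_id
  have eφ : ∀ b, Φ.inv.φ (Φ.hom.φ b) = b := fun b =>
    congrArg (fun h : P.X ⟶ P.X => h.φ b) Φ.hom_inv_id
  have ef : ∀ b, Φ.inv.f (Φ.hom.f b) = b := fun b =>
    congrArg (fun h : P.X ⟶ P.X => h.f b) Φ.hom_inv_id
  have eφ' : ∀ b, Φ.hom.φ (Φ.inv.φ b) = b := fun b =>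
    congrArg (fun h : Q.X ⟶ Q.X => h.φ b) Φ.inv_hom_id
  have ef' : ∀ b, Φ.hom.f (Φ.inv.f b) = b := fun b =>
    congrArg (fun h : Q.X ⟶ Q.X => h.f b) Φ.inv_hom_id
  { hom := { hom := Φ.hom, map_e := he, map_r := hr, map_c := hc }
    inv :=
      { hom := Φ.inv
        map_e := by rw [← he, eg]
        map_r := fun m => by rw [← eφ' m, ← hr, ef, eφ]
        map_c := fun a => by rw [← ef' a, ← hc, eφ, ef] }
    hom_inv_id := BFSGr.Hom.ext Φ.hom_inv_id
    inv_hom_id := BFSGr.Hom.ext Φ.inv_hom_id }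

end Isos

/-! ### The factorization structure on the de Rham side -/

namespace DeRham

attribute [local instance] LieRing.ofAssociativeRing

variable (K : Type u) [CommRing K]

theorem ee_mem (i : Fin 2) : ee K i ∈ gradV K 1 := ι_mem_Ugrading (e K) i

theorem ee_tmul_mem (i : Fin 2) : ee K i ⊗ₜ[K] (1 : V K) ∈ gradVV K 1 :=
  mem_convolve' (β := TensorProduct.mk K (V K) (V K)) (add_zero 1) (ee_mem K i)
    (gradV_isAlgGrading K).one_mem

theorem tmul_ee_mem (i : Fin 2) : (1 : V K) ⊗ₜ[K] ee K i ∈ gradVV K 1 :=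
  mem_convolve' (β := TensorProduct.mk K (V K) (V K)) (zero_add 1) (gradV_isAlgGrading K).one_mem
    (ee_mem K i)

theorem row_mem (j : Fin 3) : row K j ∈ gradVV K 0 := by
  have h := (gradVV_isAlgGrading K).one_mem
  fin_cases j
  exacts [h, neg_mem h, Submodule.zero_mem _]

theorem col_mem (j : Fin 3) : col K j ∈ gradVV K 1 := by
  fin_cases j
  exacts [ee_tmul_mem K 1, neg_mem (tmul_ee_mem K 1), Submodule.zero_mem _]

/-- `κ` as an isomorphism of right modules. -/
def kappaEquiv : (Fin 3 → VV K) ≃ₗ[(VV K)ᵐᵒᵖ] M K :=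
  LinearEquiv.ofBijective (kappa K) (kappa_bijective K)

/-- The morphism `r` of `O^DR`: the row, applied to the coordinates given by `κ_DR`. -/
def factR : M K →ₗ[(VV K)ᵐᵒᵖ] VV K := rowMap (row K) ∘ₗ (kappaEquiv K).symm.toLinearMap

/-- The morphism `c` of `O^DR`: the column, seen in `M^DR` through `κ_DR`. -/
def factC : VV K →ₗ[(VV K)ᵐᵒᵖ] M K := kappa K ∘ₗ colMap (col K)

theorem factR_kappa (a : Fin 3 → VV K) : factR K (kappa K a) = rowMap (row K) a :=
  congrArg (rowMap (row K)) ((kappaEquiv K).symm_apply_apply a)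

theorem factR_mem {n : ℤ} {μ : M K} (hμ : μ ∈ gradM K 1 n) : factR K μ ∈ gradVV K n := by
  obtain ⟨a, rfl⟩ := (kappa_bijective K).2 μ
  rw [factR_kappa]
  change ∑ i, row K i * a i ∈ gradVV K n
  refine sum_mem fun i _ => ?_
  have h := (gradVV_isAlgGrading K).mul_mem 0 _ _ (row_mem K i) _ (mem_gradVV_of_kappa_mem K 1 hμ i)
  rwa [show 0 + (n + (1 - 1)) = n by ring] at h

theorem factC_mem {n : ℤ} {a : VV K} (ha : a ∈ gradVV K n) : factC K a ∈ gradM K 1 (n + 1) := by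
  refine kappa_mem K 1 fun i => ?_
  have h := (gradVV_isAlgGrading K).mul_mem 1 n _ (col_mem K i) _ ha
  rwa [show 1 + n = n + 1 + (1 - 1) by ring] at h

/-- The factorization structure of `O^DR`. -/
def factorization : GrFactorization (bimodule K 1) where
  e := ee K 1
  r := factR K
  c := factC K
  ρ_e := LinearMap.ext fun μ => by
    obtain ⟨a, rfl⟩ := (kappa_bijective K).2 μ
    exact (actL_e_kappa K a).trans (congrArg (factC K) (factR_kappa K a).symm)
  e_mem := ee_mem K 1
  r_mem n m hm := factR_mem K hm
  c_mem n a ha := factC_mem K ha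

theorem isFactorization_factorization : IsFactorization K (factorization K) :=
  ⟨rfl, LinearMap.ext (f := factR K ∘ₗ kappa K) (factR_kappa K), rfl⟩

variable {K} in
theorem IsFactorization.r_kappa {S : GrFactorization (bimodule K 1)} (hS : IsFactorization K S)
    (a : Fin 3 → VV K) : S.r (kappa K a) = rowMap (row K) a :=
  congrArg (fun f : (Fin 3 → VV K) →ₗ[(VV K)ᵐᵒᵖ] VV K => f a) hS.2.1

theorem existsUnique_factorization :
    ∃! S : GrFactorization (bimodule K 1), IsFactorization K S := by
  refine ⟨factorization K, isFactorization_factorization K, fun S hS => ?_⟩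
  refine GrFactorization.ext hS.1 ?_ hS.2.2
  refine LinearMap.ext fun m => ?_
  obtain ⟨a, rfl⟩ := (kappa_bijective K).2 m
  exact (hS.r_kappa a).trans (factR_kappa K a).symm

end DeRham

/-! ### The canonical isomorphism -/

variable (K : Type u) [CommRing K] (d : ℤ)

/-- The canonical morphism from the de Rham bimodule to the graded Betti bimodule. -/
def canonicalHom : DeRham.bimodule K d ⟶ (Betti.bimodule K d).gr :=
  { g := DeRham.gV K
    φ := DeRham.phi K d
    f := DeRham.fW K
    map_act := fun m a => DeRham.phi_op_smul K d a m
    map_ρ := fun b m => DeRham.phi_actL K d b m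
    g_mem := DeRham.gV_mem K
    φ_mem := DeRham.phi_mem K d
    f_mem := DeRham.fW_mem K : GrBimodule.Hom (DeRham.bimodule K d) (Betti.bimodule K d).gr }

theorem grLeft_grGen (i : Fin 2) : Betti.grLeft K (Betti.grGen K (Betti.X i)) =
    cls (Betti.filVV K) 1 ⟨Betti.e K i ⊗ₜ 1, Betti.e_tmul_mem K i⟩ := by
  rw [Betti.grLeft, Betti.grGen, grAlgHom_cls]
  rfl

theorem grRight_grGen (i : Fin 2) : Betti.grRight K (Betti.grGen K (Betti.X i)) =
    cls (Betti.filVV K) 1 ⟨1 ⊗ₜ Betti.e K i, Betti.tmul_e_mem K i⟩ := by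
  rw [Betti.grRight, Betti.grGen, grAlgHom_cls]
  rfl

theorem fW_ee_tmul (i : Fin 2) : DeRham.fW K (DeRham.ee K i ⊗ₜ 1) =
    cls (Betti.filVV K) 1 ⟨Betti.e K i ⊗ₜ 1, Betti.e_tmul_mem K i⟩ := by
  rw [DeRham.fW_tmul_one, DeRham.gV_ee, grLeft_grGen]

theorem fW_tmul_ee (i : Fin 2) : DeRham.fW K (1 ⊗ₜ DeRham.ee K i) =
    cls (Betti.filVV K) 1 ⟨1 ⊗ₜ Betti.e K i, Betti.tmul_e_mem K i⟩ := by
  rw [DeRham.fW_one_tmul, DeRham.gV_ee, grRight_grGen]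

theorem isCanonical_canonicalHom : IsCanonical K (canonicalHom K d) where
  g_e i := DeRham.gV_ee K i
  f_e_tmul i := fW_ee_tmul K i
  f_tmul_e i := fW_tmul_ee K i
  φ_t i := DeRham.phi_m K d i

variable {K d} in
/-- The algebras `V^DR` and `V^DR ⊗ V^DR` and the right module `M^DR` are generated by the elements
whose images are prescribed. -/
theorem IsCanonical.hom_eq {Φ Φ' : DeRham.bimodule K d ⟶ (Betti.bimodule K d).gr}
    (h : IsCanonical K Φ) (h' : IsCanonical K Φ') : Φ = Φ' := by
  have hf : Φ.f = Φ'.f := DeRham.VV_hom_ext (K := K) (f := Φ.f) (g := Φ'.f)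
    (fun i => (h.f_e_tmul i).trans (h'.f_e_tmul i).symm)
    (fun i => (h.f_tmul_e i).trans (h'.f_tmul_e i).symm)
  refine GrBimodule.Hom.ext ?_ ?_ hf
  · exact DeRham.V_hom_ext (K := K) (f := Φ.g) (g := Φ'.g)
      (fun i => (h.g_e i).trans (h'.g_e i).symm)
  · refine LinearMap.ext fun μ => ?_
    obtain ⟨a, rfl⟩ := DeRham.kappa_surjective K μ
    have e : DeRham.kappa K a = ∑ i, op (a i) • DeRham.m K i := by
      change ∑ i, KerTensor.tmul _ _ (DeRham.u K i) (a i) = _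
      refine Finset.sum_congr rfl fun i _ => ?_
      rw [DeRham.m, KerTensor.op_smul_tmul, one_mul]
    rw [e]
    refine (map_sum Φ.φ _ _).trans ((Finset.sum_congr rfl fun i _ => ?_).trans
      (map_sum Φ'.φ _ _).symm)
    refine (Φ.map_act (DeRham.m K i) (a i)).trans (Eq.trans ?_
      (Φ'.map_act (DeRham.m K i) (a i)).symm)
    rw [hf]
    exact congrArg _ ((h.φ_t i).trans (h'.φ_t i).symm)

/-- The canonical morphism, as an isomorphism of graded bimodules. -/
def canonicalIso : DeRham.bimodule K d ≅ (Betti.bimodule K d).gr :=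
  GrBimodule.isoOfBijective (canonicalHom K d) (DeRham.gV_bijective K) (DeRham.phi_bijective K d)
    (DeRham.fW_bijective K)

theorem existsUnique_isCanonical :
    ∃! Φ : DeRham.bimodule K d ≅ (Betti.bimodule K d).gr, IsCanonical K Φ.hom :=
  ⟨canonicalIso K d, isCanonical_canonicalHom K d,
    fun _ h => Iso.ext (h.hom_eq (isCanonical_canonicalHom K d))⟩

/-! ### Compatibility with the factorization structures -/

/-- The rows have the same class in degree `0`, since `X_1 - 1` and `Y_1 - 1` have degree `1`. -/
theorem fW_row (i : Fin 3) : DeRham.fW K (DeRham.row K i) =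
    cls (Betti.filVV K) 0 ⟨Betti.row K i, Betti.row_mem K i⟩ := by
  have hY : Betti.Y1 K - 1 ∈ Betti.filVV K 1 := by
    have := Betti.tmul_e_mem K 1
    rwa [Betti.e, TensorProduct.tmul_sub] at this
  have hX : Betti.X1 K - 1 ∈ Betti.filVV K 1 := by
    have := Betti.e_tmul_mem K 1
    rwa [Betti.e, TensorProduct.sub_tmul] at this
  have key : ∀ w (hw : w ∈ Betti.filVV K 0), w - 1 ∈ Betti.filVV K 1 →
      cls (Betti.filVV K) 0 ⟨w, hw⟩ = 1 := fun w hw h => by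
    rw [gr_one, ← sub_eq_zero, ← map_sub]
    exact cls_eq_zero _ h
  fin_cases i
  · exact (map_one _).trans (key _ _ hY).symm
  · have h2 : Betti.X1 K * Betti.Y1 K - 1 ∈ Betti.filVV K 1 := by
      have h0 : Betti.X1 K ∈ Betti.filVV K 0 := by
        rw [Betti.filVV_of_nonpos K 0 le_rfl]; trivial
      have h3 := IsAlgFiltration.mul_mem (F := Betti.filVV K) 0 1 _ h0 _ hY
      rw [zero_add] at h3
      have := add_mem h3 hX
      rwa [mul_sub, mul_one, sub_add_sub_cancel] at this
    have h0 : Betti.X1 K * Betti.Y1 K ∈ Betti.filVV K 0 := by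
      rw [Betti.filVV_of_nonpos K 0 le_rfl]; trivial
    have h4 := congrArg (fun x => -x) (key _ h0 h2)
    refine (map_neg (DeRham.fW K) 1).trans ?_
    rw [map_one]
    refine h4.symm.trans ((map_neg (cls (Betti.filVV K) 0) _).symm.trans ?_)
    exact cls_congr rfl (neg_mul (Betti.X1 K) (Betti.Y1 K)).symm
  · exact (map_zero (DeRham.fW K)).trans (map_zero (cls (Betti.filVV K) 0)).symm

/-- The columns have the same class in degree `1`: the entries are `e_1`, `-f_1` on one side and, up
to the factor `Y_1⁻¹`, `X_1 - 1` and `1 - Y_1` on the other. -/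
theorem fW_col (i : Fin 3) : DeRham.fW K (DeRham.col K i) =
    cls (Betti.filVV K) 1 ⟨Betti.col K i, Betti.col_mem K i⟩ := by
  have hX : Betti.X1 K - 1 = Betti.e K 1 ⊗ₜ 1 := by
    rw [Betti.e, TensorProduct.sub_tmul]; rfl
  have hY : 1 - Betti.Y1 K = -(1 ⊗ₜ Betti.e K 1) := by
    rw [Betti.e, TensorProduct.tmul_sub, neg_sub]; rfl
  have hY' : Betti.Y1inv K - 1 ∈ Betti.filVV K 1 := by
    have := mem_convolve' (β := TensorProduct.mk K (Betti.V K) (Betti.V K)) (zero_add 1)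
      (IsAlgFiltration.one_mem (F := Betti.augFil K Betti.F2))
      (Betti.of_sub_one_mem_augFil K (Betti.X 1)⁻¹)
    rwa [TensorProduct.mk_apply, TensorProduct.tmul_sub] at this
  -- multiplication by `Y_1⁻¹` does not change classes, since `Y_1⁻¹ - 1` has degree `1`
  have key : ∀ w w' (hw : w ∈ Betti.filVV K 1) (hw' : Betti.Y1inv K * w' ∈ Betti.filVV K 1),
      w = w' → cls (Betti.filVV K) 1 ⟨w, hw⟩ = cls (Betti.filVV K) 1 ⟨Betti.Y1inv K * w', hw'⟩ := by
    rintro w _ hw hw' rfl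
    refine Eq.symm ?_
    rw [← sub_eq_zero, ← map_sub]
    refine cls_eq_zero _ ?_
    change Betti.Y1inv K * w - w ∈ _
    have := IsAlgFiltration.mul_mem (F := Betti.filVV K) 1 1 _ hY' _ hw
    rwa [sub_mul, one_mul] at this
  fin_cases i
  · exact (fW_ee_tmul K 1).trans (key _ _ _ _ hX.symm)
  · refine (map_neg (DeRham.fW K) _).trans ?_
    rw [fW_tmul_ee, ← map_neg]
    exact key _ _ (neg_mem (Betti.tmul_e_mem K 1)) _ hY.symm
  · exact (map_zero (DeRham.fW K)).trans (map_zero (cls (Betti.filVV K) 1)).symm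

/-- `gr_0 r` on `gr M^B`. -/
def grFactR : Gr (Betti.filM K 1) →ₗ[K] Gr (Betti.filVV K) := (Betti.factorization K).grR

/-- `gr_1 c` on `gr (V^B ⊗ V^B)`. -/
def grFactC : Gr (Betti.filVV K) →ₗ[K] Gr (Betti.filM K 1) := (Betti.factorization K).grC

theorem grFactR_actGr (μ : Gr (Betti.filM K 1)) (a : Gr (Betti.filVV K)) :
    grFactR K (Betti.actGr K 1 μ a) = grFactR K μ * a := (Betti.factorization K).grR_grAct μ a

theorem grFactC_mul (a b : Gr (Betti.filVV K)) :
    grFactC K (a * b) = Betti.actGr K 1 (grFactC K a) b := (Betti.factorization K).grC_mul a b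

theorem m_eq_kappa (i : Fin 3) : Betti.m K i = Betti.kappa K (Pi.single i 1) := by
  refine ((Betti.eq_sum_op_smul_m K _).trans (Finset.sum_congr rfl fun j _ => ?_)).trans
    (Betti.eq_sum_op_smul_m K _).symm
  rw [Betti.coord_m, Betti.coord_kappa, Pi.single_apply]

theorem grFactR_mGr (i : Fin 3) : grFactR K (Betti.mGr K 1 i) = DeRham.fW K (DeRham.row K i) := by
  rw [fW_row]
  refine ((Betti.factorization K).grR_cls (1 - 1) ⟨Betti.m K i, Betti.m_mem K 1 i⟩).trans ?_
  refine cls_congr (sub_self 1) ?_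
  change Betti.factR K (Betti.m K i) = Betti.row K i
  rw [m_eq_kappa, Betti.factR_kappa]
  change ∑ j, Betti.row K j * Pi.single (M := fun _ => Betti.VV K) i 1 j = _
  rw [Finset.sum_eq_single i (fun k _ h => by rw [Pi.single_eq_of_ne h, mul_zero])
    (fun h => absurd (Finset.mem_univ i) h), Pi.single_eq_same, mul_one]

theorem grCoord_grFactC_one (i : Fin 3) :
    Betti.grCoord K 1 i (grFactC K 1) = DeRham.fW K (DeRham.col K i) := by
  rw [fW_col]
  have h : grFactC K 1 = cls (Betti.filM K 1) (0 + 1)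
      ⟨Betti.factC K 1, Betti.factC_mem K IsAlgFiltration.one_mem⟩ :=
    (Betti.factorization K).grC_cls 0 ⟨1, IsAlgFiltration.one_mem⟩
  rw [h, Betti.grCoord_cls]
  refine cls_congr (by ring) ?_
  change Betti.coord K i (Betti.kappa K (colMap (Betti.col K) 1)) = Betti.col K i
  rw [Betti.coord_kappa]
  exact mul_one _

theorem fW_factR (μ : DeRham.M K) :
    DeRham.fW K (DeRham.factR K μ) = grFactR K (DeRham.phi K 1 μ) := by
  obtain ⟨a, rfl⟩ := DeRham.kappa_surjective K μ
  rw [DeRham.factR_kappa, DeRham.phi_kappa, map_sum]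
  change DeRham.fW K (∑ i, DeRham.row K i * a i) = _
  rw [map_sum]
  refine Finset.sum_congr rfl fun i _ => ?_
  rw [map_mul, grFactR_actGr, grFactR_mGr]

theorem phi_factC (a : DeRham.VV K) :
    DeRham.phi K 1 (DeRham.factC K a) = grFactC K (DeRham.fW K a) := by
  have h : grFactC K (DeRham.fW K a) = Betti.actGr K 1 (grFactC K 1) (DeRham.fW K a) := by
    rw [← grFactC_mul]
    exact congrArg _ (one_mul (DeRham.fW K a)).symm
  rw [h, ← Betti.sum_actGr_grCoord K 1 (grFactC K 1), map_sum, LinearMap.sum_apply]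
  refine (DeRham.phi_kappa K 1 _).trans (Finset.sum_congr rfl fun i _ => ?_)
  rw [grCoord_grFactC_one, ← Betti.actGr_mul, ← map_mul]
  rfl

/-- The canonical isomorphism preserves the factorization structures, and a morphism of `BFS_gr` is
determined by its underlying morphism of bimodules. -/
theorem existsUnique_bfsIso :
    ∃! Ψ : (⟨DeRham.bimodule K 1, DeRham.factorization K⟩ : BFSGr K) ≅
        (⟨Betti.bimodule K 1, Betti.factorization K⟩ : BFSFil K).gr,
      IsCanonical K (d := 1) Ψ.hom.hom := by
  refine ⟨BFSGr.isoOfIso (P := ⟨DeRham.bimodule K 1, DeRham.factorization K⟩)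
    (Q := (⟨Betti.bimodule K 1, Betti.factorization K⟩ : BFSFil K).gr) (canonicalIso K 1)
    (DeRham.gV_ee K 1) (fW_factR K) (phi_factC K), isCanonical_canonicalHom K 1, fun Ψ h => ?_⟩
  exact Iso.ext (BFSGr.Hom.ext (h.hom_eq (isCanonical_canonicalHom K 1)))

end

end BFSTheory

theorem mainTheorem1 (K : Type u) [CommRing K] [Algebra ℚ K] :
    (∀ d : ℤ, ∃! Φ : BFSTheory.DeRham.bimodule K d ≅ (BFSTheory.Betti.bimodule K d).gr,
      BFSTheory.IsCanonical K Φ.hom) ∧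
    Function.Bijective (BFSTheory.Betti.kappa K) ∧
    Function.Bijective (BFSTheory.DeRham.kappa K) ∧
    (∃! SB : BFSTheory.FilFactorization (BFSTheory.Betti.bimodule K 1),
      BFSTheory.Betti.IsFactorization K SB) ∧
    (∃! SD : BFSTheory.GrFactorization (BFSTheory.DeRham.bimodule K 1),
      BFSTheory.DeRham.IsFactorization K SD) ∧
    ∀ (SB : BFSTheory.FilFactorization (BFSTheory.Betti.bimodule K 1))
      (SD : BFSTheory.GrFactorization (BFSTheory.DeRham.bimodule K 1)),
      BFSTheory.Betti.IsFactorization K SB → BFSTheory.DeRham.IsFactorization K SD →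
      ∃! Ψ : (⟨BFSTheory.DeRham.bimodule K 1, SD⟩ : BFSTheory.BFSGr K) ≅
          (⟨BFSTheory.Betti.bimodule K 1, SB⟩ : BFSTheory.BFSFil K).gr,
        BFSTheory.IsCanonical K (d := 1) Ψ.hom.hom := by
  refine ⟨BFSTheory.existsUnique_isCanonical K, BFSTheory.Betti.kappa_bijective K,
    BFSTheory.DeRham.kappa_bijective K, BFSTheory.Betti.existsUnique_factorization K,
    BFSTheory.DeRham.existsUnique_factorization K, fun SB SD hB hD => ?_⟩
  obtain rfl := (BFSTheory.Betti.existsUnique_factorization K).unique hB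
    (BFSTheory.Betti.isFactorization_factorization K)
  obtain rfl := (BFSTheory.DeRham.existsUnique_factorization K).unique hD
    (BFSTheory.DeRham.isFactorization_factorization K)
  exact BFSTheory.existsUnique_bfsIso K
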